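/- Let $N\ge 1$ be an integer and let $\lambda,\mu>0$ be real. The $B_N$ Calogero Hamiltonian is $$H=\sum_{j=1}^N\Big(-\partial_{x_j}^2+x_j^2+\frac{\mu(\mu-1)}{x_j^2}\Big)+4\lambda(\lambda-1)\sum_{1\le j<k\le N}\frac{x_j^2+x_k^2}{(x_j^2-x_k^2)^2},$$ considered on the set of $\mathbf x\in\mathbb R^N$ with all $x_j\neq0$ and $x_j^2\ne x_k^2$ for $j\neq k$. Put $$\psi_0(\mathbf x)=\prod_{j=1}^N e^{-x_j^2/2}x_j^{\mu}\prod_{j<k}(x_k^2-x_j^2)^{\lambda}$$ (principal powers). For $\mathbf m\in\mathbb Z^N$ and $\varepsilon>0$ define $$f_{\mathbf m}(\mathbf x)=\prod_{j=1}^N\Big(\oint_{\mathcal C_j}\frac{dy_j}{2\pi i\,y_j}\,y_j^{2m_j}\Big)\frac{\prod_{j<k}(1-y_j^2/y_k^2)^{\lambda}}{\prod_{j,k=1}^N(1-x_j^2/y_k^2)^{\lambda}},$$ where $\mathcal C_j$ is the positively oriented circle $|y_j|=\max_k|x_k|+\varepsilon j$ and powers are principal. Let $\mathbf e_1,\dots,\mathbf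 e_N$ be the standard basis of $\mathbb Z^N$, $|\mathbf m|=m_1+\dots+m_N$, $\tilde m_j=m_j+\lambda(N+1-j)$, $\mathbf E_{jk}^{\nu}=(1-\nu)\mathbf e_j+\nu\mathbf e_k$, and $$g_{jk}(\nu;\mathbf m)=4\lambda(\lambda-1)(2\nu-1)(1-\delta_{\nu,0})(1-\delta_{jk})-2\big(2(\tilde m_j+\mu-\lambda)+1\big)\tilde m_j\,\delta_{\nu,0}\delta_{jk}.$$ For $\mathbf n\in\mathbb Z^N$ let $P_{\mathbf n}=\sum_{\mathbf m\in\mathbb Z^N}\alpha_{\mathbf n}(\mathbf m)f_{\mathbf m}$, where $$\alpha_{\mathbf n}(\mathbf m)=\delta_{\mathbf n,\mathbf m}+\sum_{s=1}^\infty\frac1{4^ss!}\sum_{j_1\le k_1}\cdots\sum_{j_s\le k_s}\ \sum_{\nu_1,\dots,\nu_s=0}^\infty\delta_{\mathbf n,\ \mathbf m+\sum_{r=1}^s\mathbf E_{j_rk_r}^{\nu_r}}\prod_{r=1}^s g_{j_rk_r}\Big(\nu_r;\mathbf n-\sum_{\ell=1}^r\mathbf E_{j_\ell k_\ell}^{\nu_\ell}\Big).$$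 Then, for every $\mathbf n\in\mathbb Z^N$, all these sums have only finitely many non-zero terms (in the sum for $P_{\mathbf n}$: only finitely many $\mathbf m$, independently of $\mathbf x$ and $\varepsilon$), and $P_{\mathbf n}$ is a reduced polynomial eigenfunction of $H$ with eigenvalue $$E_{\mathbf n}=4|\mathbf n|+N\big(1+2\mu+2\lambda(N-1)\big),$$ in the following sense: $P_{\mathbf n}$ does not depend on $\varepsilon$ and is a symmetric polynomial, with real coefficients, in $x_1^2,\dots,x_N^2$; the function $\psi_0P_{\mathbf n}$ is $C^2$ and satisfies $H\psi_0P_{\mathbf n}=E_{\mathbf n}\psi_0P_{\mathbf n}$ on the set above; and $P_{\mathbf n}\neq0$ whenever $\mathbf n$ is a partition, i.e. $n_1\ge\dots\ge n_N\ge0$. -/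

import Mathlib

open scoped BigOperators

noncomputable section

namespace CalogeroBN

/-- The open subset of `ℝ^N` on which the potential of the `B_N` Hamiltonian is non-singular. -/
def regularSet (N : ℕ) : Set (Fin N → ℝ) :=
  {x | (∀ j, x j ≠ 0) ∧ ∀ j k, j ≠ k → x j ^ 2 ≠ x k ^ 2}

/-- The second partial derivative of `ψ` with respect to the `j`-th coordinate. -/
def partialSq {N : ℕ} (j : Fin N) (ψ : (Fin N → ℝ) → ℂ) (x : Fin N → ℝ) : ℂ :=
  iteratedDeriv 2 (fun t : ℝ => ψ (Function.update x j t)) (x j)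

/-- The `B_N` Calogero Hamiltonian with couplings `lam`, `mu`, as a differential expression. -/
def hamiltonian {N : ℕ} (lam mu : ℝ) (ψ : (Fin N → ℝ) → ℂ) (x : Fin N → ℝ) : ℂ :=
  (∑ j, (-partialSq j ψ x + ((x j ^ 2 + mu * (mu - 1) / x j ^ 2 : ℝ) : ℂ) * ψ x)) +
    ((4 * lam * (lam - 1) *
      ∑ j, ∑ k ∈ Finset.Ioi j, (x j ^ 2 + x k ^ 2) / (x j ^ 2 - x k ^ 2) ^ 2 : ℝ) : ℂ) * ψ x

/-- `ψ` is a classical solution of the Schroedinger equation `H ψ = E ψ`.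
(It is not required here that `ψ` be non-zero.) -/
def SolvesSchroedinger {N : ℕ} (lam mu E : ℝ) (ψ : (Fin N → ℝ) → ℂ) : Prop :=
  ContDiffOn ℝ 2 ψ (regularSet N) ∧
    ∀ x ∈ regularSet N, hamiltonian lam mu ψ x = (E : ℂ) * ψ x

/-- The groundstate `∏_j e^{-x_j²/2} x_j^mu ∏_{j<k} (x_k² - x_j²)^lam`; powers are principal
complex powers, so that it is defined at all real points. -/
def groundState {N : ℕ} (lam mu : ℝ) (x : Fin N → ℝ) : ℂ :=
  (∏ j, ((Real.exp (-(x j ^ 2) / 2) : ℝ) : ℂ) * ((x j : ℝ) : ℂ) ^ (mu : ℂ)) *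
    ∏ j, ∏ k ∈ Finset.Ioi j, ((x k ^ 2 - x j ^ 2 : ℝ) : ℂ) ^ (lam : ℂ)

/-- The radius `max_k |x_k| + ε j` of the `j`-th circle, `j = 1, …, N` (here `j` is counted
from `0`). The norm of `Fin N → ℝ` is the maximum norm. -/
def radius {N : ℕ} (ε : ℝ) (x : Fin N → ℝ) (j : Fin N) : ℝ :=
  ‖x‖ + ε * ((j : ℕ) + 1 : ℝ)

/-- The `B_N` function `f_n(x)`, an `N`-fold contour integral over the nested circles; all
non-integer powers are principal, and their bases have positive real part on the contours. -/
def f {N : ℕ} (lam ε : ℝ) (n : Fin N → ℤ) (x : Fin N → ℝ) : ℂ :=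
  torusIntegral (fun y : Fin N → ℂ =>
      (∏ j, y j ^ (2 * n j) / (2 * (Real.pi : ℂ) * Complex.I * y j)) *
        ((∏ j, ∏ k ∈ Finset.Ioi j, (1 - y j ^ 2 / y k ^ 2) ^ (lam : ℂ)) /
          ∏ j, ∏ k, (1 - (x j : ℂ) ^ 2 / y k ^ 2) ^ (lam : ℂ)))
    0 (radius ε x)

/-- `m̃_j = m_j + lam (N + 1 - j)` for `j = 1, …, N` (here `j` is counted from `0`). -/
def tilde {N : ℕ} (lam : ℝ) (m : Fin N → ℤ) (j : Fin N) : ℝ :=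
  (m j : ℝ) + lam * ((N : ℝ) - (j : ℕ))

/-- The coefficients `g_{jk}(ν; m)`. -/
def g {N : ℕ} (lam mu : ℝ) (j k : Fin N) (ν : ℕ) (m : Fin N → ℤ) : ℝ :=
  4 * lam * (lam - 1) * (2 * (ν : ℝ) - 1) * (1 - if ν = 0 then 1 else 0) *
      (1 - if j = k then 1 else 0) -
    2 * (2 * (tilde lam m j + mu - lam) + 1) * tilde lam m j *
      (if ν = 0 then 1 else 0) * (if j = k then 1 else 0)

/-- The shift `E_{jk}^ν = (1 - ν) e_j + ν e_k`. -/
def shift {N : ℕ} (j k : Fin N) (ν : ℕ) : Fin N → ℤ :=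
  (1 - (ν : ℤ)) • Pi.single j (1 : ℤ) + (ν : ℤ) • Pi.single k (1 : ℤ)

/-- The index pairs `j ≤ k`. -/
abbrev IdxPair (N : ℕ) : Type := {p : Fin N × Fin N // p.1 ≤ p.2}

/-- A single term of the `s`-fold sum in `α_n(m)`, for given pairs `j_r ≤ k_r` and given `ν_r`. -/
def alphaTerm {N : ℕ} (lam mu : ℝ) (n m : Fin N → ℤ) (s : ℕ)
    (p : Fin s → IdxPair N) (ν : Fin s → ℕ) : ℝ :=
  (if m + ∑ r, shift (p r).1.1 (p r).1.2 (ν r) = n then 1 else 0) *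
    ∏ r, g lam mu (p r).1.1 (p r).1.2 (ν r)
      (n - ∑ l ∈ Finset.Iic r, shift (p l).1.1 (p l).1.2 (ν l))

/-- The coefficients `α_n(m)`; the outer sum is over `s + 1 = 1, 2, …`. -/
def alpha {N : ℕ} (lam mu : ℝ) (n m : Fin N → ℤ) : ℝ :=
  (if m = n then 1 else 0) +
    ∑' s : ℕ, 1 / (4 ^ (s + 1) * (Nat.factorial (s + 1) : ℝ)) *
      ∑ p : Fin (s + 1) → IdxPair N, ∑' ν : Fin (s + 1) → ℕ, alphaTerm lam mu n m (s + 1) p ν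

/-- `P_n = ∑_m α_n(m) f_m`, the sum being over all `m ∈ ℤ^N`. -/
def P {N : ℕ} (lam mu ε : ℝ) (n : Fin N → ℤ) (x : Fin N → ℝ) : ℂ :=
  ∑' m : Fin N → ℤ, (alpha lam mu n m : ℂ) * f lam ε m x

/-- `E_n = 4 |n| + N (1 + 2 mu + 2 lam (N - 1))`. -/
def energy {N : ℕ} (lam mu : ℝ) (n : Fin N → ℤ) : ℝ :=
  4 * ((∑ j, n j : ℤ) : ℝ) + (N : ℝ) * (1 + 2 * mu + 2 * lam * ((N : ℝ) - 1))

end CalogeroBN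

end

/-!
The `B_N` Calogero Hamiltonian and its eigenfunctions `P_n = ∑ α_n(m) f_m`.

Conjugation with the groundstate turns the Hamiltonian into a second order operator acting on
polynomials in `z_j = x_j²` (`hamiltonian_groundState_mul`); the three-body terms produced by the
groundstate cancel (`sum_mul_sum_sq`). The statement thus concerns polynomials only, once the
contour integrals `f_m` have been identified.

*The functions `f_m`.* With `t_l = 1 / y_l²` the integrand of `f_m` is a monomial times
`∏_{j<k} (1 - t_k / t_j)^lam ∏_{j,k} (1 - z_j t_k)^(-lam)`, which on the contours is an absolutely
convergent power series in `v_0 = t_0` and `v_i = t_i / t_{i-1}`. Integrating termwise,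
`f_eq_eval_fPol` identifies `f_m` with the coefficient of `∏ t_l ^ m_l` in this formal power
series `genSer`. In terms of the `v_i`, that is the coefficient of `∏ v_i ^ (suf m i)`, where
`suf m i` is `∑_{k ≥ i} m_k`; in particular `f_m = 0` unless all these sums are non-negative.
Everything else takes place in the ring of power series, whose coefficients are polynomials in
`z`.

*The recurrence.* On the generating function, the operator in `z` agrees with an operator in `t`.
This kernel function identity is proved in an arbitrary domain with derivations
(`kernel_identity`) and specialized in `genSer_identity`. Comparing coefficients shows that the
conjugated Hamiltonian maps `f_m` to a multiple of `f_m` plus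
`∑ g_{jk}(ν; m - E_{jk}^ν) f_{m - E_{jk}^ν}` (`zOp_fPol`). Each shift `E_{jk}^ν` has `|E| = 1` and
does not decrease the sums `suf`, and `g` vanishes unless `ν = 0`, `j = k` or `ν ≥ 1`, `j < k`.
Hence all sums are finite, and the coefficients `α_n(m)` satisfy the recursion
`4 (|n| - |m|) α_n(m) = ∑ g_{jk}(ν; m) α_n(m + E_{jk}^ν)` (`alpha_recursion`, obtained by
splitting off the last factor). It says exactly that `∑ α_n(m) f_m` is an eigenfunction
(`eigenPol_equation`).

*Non-vanishing.* `f_m` is homogeneous of degree `|m|`, and `α_n(m) ≠ 0` with `|m| = |n|` forces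
`m = n`; so `f_n` is the leading part of `P_n`, and it suffices that `f_n ≠ 0` for a partition `n`
(`fPol_ne_zero`). Let `c(q)` be the coefficient of `∏ t_l ^ n_l` in
`∏_{j<k} (1 - t_k / t_j)^lam q(t)`. Applying `c` in the variables `z` to the expansion of
`∏ (1 - z_j t_k)^(-lam)` in products of power sums, all of whose coefficients are positive, shows
that `c(f_n)` is a positive combination of the squares `c(p_r p_s ⋯)²`. If `f_n = 0`, then `c`
kills all products of power sums, hence all symmetric polynomials. But on the sum of all
permutations of the monomial `∏ t_l ^ n_l` it takes a positive value: as `n` is decreasing, only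
the permutations fixing `n` contribute, each of them by `1`. The positivity is obtained without
writing down the expansion, from Euler's identity for the kernel (`quad_recursion`).
-/

noncomputable section

namespace CalogeroBN

/-! ### Symmetrization of finite sums -/

section Sums

variable {ι M : Type*} [Fintype ι]

/-- A triple sum vanishes when its summand has vanishing cyclic sums. -/
theorem sum_sum_sum_eq_zero_of_cyclic [AddCommGroup M] [Module ℝ M] (h : ι → ι → ι → M)
    (hh : ∀ i j k, h i j k + h j k i + h k i j = 0) : ∑ i, ∑ j, ∑ k, h i j k = 0 := by
  have h0 : ∀ u : ι → ι → ι → M, ∑ i, ∑ j, ∑ k, u j k i = ∑ i, ∑ j, ∑ k, u i j k := fun u => by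
    rw [Finset.sum_comm]
    exact Finset.sum_congr rfl fun j _ => Finset.sum_comm
  have h1 := h0 h
  have h2 : ∑ i, ∑ j, ∑ k, h k i j = ∑ i, ∑ j, ∑ k, h i j k := (h0 fun i j k => h k i j).symm
  have h3 : (3 : ℝ) • ∑ i, ∑ j, ∑ k, h i j k = 0 := by
    have : ∑ i, ∑ j, ∑ k, (h i j k + h j k i + h k i j) = 0 := by simp [hh]
    simp only [Finset.sum_add_distrib] at this
    rw [h1, h2] at this
    rw [← this]; module
  exact (smul_eq_zero.1 h3).resolve_left (by norm_num)

/-- A double sum vanishes when its summand is antisymmetric. -/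
theorem sum_sum_eq_zero_of_antisymm [AddCommGroup M] [Module ℝ M] (h : ι → ι → M)
    (hh : ∀ i j, h i j + h j i = 0) : ∑ i, ∑ j, h i j = 0 := by
  have h3 : (2 : ℝ) • ∑ i, ∑ j, h i j = 0 := by
    have : ∑ i, ∑ j, (h i j + h j i) = 0 := by simp [hh]
    simp only [Finset.sum_add_distrib] at this
    rw [Finset.sum_comm (f := fun i j => h j i)] at this
    rw [← this]; module
  exact (smul_eq_zero.1 h3).resolve_left (by norm_num)

theorem sum_sum_eq_sum_Ioi [AddCommMonoid M] {N : ℕ} (h : Fin N → Fin N → M)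
    (h0 : ∀ i, h i i = 0) :
    ∑ i, ∑ j, h i j = ∑ i, ∑ j ∈ Finset.Ioi i, (h i j + h j i) := by
  have h1 : ∑ i, ∑ j ∈ Finset.Ioi i, h j i = ∑ i, ∑ j ∈ Finset.Iio i, h i j :=
    Finset.sum_comm' (by simp)
  simp only [Finset.sum_add_distrib]
  rw [h1, ← Finset.sum_add_distrib]
  refine Finset.sum_congr rfl fun i _ => ?_
  have : (Finset.univ : Finset (Fin N)) = (Finset.Ioi i ∪ Finset.Iio i) ∪ {i} := by
    ext j; simp only [Finset.mem_univ, Finset.mem_union, Finset.mem_Ioi, Finset.mem_Iio,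
      Finset.mem_singleton, true_iff]
    rcases lt_trichotomy i j with h | h | h <;> simp [h]
  rw [this, Finset.sum_union, Finset.sum_union]
  · simp [h0]
  · rw [Finset.disjoint_left]; intro j hj hj'
    simp only [Finset.mem_Ioi, Finset.mem_Iio] at hj hj'; exact lt_asymm hj hj'
  · simp

end Sums

/-! ### The kernel function identity in a ring with derivations -/

section Kernel

variable {ι S : Type*} [Fintype ι] [DecidableEq ι] [CommRing S] [IsDomain S] [Algebra ℝ S]

/-- Three-body cancellation: with `r l k = t k / (t l - t k)` off the diagonal, the mixed terms in
`∑ t l (∑ k, r l k)²` cancel. -/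
theorem sum_mul_sum_sq (t : ι → S) (r : ι → ι → S) (ht : Function.Injective t)
    (r0 : ∀ l, r l l = 0) (hr : ∀ l k, l ≠ k → (t l - t k) * r l k = t k) :
    ∑ l, t l * (∑ k, r l k) ^ 2 = ∑ l, ∑ k, t l * r l k ^ 2 := by
  let h : ι → ι → ι → S := fun l k m => if k = m then 0 else t l * r l k * r l m
  have h0 : ∑ l, ∑ k, ∑ m, h l k m = 0 := by
    refine sum_sum_sum_eq_zero_of_cyclic _ fun i j k => ?_
    by_cases hij : i = j
    · subst hij; simp [h, r0]
    by_cases hik : i = k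
    · subst hik; simp [h, r0]
    by_cases hjk : j = k
    · subst hjk; simp [h, r0]
    have e : h i j k + h j k i + h k i j =
        t i * r i j * r i k + t j * r j k * r j i + t k * r k i * r k j := by
      simp [h, hij, hjk, Ne.symm hik]
    rw [e]
    -- Clearing the denominators `t i - t j`, `t i - t k`, `t j - t k` leaves a polynomial identity.
    have a1 := sub_ne_zero.2 (ht.ne hij)
    have a2 := sub_ne_zero.2 (ht.ne hik)
    have a3 := sub_ne_zero.2 (ht.ne hjk)
    have b1 := hr i j hij
    have b2 := hr i k hik
    have b3 := hr j k hjk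
    have b4 := hr j i (Ne.symm hij)
    have b5 := hr k i (Ne.symm hik)
    have b6 := hr k j (Ne.symm hjk)
    have c1 : r j i = -1 - r i j := mul_left_cancel₀ a1 (by linear_combination -b4 + b1)
    have c2 : r k i = -1 - r i k := mul_left_cancel₀ a2 (by linear_combination -b5 + b2)
    have c3 : r k j = -1 - r j k := mul_left_cancel₀ a3 (by linear_combination -b6 + b3)
    rw [c1, c2, c3]
    refine mul_left_cancel₀ a3 (mul_left_cancel₀ a2 (mul_left_cancel₀ a1 ?_))
    have : (t i - t j) * ((t i - t k) * ((t j - t k) * (t i * r i j * r i k +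
        t j * r j k * (-1 - r i j) + t k * (-1 - r i k) * (-1 - r j k)))) =
        t i * (t j - t k) * ((t i - t j) * r i j) * ((t i - t k) * r i k) +
        t j * (t i - t k) * ((t j - t k) * r j k) * (-(t i - t j) - (t i - t j) * r i j) +
        t k * (t i - t j) * (-(t i - t k) - (t i - t k) * r i k) *
          (-(t j - t k) - (t j - t k) * r j k) := by ring
    rw [this, b1, b2, b3]; ring
  have h1 : ∀ l, t l * (∑ k, r l k) ^ 2 = ∑ k, ∑ m, h l k m + ∑ k, t l * r l k ^ 2 := by
    intro l
    rw [sq, Finset.sum_mul_sum, Finset.mul_sum, ← Finset.sum_add_distrib]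
    refine Finset.sum_congr rfl fun k _ => ?_
    have : ∑ m, h l k m =
        ∑ m, (t l * r l k * r l m - if k = m then t l * r l k * r l m else 0) := by
      refine Finset.sum_congr rfl fun m _ => ?_
      simp only [h]; split_ifs <;> ring
    rw [this, Finset.sum_sub_distrib, Finset.sum_ite_eq, Finset.mul_sum, if_pos (Finset.mem_univ _)]
    rw [Finset.sum_congr rfl fun m _ => (mul_assoc (t l) (r l k) (r l m)).symm]
    ring
  rw [Finset.sum_congr rfl fun l _ => h1 l, Finset.sum_add_distrib, h0, zero_add]

/-- The action of the `z`-operator on a kernel function equals the action of a `t`-operator. Here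
`p j k = 1 / (1 - z j t k)` and `r l k = t k / (t l - t k)`, and `F` is given by its logarithmic
derivatives. -/
theorem kernel_identity (z t e : ι → S) (p r : ι → ι → S) (lam c F : S)
    (D T : ι → Derivation ℝ S S) (ht : Function.Injective t)
    (r0 : ∀ l, r l l = 0) (hr : ∀ l k, l ≠ k → (t l - t k) * r l k = t k)
    (hp : ∀ j k, p j k = 1 + z j * t k * p j k)
    (hDp : ∀ j k, D j (p j k) = t k * p j k ^ 2) (hDt : ∀ j k, D j (t k) = 0)
    (hDl : ∀ j, D j lam = 0)
    (hTp : ∀ j l, T l (p j l) = p j l ^ 2 - p j l)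
    (hTr : ∀ l k, T l (r l k) = -(r l k * (1 + r l k)))
    (hTl : ∀ l, T l lam = 0)
    (hD : ∀ j, D j F = lam * (∑ k, t k * p j k) * F)
    (hT : ∀ l, T l F + lam * e l * F = lam * (∑ j, p j l + ∑ k, r l k) * F) :
    ∑ j, z j * D j (D j F) + c * ∑ j, D j F +
        lam * ∑ i, ∑ j, (if i = j then 0 else lam * (∑ k, t k * (p i k * p j k)) * F) =
      ∑ l, t l * ((T l (T l F + lam * e l * F) + lam * e l * (T l F + lam * e l * F)) +
          (c - lam) * (T l F + lam * e l * F)) -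
        lam * (lam - 1) * (∑ l, ∑ k, t l * r l k ^ 2) * F := by
  have hDD : ∀ j, D j (D j F) =
      (lam * ∑ k, t k ^ 2 * p j k ^ 2 + lam ^ 2 * (∑ k, t k * p j k) ^ 2) * F := by
    intro j
    rw [hD j]
    simp only [Derivation.leibniz, smul_eq_mul, map_sum, hDl, hDt, hDp, hD]
    have : ∑ k, (t k * (t k * p j k ^ 2) + p j k * 0) = ∑ k, t k ^ 2 * p j k ^ 2 :=
      Finset.sum_congr rfl fun k _ => by ring
    rw [this]; ring
  have hTT : ∀ l, T l (T l F + lam * e l * F) + lam * e l * (T l F + lam * e l * F) =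
      (lam * (∑ j, (p j l ^ 2 - p j l) - ∑ k, (r l k * (1 + r l k))) +
        lam ^ 2 * (∑ j, p j l + ∑ k, r l k) ^ 2) * F := by
    intro l
    rw [hT l]
    have e1 : T l F = lam * (∑ j, p j l + ∑ k, r l k) * F - lam * e l * F := by
      rw [← hT l]; ring
    simp only [Derivation.leibniz, smul_eq_mul, map_sum, map_add, hTl, hTp, hTr, e1,
      Finset.sum_neg_distrib]
    ring
  simp only [hDD, hTT]
  simp only [hD, hT]
  -- `z t / (1 - z t) = 1 / (1 - z t) - 1`, so that products with `z j` reduce to sums over `p`.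
  have hz : ∀ j k, z j * t k * p j k = p j k - 1 := fun j k => by
    linear_combination -hp j k
  have a1 : ∑ j, z j * ∑ k, t k ^ 2 * p j k ^ 2 = ∑ k, t k * ∑ j, (p j k ^ 2 - p j k) := by
    simp only [Finset.mul_sum]
    rw [Finset.sum_comm]
    refine Finset.sum_congr rfl fun k _ => Finset.sum_congr rfl fun j _ => ?_
    linear_combination t k * p j k * hz j k
  have a2 : ∑ i, ∑ j, (if i = j then 0 else ∑ k, t k * (p i k * p j k)) =
      ∑ k, t k * ((∑ j, p j k) ^ 2 - ∑ j, p j k ^ 2) := by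
    have : ∀ i j, (if i = j then 0 else ∑ k, t k * (p i k * p j k)) =
        ∑ k, t k * (p i k * p j k) - if i = j then ∑ k, t k * (p i k * p j k) else 0 := by
      intro i j; split_ifs <;> simp
    simp only [this, Finset.sum_sub_distrib, Finset.sum_ite_eq, Finset.mem_univ, if_true, mul_sub]
    congr 1
    · rw [Finset.sum_congr rfl fun i _ => Finset.sum_comm, Finset.sum_comm]
      refine Finset.sum_congr rfl fun k _ => ?_
      rw [sq, Finset.sum_mul_sum]; simp only [Finset.mul_sum]
    · rw [Finset.sum_comm]
      refine Finset.sum_congr rfl fun k _ => ?_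
      simp only [Finset.mul_sum, sq]
  -- The terms `k ≠ m` of `∑ z j (∑ k, t k p j k)²`; they match the cross terms between `p` and `r`.
  let X : ι → ι → S := fun k m => t k * t m * ∑ j, z j * (p j k * p j m)
  have a3 : ∑ j, z j * (∑ k, t k * p j k) ^ 2 =
      ∑ k, t k * ∑ j, (p j k ^ 2 - p j k) + ∑ k, ∑ m, (if k = m then 0 else X k m) := by
    have e1 : ∑ j, z j * (∑ k, t k * p j k) ^ 2 = ∑ k, ∑ m, X k m := by
      simp only [X, sq, Finset.sum_mul_sum]
      simp only [Finset.mul_sum]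
      rw [Finset.sum_comm]
      refine Finset.sum_congr rfl fun k _ => ?_
      rw [Finset.sum_comm]
      refine Finset.sum_congr rfl fun m _ => Finset.sum_congr rfl fun j _ => ?_
      ring
    have e2 : ∀ k m, X k m = (if k = m then 0 else X k m) + if k = m then X k m else 0 := by
      intro i j; split_ifs <;> simp
    rw [e1]
    conv_lhs => enter [2, k, 2, m]; rw [e2]
    simp only [Finset.sum_add_distrib, Finset.sum_ite_eq, Finset.mem_univ, if_true]
    rw [add_comm]
    congr 1
    refine Finset.sum_congr rfl fun k _ => ?_
    simp only [X, Finset.mul_sum]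
    refine Finset.sum_congr rfl fun j _ => ?_
    linear_combination t k * p j k * hz j k
  -- `t l * r l k = t l t k / (t l - t k)` is antisymmetric.
  have hq : ∀ l k, t l * r l k + t k * r k l = 0 := by
    intro l k
    by_cases h : l = k
    · subst h; simp [r0]
    have a := sub_ne_zero.2 (ht.ne h)
    refine mul_left_cancel₀ a ?_
    linear_combination t l * hr l k h - t k * hr k l (Ne.symm h)
  have a4 : ∑ l, t l * ∑ k, r l k = 0 := by
    simp only [Finset.mul_sum]
    exact sum_sum_eq_zero_of_antisymm _ hq
  have a5 := sum_mul_sum_sq t r ht r0 hr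
  have a6 : ∑ k, ∑ m, (if k = m then 0 else X k m) =
      2 * ∑ l, t l * (∑ j, p j l) * ∑ k, r l k := by
    have e : ∑ l, t l * (∑ j, p j l) * ∑ k, r l k = ∑ l, ∑ k, t l * (∑ j, p j l) * r l k :=
      Finset.sum_congr rfl fun l _ => Finset.mul_sum _ _ _
    rw [← sub_eq_zero, e, Finset.mul_sum, ← Finset.sum_sub_distrib]
    simp only [Finset.mul_sum (s := Finset.univ (α := ι)) (f := fun k => t _ * _ * r _ k),
      ← Finset.sum_sub_distrib]
    refine sum_sum_eq_zero_of_antisymm _ fun l k => ?_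
    by_cases h : l = k
    · subst h; simp [r0]
    have h1 : ∑ j, p j l - ∑ j, p j k = (t l - t k) * ∑ j, z j * (p j l * p j k) := by
      rw [← Finset.sum_sub_distrib, Finset.mul_sum]
      refine Finset.sum_congr rfl fun j _ => ?_
      linear_combination p j l * hz j k - p j k * hz j l
    have h2 : X l k = X k l := by
      simp only [X]; rw [mul_comm (t l)]
      congr 1; exact Finset.sum_congr rfl fun j _ => by ring
    simp only [h, Ne.symm h, if_false]
    rw [← h2]
    have h3 := hq l k
    have h4 := hr l k h
    simp only [X]
    linear_combination (-2 * ∑ j, p j k) * h3 - 2 * t l * r l k * h1 -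
      2 * t l * (∑ j, z j * (p j l * p j k)) * h4
  have a7 : ∑ j, ∑ k, t k * p j k = ∑ l, t l * ∑ j, p j l := by
    rw [Finset.sum_comm]; simp only [Finset.mul_sum]
  have a8 : ∑ l, t l * ∑ k, (r l k * (1 + r l k)) = ∑ l, ∑ k, t l * r l k ^ 2 := by
    rw [← zero_add (∑ l, ∑ k, t l * r l k ^ 2), ← a4, ← Finset.sum_add_distrib]
    refine Finset.sum_congr rfl fun l _ => ?_
    simp only [Finset.mul_sum, ← Finset.sum_add_distrib]
    exact Finset.sum_congr rfl fun k _ => by ring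
  -- Each side is a multiple of `F`; the factors agree by the identities above.
  have lhs : ∑ j, z j * ((lam * ∑ k, t k ^ 2 * p j k ^ 2 + lam ^ 2 * (∑ k, t k * p j k) ^ 2) * F) +
      c * ∑ j, lam * (∑ k, t k * p j k) * F +
        lam * ∑ i, ∑ j, (if i = j then 0 else lam * (∑ k, t k * (p i k * p j k)) * F) =
      (lam * ∑ j, z j * ∑ k, t k ^ 2 * p j k ^ 2 + lam ^ 2 * ∑ j, z j * (∑ k, t k * p j k) ^ 2 +
        c * lam * ∑ j, ∑ k, t k * p j k +
        lam ^ 2 * ∑ i, ∑ j, (if i = j then 0 else ∑ k, t k * (p i k * p j k))) * F := by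
    have i1 : ∑ i, ∑ j, (if i = j then 0 else lam * (∑ k, t k * (p i k * p j k)) * F) =
        lam * F * ∑ i, ∑ j, (if i = j then 0 else ∑ k, t k * (p i k * p j k)) := by
      rw [Finset.mul_sum]
      refine Finset.sum_congr rfl fun i _ => ?_
      rw [Finset.mul_sum]
      refine Finset.sum_congr rfl fun j _ => ?_
      split_ifs <;> ring
    have i2 : ∀ A B : ι → S, ∑ j, z j * ((lam * A j + lam ^ 2 * B j) * F) =
        (lam * ∑ j, z j * A j + lam ^ 2 * ∑ j, z j * B j) * F := by
      intro A B
      simp only [Finset.mul_sum, ← Finset.sum_add_distrib, Finset.sum_mul]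
      exact Finset.sum_congr rfl fun j _ => by ring
    rw [i1, ← Finset.sum_mul, ← Finset.mul_sum, i2]
    ring
  rw [lhs, a1, a2, a3, a6, a7]
  have rhs : ∀ A B U V : ι → S, ∑ l, t l * ((lam * (A l - B l) + lam ^ 2 * (U l + V l) ^ 2) * F +
          (c - lam) * (lam * (U l + V l) * F)) =
      (lam * ∑ l, t l * A l - lam * ∑ l, t l * B l +
        lam ^ 2 * (∑ l, t l * U l ^ 2 + 2 * ∑ l, t l * U l * V l + ∑ l, t l * V l ^ 2) +
        (c - lam) * lam * (∑ l, t l * U l + ∑ l, t l * V l)) * F := by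
    intro A B U V
    simp only [Finset.mul_sum, ← Finset.sum_add_distrib, ← Finset.sum_sub_distrib,
      Finset.sum_mul]
    exact Finset.sum_congr rfl fun l _ => by ring
  rw [rhs, a8, a5, a4]
  have a9 : ∑ k, t k * ((∑ j, p j k) ^ 2 - ∑ j, p j k ^ 2) =
      ∑ l, t l * (∑ j, p j l) ^ 2 - ∑ k, t k * ∑ j, (p j k ^ 2 - p j k) -
        ∑ l, t l * ∑ j, p j l := by
    rw [← Finset.sum_sub_distrib, ← Finset.sum_sub_distrib]
    refine Finset.sum_congr rfl fun l _ => ?_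
    rw [Finset.sum_sub_distrib]; ring
  rw [a9]; ring

end Kernel

/-! ### Derivations and lacunary series in the ring of power series -/

section PowerSeries

variable {ι R : Type*} [CommRing R]

/-- The derivation of a power series ring that multiplies the coefficient of `X ^ a` by `w a`. -/
def weightDer [Algebra ℝ R] (w : (ι →₀ ℕ) →+ ℤ) :
    Derivation ℝ (MvPowerSeries ι R) (MvPowerSeries ι R) :=
  Derivation.mk'
    { toFun := fun Φ a => (w a : R) * MvPowerSeries.coeff a Φ
      map_add' := fun Φ Ψ => by
        ext a
        exact mul_add (w a : R) (Φ a) (Ψ a)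
      map_smul' := fun c Φ => by
        ext a
        change (w a : R) * (c • Φ a) = c • ((w a : R) * Φ a)
        rw [mul_smul_comm] }
    (fun Φ Ψ => by
      classical
      let wPhi : MvPowerSeries ι R := fun a => (w a : R) * MvPowerSeries.coeff a Φ
      let wPsi : MvPowerSeries ι R := fun a => (w a : R) * MvPowerSeries.coeff a Ψ
      ext a
      change (w a : R) * MvPowerSeries.coeff a (Φ * Ψ) =
        MvPowerSeries.coeff a (Φ * wPsi) +
        MvPowerSeries.coeff a (Ψ * wPhi)
      rw [mul_comm Ψ, MvPowerSeries.coeff_mul, MvPowerSeries.coeff_mul, MvPowerSeries.coeff_mul,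
        ← Finset.sum_add_distrib, Finset.mul_sum]
      refine Finset.sum_congr rfl fun x hx => ?_
      change _ = MvPowerSeries.coeff x.1 Φ * ((w x.2 : R) * MvPowerSeries.coeff x.2 Ψ) +
        (w x.1 : R) * MvPowerSeries.coeff x.1 Φ * MvPowerSeries.coeff x.2 Ψ
      rw [← Finset.HasAntidiagonal.mem_antidiagonal.1 hx, map_add]
      push_cast; ring)

@[simp] theorem coeff_weightDer [Algebra ℝ R] (w : (ι →₀ ℕ) →+ ℤ)
    (Φ : MvPowerSeries ι R) (a : ι →₀ ℕ) :
    MvPowerSeries.coeff a (weightDer w Φ) = (w a : R) * MvPowerSeries.coeff a Φ := rfl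

/-- The coefficientwise action of a derivation of the coefficient ring. -/
def coeffDer [Algebra ℝ R] (d : Derivation ℝ R R) :
    Derivation ℝ (MvPowerSeries ι R) (MvPowerSeries ι R) :=
  Derivation.mk'
    { toFun := fun Φ a => d (MvPowerSeries.coeff a Φ)
      map_add' := fun Φ Ψ => by
        ext a
        exact map_add d (Φ a) (Ψ a)
      map_smul' := fun c Φ => by
        ext a
        change d (c • Φ a) = c • d (Φ a)
        exact d.map_smul c (Φ a) }
    (fun Φ Ψ => by
      classical
      let wPhi : MvPowerSeries ι R := fun a => d (MvPowerSeries.coeff a Φ)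
      let wPsi : MvPowerSeries ι R := fun a => d (MvPowerSeries.coeff a Ψ)
      ext a
      change d (MvPowerSeries.coeff a (Φ * Ψ)) =
        MvPowerSeries.coeff a (Φ * wPsi) +
        MvPowerSeries.coeff a (Ψ * wPhi)
      rw [mul_comm Ψ, MvPowerSeries.coeff_mul, MvPowerSeries.coeff_mul, MvPowerSeries.coeff_mul,
        ← Finset.sum_add_distrib, map_sum]
      refine Finset.sum_congr rfl fun x hx => ?_
      change _ = MvPowerSeries.coeff x.1 Φ * d (MvPowerSeries.coeff x.2 Ψ) +
        d (MvPowerSeries.coeff x.1 Φ) * MvPowerSeries.coeff x.2 Ψ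
      rw [Derivation.leibniz, smul_eq_mul, smul_eq_mul]
      ring)

@[simp] theorem coeff_coeffDer [Algebra ℝ R] (d : Derivation ℝ R R)
    (Φ : MvPowerSeries ι R) (a : ι →₀ ℕ) :
    MvPowerSeries.coeff a (coeffDer d Φ) = d (MvPowerSeries.coeff a Φ) := rfl

theorem coeff_intCast_mul (k : ℤ) (Φ : MvPowerSeries ι R) (a : ι →₀ ℕ) :
    MvPowerSeries.coeff a ((k : MvPowerSeries ι R) * Φ) = (k : R) * MvPowerSeries.coeff a Φ := by
  rw [← zsmul_eq_mul, ← zsmul_eq_mul]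
  exact map_zsmul (MvPowerSeries.coeff a) k Φ

theorem weightDer_monomial [Algebra ℝ R] (w : (ι →₀ ℕ) →+ ℤ) (e : ι →₀ ℕ) (c : R) :
    weightDer w (MvPowerSeries.monomial e c) =
      (w e : MvPowerSeries ι R) * MvPowerSeries.monomial e c := by
  classical
  ext a
  rw [coeff_weightDer, coeff_intCast_mul, MvPowerSeries.coeff_monomial]
  split_ifs with h
  · rw [h]
  · simp

theorem coeffDer_monomial [Algebra ℝ R] (d : Derivation ℝ R R) (e : ι →₀ ℕ) (c : R) :
    coeffDer d (MvPowerSeries.monomial e c) = MvPowerSeries.monomial e (d c) := by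
  classical
  ext a
  rw [coeff_coeffDer, MvPowerSeries.coeff_monomial, MvPowerSeries.coeff_monomial]
  split_ifs <;> simp

/-- The power series `∑ f_n X^(n δ)`, the substitution of the monomial `X^δ` into `f`. -/
def lac (δ : ι →₀ ℕ) (f : PowerSeries R) : MvPowerSeries ι R :=
  f.subst (MvPowerSeries.monomial δ (1 : R))

variable {δ : ι →₀ ℕ}

theorem hasSubst_monomial (hδ : δ ≠ 0) :
    PowerSeries.HasSubst (MvPowerSeries.monomial δ (1 : R)) :=
  PowerSeries.HasSubst.monomial hδ 1

theorem lac_mul (hδ : δ ≠ 0) (f g : PowerSeries R) : lac δ (f * g) = lac δ f * lac δ g :=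
  PowerSeries.subst_mul (hasSubst_monomial hδ) f g

theorem lac_add (hδ : δ ≠ 0) (f g : PowerSeries R) : lac δ (f + g) = lac δ f + lac δ g :=
  PowerSeries.subst_add (hasSubst_monomial hδ) f g

theorem lac_X (hδ : δ ≠ 0) : lac δ (PowerSeries.X : PowerSeries R) = MvPowerSeries.monomial δ 1 :=
  PowerSeries.subst_X (hasSubst_monomial hδ)

theorem nsmul_left_injective_of_ne_zero (hδ : δ ≠ 0) : Function.Injective fun n : ℕ => n • δ := by
  intro m n h
  obtain ⟨i, hi⟩ := Finsupp.ne_iff.1 hδ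
  have := DFunLike.congr_fun h i
  simpa [show δ i ≠ 0 from hi] using this

theorem coeff_lac_smul (hδ : δ ≠ 0) (f : PowerSeries R) (n : ℕ) :
    MvPowerSeries.coeff (n • δ) (lac δ f) = PowerSeries.coeff n f := by
  classical
  rw [lac, PowerSeries.coeff_subst (hasSubst_monomial hδ), finsum_eq_single _ n]
  · simp [MvPowerSeries.monomial_pow]
  · intro m hm
    rw [MvPowerSeries.monomial_pow, MvPowerSeries.coeff_monomial, if_neg, smul_zero]
    exact fun h => hm (nsmul_left_injective_of_ne_zero hδ h).symm

theorem coeff_lac_of_ne (hδ : δ ≠ 0) (f : PowerSeries R) {a : ι →₀ ℕ} (ha : ∀ n : ℕ, n • δ ≠ a) :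
    MvPowerSeries.coeff a (lac δ f) = 0 := by
  classical
  rw [lac, PowerSeries.coeff_subst (hasSubst_monomial hδ)]
  refine finsum_eq_zero_of_forall_eq_zero fun n => ?_
  rw [MvPowerSeries.monomial_pow, MvPowerSeries.coeff_monomial, if_neg (ha n).symm, smul_zero]

theorem lac_C (hδ : δ ≠ 0) (c : R) : lac δ (PowerSeries.C c) = MvPowerSeries.C c := by
  classical
  ext a
  by_cases h : ∃ n : ℕ, n • δ = a
  · obtain ⟨n, rfl⟩ := h
    rw [coeff_lac_smul hδ, PowerSeries.coeff_C, MvPowerSeries.coeff_C]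
    simp [hδ]
  · push Not at h
    rw [coeff_lac_of_ne hδ _ h, MvPowerSeries.coeff_C, if_neg]
    rintro rfl; exact h 0 (by simp)

theorem lac_one (hδ : δ ≠ 0) : lac δ (1 : PowerSeries R) = 1 := by
  simpa using lac_C (R := R) hδ 1

theorem weightDer_lac [Algebra ℝ R] (hδ : δ ≠ 0) (w : (ι →₀ ℕ) →+ ℤ) (f : PowerSeries R) :
    weightDer w (lac δ f) =
      (w δ : MvPowerSeries ι R) *
        lac δ (PowerSeries.mk fun n => (n : R) * PowerSeries.coeff n f) := by
  ext a
  rw [coeff_weightDer, coeff_intCast_mul]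
  by_cases h : ∃ n : ℕ, n • δ = a
  · obtain ⟨n, rfl⟩ := h
    rw [coeff_lac_smul hδ, coeff_lac_smul hδ, PowerSeries.coeff_mk, map_nsmul]
    simp; ring
  · push Not at h
    simp [coeff_lac_of_ne hδ _ h]

theorem coeffDer_lac [Algebra ℝ R] (hδ : δ ≠ 0) (d : Derivation ℝ R R) (f : PowerSeries R) :
    coeffDer d (lac δ f) = lac δ (PowerSeries.mk fun n => d (PowerSeries.coeff n f)) := by
  ext a
  rw [coeff_coeffDer]
  by_cases h : ∃ n : ℕ, n • δ = a
  · obtain ⟨n, rfl⟩ := h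
    rw [coeff_lac_smul hδ, coeff_lac_smul hδ, PowerSeries.coeff_mk]
  · push Not at h
    simp [coeff_lac_of_ne hδ _ h]

theorem map_lac {R' : Type*} [CommRing R'] (hδ : δ ≠ 0) (φ : R →+* R') (f : PowerSeries R) :
    MvPowerSeries.map φ (lac δ f) = lac δ (PowerSeries.map φ f) := by
  ext a
  rw [MvPowerSeries.coeff_map]
  by_cases h : ∃ n : ℕ, n • δ = a
  · obtain ⟨n, rfl⟩ := h
    rw [coeff_lac_smul hδ, coeff_lac_smul hδ, PowerSeries.coeff_map]
  · push Not at h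
    simp [coeff_lac_of_ne hδ _ h]

/-- Splitting off the first `M` terms of a lacunary series. -/
theorem lac_eq_sum_add (hδ : δ ≠ 0) (f : PowerSeries R) (M : ℕ) :
    lac δ f = ∑ n ∈ Finset.range M, MvPowerSeries.monomial (n • δ) (PowerSeries.coeff n f) +
      MvPowerSeries.monomial (M • δ) 1 *
        lac δ (PowerSeries.mk fun n => PowerSeries.coeff (n + M) f) := by
  classical
  induction M with
  | zero =>
    simp only [Finset.range_zero, Finset.sum_empty, zero_smul, zero_add, add_zero]
    rw [MvPowerSeries.monomial_zero_one, one_mul]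
    congr 1; ext n; simp
  | succ M ih =>
    rw [ih, Finset.sum_range_succ, add_assoc]
    congr 1
    have : (PowerSeries.mk fun n => PowerSeries.coeff (n + M) f) =
        PowerSeries.C (PowerSeries.coeff M f) + PowerSeries.X *
          PowerSeries.mk fun n => PowerSeries.coeff (n + (M + 1)) f := by
      ext n
      rcases n with _ | n
      · simp
      · rw [map_add, PowerSeries.coeff_succ_X_mul]
        simp [add_assoc, add_comm 1 M]
    rw [this, lac_add hδ, lac_mul hδ, lac_X hδ, lac_C hδ, mul_add, ← mul_assoc,
      MvPowerSeries.monomial_mul_monomial, succ_nsmul, one_mul,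
      ← MvPowerSeries.monomial_zero_eq_C_apply, MvPowerSeries.monomial_mul_monomial, add_zero,
      one_mul]

/-- The coefficients of `(1 - x) ^ κ`. -/
def bin (κ : ℝ) (n : ℕ) : ℝ := (-1) ^ n * Ring.choose κ n

theorem bin_zero (κ : ℝ) : bin κ 0 = 1 := by simp [bin]

theorem bin_succ (κ : ℝ) (n : ℕ) : ((n : ℝ) + 1) * bin κ (n + 1) = (n - κ) * bin κ n := by
  have h1 := Ring.descPochhammer_eq_factorial_smul_choose κ n
  have h2 := Ring.descPochhammer_eq_factorial_smul_choose κ (n + 1)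
  rw [descPochhammer_succ_right] at h2
  have h3 : (n.factorial : ℝ) ≠ 0 := by positivity
  simp only [Polynomial.smeval_mul, Polynomial.smeval_sub, Polynomial.smeval_X, Nat.factorial_succ,
    Polynomial.smeval_natCast, nsmul_eq_mul, h1] at h2
  simp only [bin, pow_succ]
  push_cast at h2
  refine mul_left_cancel₀ h3 ?_
  simp only [pow_zero, pow_one, mul_one] at h2
  linear_combination (-(-1) ^ n) * -h2

/-- The one-variable series `(1 - c x) ^ κ`. -/
def binSeries [Algebra ℝ R] (κ : ℝ) (c : R) : PowerSeries R :=
  PowerSeries.mk fun n => algebraMap ℝ R (bin κ n) * c ^ n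

/-- The geometric series `1 / (1 - c x)`. -/
def geom (c : R) : PowerSeries R := PowerSeries.mk fun n => c ^ n

theorem geom_eq (c : R) : geom c = 1 + PowerSeries.C c * PowerSeries.X * geom c := by
  ext n
  rw [mul_assoc, map_add, PowerSeries.coeff_C_mul]
  rcases n with _ | n
  · simp [geom]
  · rw [PowerSeries.coeff_succ_X_mul]; simp [geom, pow_succ, mul_comm, PowerSeries.coeff_one]

end PowerSeries

section BinSeries

variable {R : Type*} [CommRing R] [Algebra ℝ R]

/-- The Euler operator `x d/dx` on `(1 - c x) ^ κ`. -/
theorem mk_mul_coeff_binSeries (κ : ℝ) (c : R) :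
    (PowerSeries.mk fun n => (n : R) * PowerSeries.coeff n (binSeries κ c)) =
      PowerSeries.C (algebraMap ℝ R (-κ)) * (geom c - 1) * binSeries κ c := by
  set f := binSeries κ c
  set g := PowerSeries.mk fun n => (n : R) * PowerSeries.coeff n f
  have h1 : g = PowerSeries.C c * PowerSeries.X * g -
      PowerSeries.C (algebraMap ℝ R κ) * (PowerSeries.C c * (PowerSeries.X * f)) := by
    ext n
    rw [map_sub, mul_assoc, PowerSeries.coeff_C_mul, PowerSeries.coeff_C_mul,
      PowerSeries.coeff_C_mul]
    rcases n with _ | n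
    · simp [g]
    · rw [PowerSeries.coeff_succ_X_mul, PowerSeries.coeff_succ_X_mul]
      simp only [g, f, binSeries, PowerSeries.coeff_mk]
      have := congrArg (algebraMap ℝ R) (bin_succ κ n)
      simp only [map_mul, map_add, map_sub, map_natCast, map_one] at this
      push_cast
      rw [pow_succ]
      linear_combination c ^ n * c * this
  have h2 := geom_eq c
  have h3 : (1 - PowerSeries.C c * PowerSeries.X) * geom c = 1 := by linear_combination h2
  calc g = (geom c * (1 - PowerSeries.C c * PowerSeries.X)) * g := by
        rw [mul_comm (geom c), h3, one_mul]
    _ = geom c * (-PowerSeries.C (algebraMap ℝ R κ) *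
          (PowerSeries.C c * (PowerSeries.X * f))) := by linear_combination geom c * h1
    _ = _ := by
        rw [map_neg, map_neg]
        linear_combination PowerSeries.C (algebraMap ℝ R κ) * f * h2

/-- A derivation `d` of the coefficient ring maps `(1 - c x) ^ κ` to
`-κ (d c) x / (1 - c x)` times itself. -/
theorem mk_deriv_coeff_binSeries (κ : ℝ) (c : R) (d : Derivation ℝ R R) :
    (PowerSeries.mk fun n => d (PowerSeries.coeff n (binSeries κ c))) =
      PowerSeries.C (algebraMap ℝ R (-κ)) * PowerSeries.C (d c) *
        (PowerSeries.X * geom c * binSeries κ c) := by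
  set f := binSeries κ c
  set g := PowerSeries.mk fun n => d (PowerSeries.coeff n f)
  have h1 : g = PowerSeries.C c * PowerSeries.X * g -
      PowerSeries.C (algebraMap ℝ R κ) * (PowerSeries.C (d c) * (PowerSeries.X * f)) := by
    ext n
    rw [map_sub, mul_assoc, PowerSeries.coeff_C_mul, PowerSeries.coeff_C_mul,
      PowerSeries.coeff_C_mul]
    rcases n with _ | n
    · simp [g, f, binSeries, bin_zero]
    · rw [PowerSeries.coeff_succ_X_mul, PowerSeries.coeff_succ_X_mul]
      simp only [g, f, binSeries, PowerSeries.coeff_mk, Derivation.leibniz, Derivation.leibniz_pow,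
        Derivation.map_algebraMap, smul_eq_mul, nsmul_eq_mul]
      have := congrArg (algebraMap ℝ R) (bin_succ κ n)
      simp only [map_mul, map_add, map_sub, map_natCast, map_one] at this
      rcases n with _ | n
      · push_cast at this ⊢
        simp only [zero_add, pow_zero, one_mul, zero_mul, mul_zero, zero_sub] at this ⊢
        linear_combination d c * this
      · simp only [Nat.add_sub_cancel]
        push_cast at this ⊢
        rw [pow_succ]
        linear_combination c ^ n * c * d c * this
  have h2 := geom_eq c
  have h3 : (1 - PowerSeries.C c * PowerSeries.X) * geom c = 1 := by linear_combination h2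
  calc g = (geom c * (1 - PowerSeries.C c * PowerSeries.X)) * g := by
        rw [mul_comm (geom c), h3, one_mul]
    _ = geom c * (-PowerSeries.C (algebraMap ℝ R κ) *
          (PowerSeries.C (d c) * (PowerSeries.X * f))) := by linear_combination geom c * h1
    _ = _ := by
        rw [map_neg, map_neg]; ring

variable {ι : Type*} {δ : ι →₀ ℕ}

theorem weightDer_lac_binSeries (hδ : δ ≠ 0) (w : (ι →₀ ℕ) →+ ℤ) (κ : ℝ) (c : R) :
    weightDer w (lac δ (binSeries κ c)) =
      -(w δ : MvPowerSeries ι R) * MvPowerSeries.C (algebraMap ℝ R κ) *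
        (lac δ (geom c) - 1) * lac δ (binSeries κ c) := by
  rw [weightDer_lac hδ, mk_mul_coeff_binSeries]
  have : geom c - 1 = geom c + PowerSeries.C (-1 : R) := by simp [sub_eq_add_neg]
  rw [this, lac_mul hδ, lac_mul hδ, lac_add hδ, lac_C hδ, lac_C hδ]
  simp only [map_neg, map_one]; ring

theorem coeffDer_lac_binSeries (hδ : δ ≠ 0) (d : Derivation ℝ R R) (κ : ℝ) (c : R) :
    coeffDer d (lac δ (binSeries κ c)) =
      -(MvPowerSeries.C (algebraMap ℝ R κ) * MvPowerSeries.C (d c) *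
        (MvPowerSeries.monomial δ 1 * lac δ (geom c))) * lac δ (binSeries κ c) := by
  rw [coeffDer_lac hδ, mk_deriv_coeff_binSeries]
  rw [lac_mul hδ, lac_mul hδ, lac_mul hδ, lac_mul hδ, lac_C hδ, lac_C hδ, lac_X hδ]
  simp only [map_neg]; ring

theorem lac_geom_eq {R : Type*} [CommRing R] (hδ : δ ≠ 0) (c : R) :
    lac δ (geom c) = 1 + MvPowerSeries.C c * MvPowerSeries.monomial δ 1 * lac δ (geom c) := by
  conv_lhs => rw [geom_eq]
  rw [lac_add hδ, lac_mul hδ, lac_mul hδ, lac_one hδ, lac_C hδ, lac_X hδ]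

end BinSeries

/-! ### The generating function of the functions `f_m` -/

section Generating

variable {N : ℕ}

/-- The exponent of `t_l = v_0 ⋯ v_l`, where `t_l` stands for `1 / y_l²` and the variables of the
power series ring are `v_0 = t_0` and `v_i = t_i / t_{i-1}`. -/
def tExp (l : Fin N) : Fin N →₀ ℕ := Finsupp.equivFunOnFinite.symm fun i => if i ≤ l then 1 else 0

/-- The exponent of `t_k / t_l = v_{l+1} ⋯ v_k`, for `l < k`. -/
def uExp (l k : Fin N) : Fin N →₀ ℕ :=
  Finsupp.equivFunOnFinite.symm fun i => if l < i ∧ i ≤ k then 1 else 0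

theorem tExp_apply (l i : Fin N) : tExp l i = if i ≤ l then 1 else 0 := rfl

theorem uExp_apply (l k i : Fin N) : uExp l k i = if l < i ∧ i ≤ k then 1 else 0 := rfl

theorem tExp_add_uExp {l k : Fin N} (h : l ≤ k) : tExp l + uExp l k = tExp k := by
  ext i
  simp only [Finsupp.add_apply, tExp_apply, uExp_apply]
  split_ifs <;> grind

theorem tExp_ne_zero (l : Fin N) : tExp l ≠ 0 := by
  intro h
  have := DFunLike.congr_fun h l
  simp [tExp_apply] at this

theorem uExp_ne_zero {l k : Fin N} (h : l < k) : uExp l k ≠ 0 := by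
  intro h'
  have := DFunLike.congr_fun h' k
  simp [uExp_apply, h] at this

theorem tExp_injective : Function.Injective (tExp : Fin N → Fin N →₀ ℕ) := by
  intro l k h
  have h1 := DFunLike.congr_fun h l
  have h2 := DFunLike.congr_fun h k
  simp only [tExp_apply, le_refl, if_true] at h1 h2
  refine le_antisymm ?_ ?_
  · by_contra hc; simp [hc] at h1
  · by_contra hc; simp [hc] at h2

/-- The exponent of `t_l` in the monomial `v^a`. -/
def wt (l : Fin N) : (Fin N →₀ ℕ) →+ ℤ where
  toFun a := a l - if h : (l : ℕ) + 1 < N then (a ⟨l + 1, h⟩ : ℤ) else 0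
  map_zero' := by simp
  map_add' a b := by split_ifs <;> simp; ring

theorem wt_apply (l : Fin N) (a : Fin N →₀ ℕ) :
    wt l a = a l - if h : (l : ℕ) + 1 < N then (a ⟨l + 1, h⟩ : ℤ) else 0 := rfl

theorem wt_tExp (l k : Fin N) : wt l (tExp k) = if l = k then 1 else 0 := by
  rw [wt_apply]
  simp only [tExp_apply, Fin.le_def, Fin.ext_iff]
  have := k.2
  split_ifs <;> omega

/-- The monomial with exponent `uExp l k` is `t_k / t_l`. -/
theorem wt_uExp {l k : Fin N} (h : l < k) (i : Fin N) :
    wt i (uExp l k) = (if i = k then 1 else 0) - if i = l then 1 else 0 := by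
  have := congrArg (wt i) (tExp_add_uExp h.le)
  rw [map_add, wt_tExp, wt_tExp] at this
  linarith

/-- The ring of polynomials in the variables `z_j`, which stand for `x_j²`. -/
abbrev Pol (N : ℕ) : Type := MvPolynomial (Fin N) ℝ

/-- Power series in the `v_i` whose coefficients are polynomials in the `z_j`. -/
abbrev Ser (N : ℕ) : Type := MvPowerSeries (Fin N) (Pol N)

/-- The series `t_l`. -/
def tVar (R : Type*) [CommRing R] (l : Fin N) : MvPowerSeries (Fin N) R :=
  MvPowerSeries.monomial (tExp l) 1

/-- The series `1 / (1 - z_j t_k)`. -/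
def pSer (j k : Fin N) : Ser N := lac (tExp k) (geom (MvPolynomial.X j))

/-- The expansion of `t_k / (t_l - t_k)` in powers of the `v_i`; it is set to `0` for `l = k`. -/
def rSer (R : Type*) [CommRing R] (l k : Fin N) : MvPowerSeries (Fin N) R :=
  if l < k then lac (uExp l k) (geom 1) - 1 else if k < l then -lac (uExp k l) (geom 1) else 0

/-- The series `∏_{j < k} (1 - t_k / t_j) ^ lam`. -/
def deltaSer (R : Type*) [CommRing R] [Algebra ℝ R] (lam : ℝ) : MvPowerSeries (Fin N) R :=
  ∏ j, ∏ k ∈ Finset.Ioi j, lac (uExp j k) (binSeries lam 1)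

/-- The series `∏_{j, k} (1 - z_j t_k) ^ (-lam)`. -/
def kernelSer (lam : ℝ) : Ser N :=
  ∏ j, ∏ k, lac (tExp k) (binSeries (-lam) (MvPolynomial.X j))

/-- The derivation `t_l ∂/∂t_l`. -/
abbrev thetaT {R : Type*} [CommRing R] [Algebra ℝ R] (l : Fin N) :
    Derivation ℝ (MvPowerSeries (Fin N) R) (MvPowerSeries (Fin N) R) := weightDer (wt l)

/-- The derivation `∂/∂z_j`. -/
abbrev derZ (j : Fin N) : Derivation ℝ (Ser N) (Ser N) :=
  coeffDer ((MvPolynomial.pderiv j).restrictScalars ℝ)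

/-- The logarithmic derivative of a product is the sum of the logarithmic derivatives. -/
theorem derivation_prod_of_log {α A : Type*} [CommRing A] [Algebra ℝ A] (d : Derivation ℝ A A)
    (s : Finset α) (f g : α → A) (h : ∀ i ∈ s, d (f i) = g i * f i) :
    d (∏ i ∈ s, f i) = (∑ i ∈ s, g i) * ∏ i ∈ s, f i := by
  classical
  induction s using Finset.induction_on with
  | empty => simp
  | insert a s ha ih =>
    rw [Finset.prod_insert ha, Finset.sum_insert ha, Derivation.leibniz, smul_eq_mul, smul_eq_mul,
      ih fun i hi => h i (Finset.mem_insert_of_mem hi), h a (Finset.mem_insert_self _ _)]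
    ring

section Ring

variable {R : Type*} [CommRing R]

theorem rSer_self (l : Fin N) : rSer R l l = 0 := by simp [rSer]

theorem rSer_of_lt {l k : Fin N} (h : l < k) : rSer R l k = lac (uExp l k) (geom 1) - 1 := by
  simp [rSer, h]

theorem rSer_of_gt {l k : Fin N} (h : k < l) : rSer R l k = -1 - rSer R k l := by
  simp [rSer, h, not_lt.2 h.le]; ring

theorem tVar_mul_u {l k : Fin N} (h : l ≤ k) :
    tVar R l * MvPowerSeries.monomial (uExp l k) 1 = tVar R k := by
  rw [tVar, tVar, MvPowerSeries.monomial_mul_monomial, tExp_add_uExp h, one_mul]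

theorem rSer_eq {l k : Fin N} (h : l < k) :
    rSer R l k = MvPowerSeries.monomial (uExp l k) 1 * (1 + rSer R l k) := by
  have := lac_geom_eq (uExp_ne_zero h) (1 : R)
  rw [rSer_of_lt h]
  rw [map_one] at this
  linear_combination this

/-- Both expansions in `rSer`, for `l < k` and for `k < l`, represent `t_k / (t_l - t_k)`. -/
theorem tVar_sub_mul_rSer {l k : Fin N} (h : l ≠ k) :
    (tVar R l - tVar R k) * rSer R l k = tVar R k := by
  rcases lt_or_gt_of_ne h with h | h
  · have h1 := tVar_mul_u (R := R) h.le
    have h2 := rSer_eq (R := R) h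
    linear_combination tVar R l * h2 + (1 + rSer R l k) * h1
  · have h1 := tVar_mul_u (R := R) h.le
    have h2 := rSer_eq (R := R) h
    rw [rSer_of_gt h]
    linear_combination tVar R k * h2 + (1 + rSer R k l) * h1

theorem tVar_injective [Nontrivial R] : Function.Injective (tVar R : Fin N → _) := by
  classical
  intro l k h
  by_contra hne
  have := congrArg (MvPowerSeries.coeff (tExp l)) h
  rw [tVar, tVar, MvPowerSeries.coeff_monomial_same, MvPowerSeries.coeff_monomial_ne] at this
  · exact one_ne_zero this
  · exact fun h => hne (tExp_injective h)

variable [Algebra ℝ R]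

theorem thetaT_rSer (l k : Fin N) :
    thetaT l (rSer R l k) = -(rSer R l k * (1 + rSer R l k)) := by
  have key : ∀ {i j : Fin N} (_ : i < j) (m : Fin N), thetaT m (rSer R i j) =
      (wt m (uExp i j) : MvPowerSeries (Fin N) R) * (rSer R i j * (1 + rSer R i j)) := by
    intro i j h m
    have h2 := rSer_eq (R := R) h
    set u : MvPowerSeries (Fin N) R := MvPowerSeries.monomial (uExp i j) 1
    have h3 := congrArg (thetaT m) h2
    have h4 : thetaT m u = (wt m (uExp i j) : MvPowerSeries (Fin N) R) * u :=
      weightDer_monomial _ _ _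
    rw [Derivation.leibniz, smul_eq_mul, smul_eq_mul, map_add, Derivation.map_one_eq_zero, h4] at h3
    set x := thetaT m (rSer R i j)
    set w := (wt m (uExp i j) : MvPowerSeries (Fin N) R)
    linear_combination (1 + rSer R i j) * h3 + (w * (1 + rSer R i j) + x) * -h2
  rcases lt_trichotomy l k with h | rfl | h
  · rw [key h, wt_uExp h, if_neg h.ne]; simp
  · simp [rSer_self]
  · have := key h l
    rw [wt_uExp h, if_neg h.ne'] at this
    rw [rSer_of_gt h, map_sub, map_neg, Derivation.map_one_eq_zero, this]
    simp; ring

theorem thetaT_deltaSer (lam : ℝ) (l : Fin N) :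
    thetaT l (deltaSer R lam : MvPowerSeries (Fin N) R) =
      MvPowerSeries.C (algebraMap ℝ R lam) * (((l : ℕ) : MvPowerSeries (Fin N) R) +
        ∑ k, rSer R l k) * deltaSer R lam := by
  let q : Fin N → Fin N → MvPowerSeries (Fin N) R := fun j k =>
    -(wt l (uExp j k) : MvPowerSeries (Fin N) R) * MvPowerSeries.C (algebraMap ℝ R lam) * rSer R j k
  have h1 : thetaT l (deltaSer R lam : MvPowerSeries (Fin N) R) =
      (∑ j, ∑ k ∈ Finset.Ioi j, q j k) * deltaSer R lam := by
    unfold deltaSer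
    refine derivation_prod_of_log _ _ _ _ fun j _ => derivation_prod_of_log _ _ _ _ fun k hk => ?_
    have hk := Finset.mem_Ioi.1 hk
    rw [weightDer_lac_binSeries (uExp_ne_zero hk), ← rSer_of_lt hk]
  rw [h1]
  congr 1
  have h2 : ∀ j k, j < k → q j k = MvPowerSeries.C (algebraMap ℝ R lam) *
      ((if j = l then rSer R l k else 0) + if k = l then 1 + rSer R l j else 0) := by
    intro j k h
    simp only [q, wt_uExp h, @eq_comm _ l]
    by_cases hj : j = l
    · subst hj; simp [h.ne']
    · by_cases hk : k = l
      · subst hk; simp [hj, rSer_of_gt h]; ring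
      · simp [hj, hk]
  rw [Finset.sum_congr rfl fun j _ => Finset.sum_congr rfl fun k hk => h2 j k (Finset.mem_Ioi.1 hk)]
  simp only [← Finset.mul_sum]
  congr 1
  simp only [Finset.sum_add_distrib]
  have h3 : ∑ j, ∑ k ∈ Finset.Ioi j, (if j = l then rSer R l k else 0) =
      ∑ k ∈ Finset.Ioi l, rSer R l k := by
    rw [Finset.sum_eq_single l] <;> simp +contextual
  have h4 : ∑ j, ∑ k ∈ Finset.Ioi j, (if k = l then 1 + rSer R l j else 0) =
      ((l : ℕ) : MvPowerSeries (Fin N) R) + ∑ k ∈ Finset.Iio l, rSer R l k := by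
    rw [Finset.sum_comm' (t' := Finset.univ) (s' := fun k => Finset.Iio k) (by simp),
      Finset.sum_eq_single l]
    · simp [Finset.sum_add_distrib]
    · intro b _ hb; simp [hb]
    · simp
  rw [h3, h4]
  have h5 : ∑ k, rSer R l k = ∑ k ∈ Finset.Ioi l, rSer R l k + ∑ k ∈ Finset.Iio l, rSer R l k := by
    rw [← Finset.sum_union]
    · symm
      refine Finset.sum_subset (Finset.subset_univ _) fun k _ hk => ?_
      have : k = l := by
        by_contra hne
        rcases lt_or_gt_of_ne hne with h | h <;> simp [h] at hk
      rw [this, rSer_self]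
    · rw [Finset.disjoint_left]; intro j hj hj'
      simp only [Finset.mem_Ioi, Finset.mem_Iio] at hj hj'; exact lt_asymm hj hj'
  rw [h5]; ring

end Ring

theorem pSer_eq (j k : Fin N) :
    pSer j k = 1 + MvPowerSeries.C (MvPolynomial.X j) * tVar (Pol N) k * pSer j k :=
  lac_geom_eq (tExp_ne_zero k) _

theorem derZ_C (j : Fin N) (q : Pol N) :
    derZ j (MvPowerSeries.C q) = MvPowerSeries.C (MvPolynomial.pderiv j q) := by
  rw [← MvPowerSeries.monomial_zero_eq_C_apply, coeffDer_monomial]; rfl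

theorem derZ_tVar (j k : Fin N) : derZ j (tVar (Pol N) k) = 0 := by
  rw [tVar, coeffDer_monomial]; simp

theorem thetaT_tVar {R : Type*} [CommRing R] [Algebra ℝ R] (l k : Fin N) :
    thetaT l (tVar R k) = if l = k then tVar R k else 0 := by
  rw [tVar, weightDer_monomial, wt_tExp]; split_ifs <;> simp

theorem thetaT_C {R : Type*} [CommRing R] [Algebra ℝ R] (l : Fin N) (q : R) :
    thetaT l (MvPowerSeries.C q : MvPowerSeries (Fin N) R) = 0 := by
  rw [← MvPowerSeries.monomial_zero_eq_C_apply, weightDer_monomial]; simp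

theorem derZ_pSer (j k : Fin N) : derZ j (pSer j k) = tVar (Pol N) k * pSer j k ^ 2 := by
  have h1 := pSer_eq j k
  have h2 := congrArg (derZ j) h1
  rw [map_add, Derivation.map_one_eq_zero, Derivation.leibniz, Derivation.leibniz, derZ_tVar,
    derZ_C, MvPolynomial.pderiv_X_self, map_one] at h2
  simp only [smul_eq_mul] at h2
  set x := derZ j (pSer j k)
  linear_combination pSer j k * h2 - x * h1

theorem thetaT_pSer (j l : Fin N) : thetaT l (pSer j l) = pSer j l ^ 2 - pSer j l := by
  have h1 := pSer_eq j l
  have h2 := congrArg (thetaT l) h1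
  rw [map_add, Derivation.map_one_eq_zero, Derivation.leibniz, Derivation.leibniz, thetaT_tVar,
    thetaT_C, if_pos rfl] at h2
  simp only [smul_eq_mul] at h2
  set x := thetaT l (pSer j l)
  linear_combination pSer j l * h2 - (x + pSer j l) * h1

theorem derZ_kernelSer (lam : ℝ) (j : Fin N) :
    derZ j (kernelSer lam) = MvPowerSeries.C (algebraMap ℝ (Pol N) lam) *
      (∑ k, tVar (Pol N) k * pSer j k) * kernelSer lam := by
  have h1 : derZ j (kernelSer lam) = (∑ i, ∑ k, if i = j then
      MvPowerSeries.C (algebraMap ℝ (Pol N) lam) * (tVar (Pol N) k * pSer j k) else 0) *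
        kernelSer lam := by
    unfold kernelSer
    refine derivation_prod_of_log _ _ _ _ fun i _ => derivation_prod_of_log _ _ _ _ fun k _ => ?_
    rw [coeffDer_lac_binSeries (tExp_ne_zero k)]
    congr 1
    by_cases h : i = j
    · subst h
      rw [if_pos rfl, Derivation.restrictScalars_apply, MvPolynomial.pderiv_X_self, map_neg,
        map_neg, map_one, tVar, pSer]
      ring
    · rw [if_neg h, Derivation.restrictScalars_apply, MvPolynomial.pderiv_X_of_ne h]; simp
  rw [h1, Finset.sum_eq_single j]
  · simp [Finset.mul_sum]
  · intro b _ hb; simp [hb]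
  · simp

theorem thetaT_kernelSer (lam : ℝ) (l : Fin N) :
    thetaT l (kernelSer lam) = MvPowerSeries.C (algebraMap ℝ (Pol N) lam) *
      (∑ j, (pSer j l - 1)) * kernelSer lam := by
  have h1 : thetaT l (kernelSer lam) = (∑ j, ∑ k, if l = k then
      MvPowerSeries.C (algebraMap ℝ (Pol N) lam) * (pSer j k - 1) else 0) *
        kernelSer lam := by
    unfold kernelSer
    refine derivation_prod_of_log _ _ _ _ fun i _ => derivation_prod_of_log _ _ _ _ fun k _ => ?_
    rw [weightDer_lac_binSeries (tExp_ne_zero k), wt_tExp]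
    congr 1
    by_cases h : l = k
    · subst h
      rw [if_pos rfl, if_pos rfl, map_neg, map_neg, pSer]; push_cast; ring
    · rw [if_neg h, if_neg h]; simp
  rw [h1, Finset.mul_sum]
  simp

theorem derZ_deltaSer (lam : ℝ) (j : Fin N) : derZ j (deltaSer (Pol N) lam) = 0 := by
  have h1 : derZ j (deltaSer (Pol N) lam) =
      (∑ j : Fin N, ∑ k ∈ Finset.Ioi j, (0 : Ser N)) * deltaSer (Pol N) lam := by
    unfold deltaSer
    refine derivation_prod_of_log _ _ _ _ fun i _ => derivation_prod_of_log _ _ _ _ fun k hk => ?_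
    rw [coeffDer_lac_binSeries (uExp_ne_zero (Finset.mem_Ioi.1 hk))]
    simp
  rw [h1]; simp

/-- The generating function of the `f_m`. -/
def genSer (lam : ℝ) : Ser N := deltaSer (Pol N) lam * kernelSer lam

/-- The series `lam ∑_k t_k / ((1 - z_i t_k) (1 - z_j t_k))` times the generating function, which is
the divided difference of its logarithmic derivatives `z_i ∂_i` and `z_j ∂_j`. -/
def qSer (lam : ℝ) (i j : Fin N) : Ser N :=
  MvPowerSeries.C (algebraMap ℝ (Pol N) lam) *
    (∑ k, tVar (Pol N) k * (pSer i k * pSer j k)) * genSer lam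

theorem derZ_genSer (lam : ℝ) (j : Fin N) :
    derZ j (genSer lam) = MvPowerSeries.C (algebraMap ℝ (Pol N) lam) *
      (∑ k, tVar (Pol N) k * pSer j k) * genSer lam := by
  rw [genSer, Derivation.leibniz, derZ_deltaSer, derZ_kernelSer]
  simp only [smul_eq_mul]; ring

/-- The shift by `lam (N - l)` absorbs the constants in the logarithmic derivatives: `-lam N` from
the sum of the `lam (p_{jl} - 1)` and `lam l` from the product over `j < k`. -/
theorem thetaT_genSer (lam : ℝ) (l : Fin N) :
    thetaT l (genSer lam) + MvPowerSeries.C (algebraMap ℝ (Pol N) lam) *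
      (((N : ℝ) - (l : ℕ) : ℝ) • (1 : Ser N)) * genSer lam =
      MvPowerSeries.C (algebraMap ℝ (Pol N) lam) *
        (∑ j, pSer j l + ∑ k, rSer (Pol N) l k) * genSer lam := by
  rw [genSer, Derivation.leibniz, thetaT_deltaSer, thetaT_kernelSer]
  rw [sub_smul, Nat.cast_smul_eq_nsmul, Nat.cast_smul_eq_nsmul]
  simp only [smul_eq_mul, Finset.sum_sub_distrib, Finset.sum_const, Finset.card_univ,
    Fintype.card_fin, nsmul_eq_mul, mul_one]
  ring

theorem sub_mul_qSer (lam : ℝ) (i j : Fin N) :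
    (MvPowerSeries.C (MvPolynomial.X i) - MvPowerSeries.C (MvPolynomial.X j)) * qSer lam i j =
      MvPowerSeries.C (MvPolynomial.X i) * derZ i (genSer lam) -
        MvPowerSeries.C (MvPolynomial.X j) * derZ j (genSer lam) := by
  rw [derZ_genSer, derZ_genSer, qSer]
  have : (MvPowerSeries.C (MvPolynomial.X i) - MvPowerSeries.C (MvPolynomial.X j) : Ser N) *
      (∑ k, tVar (Pol N) k * (pSer i k * pSer j k)) =
      MvPowerSeries.C (MvPolynomial.X i) * (∑ k, tVar (Pol N) k * pSer i k) -
      MvPowerSeries.C (MvPolynomial.X j) * (∑ k, tVar (Pol N) k * pSer j k) := by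
    simp only [Finset.mul_sum, ← Finset.sum_sub_distrib]
    refine Finset.sum_congr rfl fun k _ => ?_
    linear_combination (pSer i k - 1) * pSer_eq j k - (pSer j k - 1) * pSer_eq i k
  linear_combination MvPowerSeries.C (algebraMap ℝ (Pol N) lam) * genSer lam * this

theorem sum_add_sum_rSer (R : Type*) [CommRing R] :
    ∑ l : Fin N, (((l : ℕ) : MvPowerSeries (Fin N) R) + ∑ k, rSer R l k) = 0 := by
  rw [Finset.sum_add_distrib, sum_sum_eq_sum_Ioi _ fun i => rSer_self i]
  rw [Finset.sum_congr rfl fun i _ => Finset.sum_congr rfl fun j hj => by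
    rw [rSer_of_gt (Finset.mem_Ioi.1 hj), add_sub_cancel]]
  have : ∑ i : Fin N, ∑ j ∈ Finset.Ioi i, (-1 : MvPowerSeries (Fin N) R) =
      ∑ j : Fin N, ∑ i ∈ Finset.Iio j, (-1 : MvPowerSeries (Fin N) R) :=
    Finset.sum_comm' (by simp)
  rw [this, ← Finset.sum_add_distrib]
  simp

/-- The Euler operators in `z` and in `t` agree on the generating function. -/
theorem euler_genSer (lam : ℝ) :
    ∑ j, MvPowerSeries.C (MvPolynomial.X j) * derZ j (genSer lam) =
      ∑ l, thetaT l (genSer (N := N) lam) := by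
  have h1 := sum_add_sum_rSer (N := N) (Pol N)
  have h2 : ∀ l : Fin N, thetaT l (genSer (N := N) lam) =
      MvPowerSeries.C (algebraMap ℝ (Pol N) lam) * genSer lam *
        (((l : ℕ) : Ser N) + ∑ k, rSer (Pol N) l k) +
      MvPowerSeries.C (algebraMap ℝ (Pol N) lam) * genSer lam * ∑ j, (pSer j l - 1) := by
    intro l
    rw [genSer, Derivation.leibniz, thetaT_deltaSer, thetaT_kernelSer]
    simp only [smul_eq_mul]; ring
  simp only [h2, Finset.sum_add_distrib (s := Finset.univ (α := Fin N)) (f := fun l => _ * (_ + _)),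
    ← Finset.mul_sum (s := Finset.univ (α := Fin N)) (f := fun l => (_ + _)), h1]
  rw [mul_zero, zero_add, ← Finset.mul_sum, Finset.sum_comm, Finset.mul_sum]
  refine Finset.sum_congr rfl fun j _ => ?_
  rw [derZ_genSer]
  have : ∑ k, (pSer j k - 1) = MvPowerSeries.C (MvPolynomial.X j) *
      ∑ k, tVar (Pol N) k * pSer j k := by
    rw [Finset.mul_sum]
    exact Finset.sum_congr rfl fun k _ => by linear_combination pSer_eq j k
  rw [this]; ring

/-- The kernel function identity for the generating function. The left side acts in the variables
`z`, the right side in the variables `t`. -/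
theorem genSer_identity (lam c : ℝ) :
    ∑ j, MvPowerSeries.C (MvPolynomial.X j) * derZ j (derZ j (genSer (N := N) lam)) +
        c • ∑ j, derZ j (genSer (N := N) lam) +
        lam • ∑ i, ∑ j, (if i = j then 0 else qSer lam i j) =
      ∑ l : Fin N, tVar (Pol N) l *
        ((thetaT l (thetaT l (genSer lam) + (lam * ((N : ℝ) - (l : ℕ))) • genSer lam) +
          (lam * ((N : ℝ) - (l : ℕ))) •
            (thetaT l (genSer lam) + (lam * ((N : ℝ) - (l : ℕ))) • genSer lam)) +
          (c - lam) • (thetaT l (genSer lam) + (lam * ((N : ℝ) - (l : ℕ))) • genSer lam)) -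
        (lam * (lam - 1)) • ((∑ l, ∑ k, tVar (Pol N) l * rSer (Pol N) l k ^ 2) * genSer lam) := by
  have hC : ∀ (a : ℝ) (Φ : Ser N), a • Φ = MvPowerSeries.C (algebraMap ℝ (Pol N) a) * Φ := by
    intro a Φ
    rw [Algebra.smul_def, MvPowerSeries.algebraMap_apply]
  have : IsDomain (Ser N) := NoZeroDivisors.to_isDomain _
  have h := kernel_identity (S := Ser N) (fun j => MvPowerSeries.C (MvPolynomial.X j))
    (tVar (Pol N)) (fun l => (((N : ℝ) - (l : ℕ) : ℝ) • (1 : Ser N))) pSer (rSer (Pol N))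
    (MvPowerSeries.C (algebraMap ℝ (Pol N) lam)) (MvPowerSeries.C (algebraMap ℝ (Pol N) c))
    (genSer lam) derZ thetaT tVar_injective rSer_self (fun l k h => tVar_sub_mul_rSer h) pSer_eq
    derZ_pSer derZ_tVar
    (fun j => by rw [derZ_C]; simp [MvPolynomial.algebraMap_eq]) thetaT_pSer thetaT_rSer
    (fun l => thetaT_C l _) (derZ_genSer lam) (thetaT_genSer lam)
  simp only [hC, map_mul, map_sub, mul_one, map_one] at h ⊢
  simp only [qSer]
  rw [h]
  ring

end Generating

/-! ### Coefficient extraction and the recurrence for the `f_m` -/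

section Coefficients

variable {N : ℕ} {R : Type*} [CommRing R]

/-- The sums `∑_{k ≥ i} m_k`: the monomial `∏ t_k ^ m_k` is `∏ v_i ^ (suf m i)`. -/
def suf : (Fin N → ℤ) →+ (Fin N → ℤ) where
  toFun m i := ∑ k ∈ Finset.Ici i, m k
  map_zero' := by ext; simp
  map_add' a b := by ext; simp [Finset.sum_add_distrib]

theorem suf_apply (m : Fin N → ℤ) (i : Fin N) : suf m i = ∑ k ∈ Finset.Ici i, m k := rfl

/-- The exponent with entries `a i`, if these are non-negative. -/
def natExp (a : Fin N → ℤ) : Fin N →₀ ℕ := Finsupp.equivFunOnFinite.symm fun i => (a i).toNat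

theorem natExp_apply (a : Fin N → ℤ) (i : Fin N) : natExp a i = (a i).toNat := rfl

open scoped Classical in
/-- The coefficient at an integer exponent; it is zero unless the exponent is non-negative. -/
def ecoeff (a : Fin N → ℤ) : MvPowerSeries (Fin N) R →ₗ[R] R :=
  if 0 ≤ a then MvPowerSeries.coeff (natExp a) else 0

theorem ecoeff_of_nonneg {a : Fin N → ℤ} (h : 0 ≤ a) (Φ : MvPowerSeries (Fin N) R) :
    ecoeff a Φ = MvPowerSeries.coeff (natExp a) Φ := by simp [ecoeff, h]

theorem ecoeff_of_not_nonneg {a : Fin N → ℤ} (h : ¬ 0 ≤ a) (Φ : MvPowerSeries (Fin N) R) :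
    ecoeff a Φ = 0 := by simp [ecoeff, h]

theorem ecoeff_monomial_mul (e : Fin N →₀ ℕ) (c : R) (Φ : MvPowerSeries (Fin N) R)
    (a : Fin N → ℤ) :
    ecoeff a (MvPowerSeries.monomial e c * Φ) = c * ecoeff (a - fun i => (e i : ℤ)) Φ := by
  classical
  by_cases h : 0 ≤ a
  · rw [ecoeff_of_nonneg h, MvPowerSeries.coeff_monomial_mul]
    by_cases h' : 0 ≤ a - fun i => (e i : ℤ)
    · rw [ecoeff_of_nonneg h', if_pos]
      · have : natExp a - e = natExp (a - fun i => (e i : ℤ)) := by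
          ext i
          have := h' i
          simp only [Pi.sub_apply, Pi.zero_apply] at this
          simp only [Finsupp.tsub_apply, natExp_apply, Pi.sub_apply]
          omega
        rw [this]
      · intro i
        have := h' i
        simp only [Pi.sub_apply, Pi.zero_apply] at this
        simp only [natExp_apply]
        omega
    · rw [ecoeff_of_not_nonneg h', if_neg, mul_zero]
      intro h''
      refine h' fun i => ?_
      have h1 := h'' i
      have h2 := h i
      simp only [natExp_apply, Pi.zero_apply] at h1 h2
      simp only [Pi.sub_apply, Pi.zero_apply]
      omega
  · rw [ecoeff_of_not_nonneg h, ecoeff_of_not_nonneg, mul_zero]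
    intro h'
    refine h fun i => ?_
    have := h' i
    simp only [Pi.sub_apply, Pi.zero_apply] at this ⊢
    omega

theorem ecoeff_C_mul (c : R) (Φ : MvPowerSeries (Fin N) R) (a : Fin N → ℤ) :
    ecoeff a (MvPowerSeries.C c * Φ) = c * ecoeff a Φ := by
  rw [← MvPowerSeries.monomial_zero_eq_C_apply, ecoeff_monomial_mul]
  have : (a - fun i => (((0 : Fin N →₀ ℕ) i : ℕ) : ℤ)) = a := by ext; simp
  rw [this]

theorem ecoeff_smul [Algebra ℝ R] (c : ℝ) (Φ : MvPowerSeries (Fin N) R) (a : Fin N → ℤ) :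
    ecoeff a (c • Φ) = c • ecoeff a Φ := by
  rw [Algebra.smul_def, MvPowerSeries.algebraMap_apply, ecoeff_C_mul, Algebra.smul_def]

theorem suf_single (l i : Fin N) : suf (Pi.single l (1 : ℤ)) i = (tExp l i : ℤ) := by
  rw [suf_apply, tExp_apply]
  simp [Pi.single_apply]

theorem suf_shift {l k : Fin N} (h : l ≤ k) (ν : ℕ) (i : Fin N) :
    suf (shift l k ν) i = (tExp l i : ℤ) + ν * (uExp l k i : ℤ) := by
  have h1 := congrArg (fun e : Fin N →₀ ℕ => (e i : ℤ)) (tExp_add_uExp h)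
  simp only [Finsupp.add_apply, Nat.cast_add] at h1
  rw [shift, map_add, map_zsmul, map_zsmul, Pi.add_apply, Pi.smul_apply, Pi.smul_apply,
    suf_single, suf_single, ← h1, smul_eq_mul, smul_eq_mul]
  ring

theorem suf_eq (m : Fin N → ℤ) (l : Fin N) :
    suf m l = m l + if h : (l : ℕ) + 1 < N then suf m ⟨l + 1, h⟩ else 0 := by
  rw [suf_apply, ← Finset.Ioi_insert, Finset.sum_insert (by simp)]
  congr 1
  split_ifs with h'
  · rw [suf_apply]
    have : Finset.Ici (⟨l + 1, h'⟩ : Fin N) = Finset.Ioi l := by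
      ext i; rw [Finset.mem_Ici, Finset.mem_Ioi, Fin.le_def, Fin.lt_def]; exact Nat.succ_le_iff
    rw [this]
  · have : Finset.Ioi l = ∅ := by
      ext i; simp only [Finset.mem_Ioi, Fin.lt_def, Finset.notMem_empty, iff_false]
      have := i.2; omega
    rw [this]; simp

theorem wt_natExp_suf {m : Fin N → ℤ} (h : 0 ≤ suf m) (l : Fin N) :
    wt l (natExp (suf m)) = m l := by
  rw [wt_apply, natExp_apply, Int.toNat_of_nonneg (h l), suf_eq]
  split_ifs with h'
  · rw [natExp_apply, Int.toNat_of_nonneg (h _)]; ring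
  · ring

/-- The maps `suf` and `wt` are inverse to each other. -/
theorem suf_wt (a : Fin N →₀ ℕ) (i : Fin N) : suf (fun l => wt l a) i = a i := by
  have key : ∀ d : ℕ, ∀ i : Fin N, N - (i : ℕ) = d → suf (fun l => wt l a) i = a i := by
    intro d
    induction d with
    | zero => intro i hi; have := i.2; omega
    | succ d ih =>
      intro i hi
      rw [suf_eq, wt_apply]
      split_ifs with h
      · rw [ih ⟨i + 1, h⟩ (by simp only; omega)]; ring
      · ring
  exact key _ i rfl

theorem wt_eq_iff (a : Fin N →₀ ℕ) (m : Fin N → ℤ) :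
    (∀ l, wt l a = m l) ↔ 0 ≤ suf m ∧ a = natExp (suf m) := by
  constructor
  · intro h
    have h1 : suf m = fun i => (a i : ℤ) := by
      rw [← funext h]; exact funext (suf_wt a)
    rw [h1]
    refine ⟨fun i => by simp, ?_⟩
    ext i; simp [natExp_apply]
  · rintro ⟨h, rfl⟩ l
    exact wt_natExp_suf h l

/-- On the coefficient of `∏ t_l ^ m_l`, the operator `t_l ∂/∂t_l` is multiplication by `m_l`. -/
theorem ecoeff_suf_thetaT [Algebra ℝ R] (m : Fin N → ℤ) (l : Fin N)
    (Φ : MvPowerSeries (Fin N) R) :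
    ecoeff (suf m) (thetaT l Φ) = (m l : ℝ) • ecoeff (suf m) Φ := by
  by_cases h : 0 ≤ suf m
  · rw [ecoeff_of_nonneg h, ecoeff_of_nonneg h, coeff_weightDer, wt_natExp_suf h,
      Algebra.smul_def, map_intCast]
  · rw [ecoeff_of_not_nonneg h, ecoeff_of_not_nonneg h, smul_zero]

theorem ecoeff_suf_tVar_mul (m : Fin N → ℤ) (l : Fin N) (Φ : MvPowerSeries (Fin N) R) :
    ecoeff (suf m) (tVar R l * Φ) = ecoeff (suf (m - Pi.single l 1)) Φ := by
  rw [tVar, ecoeff_monomial_mul, one_mul, map_sub]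
  congr 2; ext i; exact congrArg (suf m i - ·) (suf_single l i).symm

theorem ecoeff_lac_mul {δ : Fin N →₀ ℕ} (hδ : δ ≠ 0) (f : PowerSeries R)
    (Φ : MvPowerSeries (Fin N) R) (a : Fin N → ℤ) (M : ℕ) (hM : ∀ i, a i < M) :
    ecoeff a (lac δ f * Φ) = ∑ n ∈ Finset.range M,
      PowerSeries.coeff n f * ecoeff (a - fun i => (n : ℤ) * δ i) Φ := by
  rw [lac_eq_sum_add hδ f M, add_mul, map_add, Finset.sum_mul, map_sum, mul_assoc,
    ecoeff_monomial_mul, one_mul, ecoeff_of_not_nonneg, add_zero]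
  · refine Finset.sum_congr rfl fun n _ => ?_
    rw [ecoeff_monomial_mul]
    congr 2
  · intro h
    obtain ⟨i, hi⟩ := Finsupp.ne_iff.1 hδ
    have h1 := h i
    have h2 := hM i
    simp only [Pi.sub_apply, Pi.zero_apply, Finsupp.smul_apply, smul_eq_mul] at h1
    have h3 : 1 ≤ δ i := Nat.one_le_iff_ne_zero.2 hi
    have h4 : M * 1 ≤ M * δ i := Nat.mul_le_mul_left _ h3
    omega

/-- The series `∑_{ν ≥ 1} (2 ν - 1) x ^ ν = x (1 + x) / (1 - x) ^ 2`. -/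
def oddSeries (R : Type*) [CommRing R] : PowerSeries R :=
  PowerSeries.mk fun ν => if ν = 0 then 0 else 2 * (ν : R) - 1

/-- With `u = t_k / t_l`, the right side is `(t_l r_{lk}² + t_k r_{kl}²) / t_l`. -/
theorem oddSeries_eq : oddSeries R = (geom 1 - 1) ^ 2 + PowerSeries.X * geom 1 ^ 2 := by
  have h1 : geom (1 : R) = 1 + PowerSeries.X * geom 1 := by
    simpa using geom_eq (1 : R)
  have h2 : oddSeries R = PowerSeries.X * oddSeries R +
      PowerSeries.X * (1 + PowerSeries.C 2 * (PowerSeries.X * geom 1)) := by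
    ext n
    rcases n with _ | _ | n
    · simp [oddSeries]
    · simp [oddSeries, PowerSeries.coeff_succ_X_mul]; ring
    · rw [map_add, PowerSeries.coeff_succ_X_mul, PowerSeries.coeff_succ_X_mul, map_add,
        PowerSeries.coeff_C_mul, PowerSeries.coeff_succ_X_mul]
      simp [oddSeries, geom, PowerSeries.coeff_one]; ring
  have h3 : (PowerSeries.C 2 : PowerSeries R) = 2 := map_ofNat _ 2
  rw [h3] at h2
  set g := geom (1 : R)
  have h4 : oddSeries R = g * (PowerSeries.X * (1 + 2 * (PowerSeries.X * g))) := by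
    linear_combination g * h2 - oddSeries R * h1
  rw [h4]
  linear_combination (-(g - 1 + 2 * (PowerSeries.X * g))) * h1

theorem tVar_mul_rSer_sq_add {l k : Fin N} (h : l < k) :
    tVar R l * rSer R l k ^ 2 + tVar R k * rSer R k l ^ 2 =
      tVar R l * lac (uExp l k) (oddSeries R) := by
  have hne := uExp_ne_zero h
  have e : geom (1 : R) - 1 = geom 1 + PowerSeries.C (-1) := by simp [sub_eq_add_neg]
  rw [oddSeries_eq, e, lac_add hne, sq (geom 1 + _), sq (geom 1),
    lac_mul hne, lac_mul hne, lac_mul hne, lac_add hne,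
    lac_C hne, lac_X hne, rSer_of_gt h, rSer_of_lt h, ← tVar_mul_u h.le]
  simp only [map_neg, map_one]; ring

/-- The polynomial in `z_j = x_j ^ 2` that represents `f_m`. -/
def fPol (lam : ℝ) (m : Fin N → ℤ) : Pol N := ecoeff (suf m) (genSer lam)

/-- The value at `z` of `∑ z_j ∂_j² p + c ∑ ∂_j p + 2 lam ∑_{i ≠ j} z_i / (z_i - z_j) ∂_i p`; the
diagonal terms of the double sum vanish because division by zero gives zero. -/
def zOp (lam c : ℝ) (z : Fin N → ℝ) (p : Pol N) : ℝ :=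
  ∑ j, z j * MvPolynomial.eval z (MvPolynomial.pderiv j (MvPolynomial.pderiv j p)) +
    c * ∑ j, MvPolynomial.eval z (MvPolynomial.pderiv j p) +
    2 * lam * ∑ i, ∑ j, z i / (z i - z j) * MvPolynomial.eval z (MvPolynomial.pderiv i p)

theorem ecoeff_derZ (a : Fin N → ℤ) (j : Fin N) (Φ : Ser N) :
    ecoeff a (derZ j Φ) = MvPolynomial.pderiv j (ecoeff a Φ) := by
  by_cases h : 0 ≤ a
  · rw [ecoeff_of_nonneg h, ecoeff_of_nonneg h]; rfl
  · rw [ecoeff_of_not_nonneg h, ecoeff_of_not_nonneg h, map_zero]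

/-- The recurrence for the `f_m`: the coefficient of `∏ t_l ^ m_l` in the kernel function identity.
The bound `M` cuts off the expansion of `t_l r_{lk}² + t_k r_{kl}²` where its terms no longer
contribute to this coefficient. -/
theorem zOp_fPol (lam c : ℝ) (z : Fin N → ℝ) (hz : Function.Injective z) (m : Fin N → ℤ) (M : ℕ)
    (hM : ∀ i, suf m i < M) :
    zOp lam c z (fPol lam m) =
      ∑ l : Fin N, ((m l : ℝ) - 1 + lam * ((N : ℝ) - (l : ℕ))) *
        ((m l : ℝ) - 1 + lam * ((N : ℝ) - (l : ℕ)) + c - lam) *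
          MvPolynomial.eval z (fPol lam (m - Pi.single l 1)) -
        lam * (lam - 1) * ∑ l, ∑ k ∈ Finset.Ioi l, ∑ ν ∈ Finset.range M,
          (if ν = 0 then 0 else 2 * (ν : ℝ) - 1) *
            MvPolynomial.eval z (fPol lam (m - shift l k ν)) := by
  have h := congrArg (fun Φ => MvPolynomial.eval z (ecoeff (suf m) Φ))
    (genSer_identity (N := N) lam c)
  simp only [LinearMap.map_add, LinearMap.map_sub, map_sum, ecoeff_smul, ecoeff_C_mul, ecoeff_derZ,
    map_mul, map_add (MvPolynomial.eval z), map_sub (MvPolynomial.eval z), MvPolynomial.eval_X,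
    ecoeff_suf_tVar_mul, ecoeff_suf_thetaT] at h
  have h1 : ∀ (a : ℝ) (p : Pol N), MvPolynomial.eval z (a • p) = a * MvPolynomial.eval z p := by
    intro a p; rw [MvPolynomial.smul_eval]
  simp only [h1, map_sum, map_add (MvPolynomial.eval z)] at h
  have hq : ∑ i, ∑ j, MvPolynomial.eval z (ecoeff (suf m) (if i = j then 0 else qSer lam i j)) =
      2 * ∑ i, ∑ j, z i / (z i - z j) *
        MvPolynomial.eval z (MvPolynomial.pderiv i (fPol lam m)) := by
    have h2 : ∀ i j, MvPolynomial.eval z (ecoeff (suf m) (if i = j then 0 else qSer lam i j)) =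
        z i / (z i - z j) * MvPolynomial.eval z (MvPolynomial.pderiv i (fPol lam m)) +
        z j / (z j - z i) * MvPolynomial.eval z (MvPolynomial.pderiv j (fPol lam m)) := by
      intro i j
      by_cases hij : i = j
      · subst hij; simp
      · rw [if_neg hij]
        have h3 := congrArg (fun Φ => MvPolynomial.eval z (ecoeff (suf m) Φ)) (sub_mul_qSer lam i j)
        simp only [sub_mul, map_sub, ecoeff_C_mul, ecoeff_derZ, map_mul, MvPolynomial.eval_X] at h3
        have h4 : z i - z j ≠ 0 := sub_ne_zero.2 (hz.ne hij)
        have h5 : z j - z i ≠ 0 := sub_ne_zero.2 (hz.ne (Ne.symm hij))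
        rw [fPol]
        refine mul_left_cancel₀ h4 ?_
        rw [sub_mul, h3, show z j - z i = -(z i - z j) by ring]
        field_simp
        ring
    simp only [h2, Finset.sum_add_distrib]
    rw [Finset.sum_comm (f := fun i j => z j / (z j - z i) * _)]
    ring
  have hw : ecoeff (suf m) ((∑ l, ∑ k, tVar (Pol N) l * rSer (Pol N) l k ^ 2) * genSer lam) =
      ∑ l, ∑ k ∈ Finset.Ioi l, ∑ ν ∈ Finset.range M,
        (if ν = 0 then 0 else 2 * (ν : Pol N) - 1) * fPol lam (m - shift l k ν) := by
    rw [sum_sum_eq_sum_Ioi _ fun l => by rw [rSer_self]; simp]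
    simp only [Finset.sum_mul, map_sum]
    refine Finset.sum_congr rfl fun l _ => Finset.sum_congr rfl fun k hk => ?_
    have hk := Finset.mem_Ioi.1 hk
    rw [tVar_mul_rSer_sq_add hk, mul_assoc, ecoeff_suf_tVar_mul,
      ecoeff_lac_mul (uExp_ne_zero hk) _ _ _ M]
    · refine Finset.sum_congr rfl fun ν _ => ?_
      rw [fPol, oddSeries, PowerSeries.coeff_mk]
      congr 3
      ext i
      rw [map_sub, map_sub, Pi.sub_apply, Pi.sub_apply, Pi.sub_apply, suf_shift hk.le, suf_single]
      ring
    · intro i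
      rw [map_sub, Pi.sub_apply, suf_single]
      have := hM i
      omega
  rw [hq, hw] at h
  unfold zOp
  have hw2 : MvPolynomial.eval z (∑ l, ∑ k ∈ Finset.Ioi l, ∑ ν ∈ Finset.range M,
        (if ν = 0 then 0 else 2 * (ν : Pol N) - 1) * fPol lam (m - shift l k ν)) =
      ∑ l, ∑ k ∈ Finset.Ioi l, ∑ ν ∈ Finset.range M,
        (if ν = 0 then 0 else 2 * (ν : ℝ) - 1) *
          MvPolynomial.eval z (fPol lam (m - shift l k ν)) := by
    simp only [map_sum, map_mul]
    refine Finset.sum_congr rfl fun l _ => Finset.sum_congr rfl fun k _ =>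
      Finset.sum_congr rfl fun ν _ => ?_
    split_ifs <;> simp
  rw [hw2] at h
  rw [fPol] at h ⊢
  rw [show 2 * lam * ∑ i, ∑ j, z i / (z i - z j) *
      MvPolynomial.eval z (MvPolynomial.pderiv i (ecoeff (suf m) (genSer lam))) =
      lam * (2 * ∑ i, ∑ j, z i / (z i - z j) *
      MvPolynomial.eval z (MvPolynomial.pderiv i (ecoeff (suf m) (genSer lam)))) by ring, h]
  congr 1
  refine Finset.sum_congr rfl fun l _ => ?_
  rw [fPol]
  simp only [Pi.sub_apply, Pi.single_eq_same]
  push_cast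
  ring

/-- `f_m` is homogeneous of degree `|m|`. -/
theorem sum_mul_pderiv_fPol (lam : ℝ) (m : Fin N → ℤ) :
    ∑ j, MvPolynomial.X j * MvPolynomial.pderiv j (fPol lam m) =
      ((∑ j, m j : ℤ) : ℝ) • fPol lam m := by
  have h := congrArg (ecoeff (suf m)) (euler_genSer (N := N) lam)
  simp only [map_sum, ecoeff_C_mul, ecoeff_derZ, ecoeff_suf_thetaT] at h
  rw [fPol, h, ← Finset.sum_smul]
  push_cast
  rfl

theorem fPol_eq_zero {lam : ℝ} {m : Fin N → ℤ} (h : ¬ 0 ≤ suf m) : fPol lam m = 0 :=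
  ecoeff_of_not_nonneg h _

theorem coeff_fPol {lam : ℝ} {m : Fin N → ℤ} {b : Fin N →₀ ℕ}
    (h : MvPolynomial.coeff b (fPol lam m) ≠ 0) : ((∑ j, b j : ℕ) : ℤ) = ∑ j, m j := by
  have h1 := congrArg (MvPolynomial.coeff b) (sum_mul_pderiv_fPol lam m)
  rw [MvPolynomial.coeff_sum, MvPolynomial.coeff_smul, smul_eq_mul] at h1
  have h2 : ∀ j, MvPolynomial.coeff b (MvPolynomial.X j * MvPolynomial.pderiv j (fPol lam m)) =
      (b j : ℝ) * MvPolynomial.coeff b (fPol lam m) := by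
    intro j
    rw [MvPolynomial.coeff_X_mul']
    split_ifs with hj
    · have hle : Finsupp.single j 1 ≤ b := by
        rw [Finsupp.single_le_iff]; exact Nat.one_le_iff_ne_zero.2 (Finsupp.mem_support_iff.1 hj)
      rw [MvPolynomial.coeff_pderiv, tsub_add_cancel_of_le hle]
      have : (b - Finsupp.single j 1 : Fin N →₀ ℕ) j + 1 = b j := by
        have := hle j
        simp at this ⊢
        omega
      rw [← Nat.cast_add_one, this]
      ring
    · rw [Finsupp.notMem_support_iff.1 hj]; simp
  simp only [h2, ← Finset.sum_mul] at h1
  have h3 := mul_right_cancel₀ h h1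
  exact_mod_cast h3

theorem isSymmetric_fPol (lam : ℝ) (m : Fin N → ℤ) : (fPol lam m).IsSymmetric := by
  intro e
  have hmap : ∀ Φ : Ser N, MvPolynomial.rename e (ecoeff (suf m) Φ) =
      ecoeff (suf m)
        (MvPowerSeries.map (MvPolynomial.rename e : Pol N →ₐ[ℝ] Pol N).toRingHom Φ) := by
    intro Φ
    by_cases h : 0 ≤ suf m
    · rw [ecoeff_of_nonneg h, ecoeff_of_nonneg h, MvPowerSeries.coeff_map]; rfl
    · rw [ecoeff_of_not_nonneg h, ecoeff_of_not_nonneg h, map_zero]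
  have hbin : ∀ (κ : ℝ) (c : Pol N),
      PowerSeries.map (MvPolynomial.rename e : Pol N →ₐ[ℝ] Pol N).toRingHom (binSeries κ c) =
      binSeries κ (MvPolynomial.rename e c) := by
    intro κ c
    ext n : 1
    simp [binSeries, MvPolynomial.algebraMap_eq]
  rw [fPol, hmap]
  congr 1
  rw [genSer, map_mul, deltaSer, kernelSer, map_prod, map_prod]
  congr 1
  · refine Finset.prod_congr rfl fun j _ => ?_
    rw [map_prod]
    refine Finset.prod_congr rfl fun k hk => ?_
    rw [map_lac (uExp_ne_zero (Finset.mem_Ioi.1 hk)), hbin, map_one]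
  · rw [← Equiv.prod_comp e (fun j => ∏ k, lac (tExp k) (binSeries (-lam) (MvPolynomial.X j)))]
    refine Finset.prod_congr rfl fun j _ => ?_
    rw [map_prod]
    refine Finset.prod_congr rfl fun k _ => ?_
    rw [map_lac (tExp_ne_zero k), hbin, MvPolynomial.rename_X]

end Coefficients

/-! ### The contour integral as coefficient extraction -/

section Contour

variable {N : ℕ}

/-- The value of the monomial with exponent `a` when `t_l = 1 / y_l ^ 2`. -/
def mon (y : Fin N → ℂ) (a : Fin N →₀ ℕ) : ℂ := ∏ l, y l ^ (-2 * wt l a)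

/-- The series `Φ` converges at `t_l = 1 / y_l ^ 2`, with sum `F`. As the sum is unconditional,
convergence is absolute. -/
def SumsTo (y : Fin N → ℂ) (Φ : MvPowerSeries (Fin N) ℂ) (F : ℂ) : Prop :=
  HasSum (fun a => MvPowerSeries.coeff a Φ * mon y a) F

variable {y : Fin N → ℂ}

theorem mon_add (hy : ∀ l, y l ≠ 0) (a b : Fin N →₀ ℕ) : mon y (a + b) = mon y a * mon y b := by
  rw [mon, mon, mon, ← Finset.prod_mul_distrib]
  refine Finset.prod_congr rfl fun l _ => ?_
  rw [map_add, mul_add, zpow_add₀ (hy l)]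

theorem mon_zero : mon y 0 = 1 := by simp [mon]

theorem mon_nsmul (hy : ∀ l, y l ≠ 0) (n : ℕ) (a : Fin N →₀ ℕ) : mon y (n • a) = mon y a ^ n := by
  induction n with
  | zero => simp [mon_zero]
  | succ n ih => rw [succ_nsmul, mon_add hy, ih, pow_succ]

theorem mon_tExp (k : Fin N) : mon y (tExp k) = 1 / y k ^ 2 := by
  rw [mon, Finset.prod_eq_single k]
  · rw [wt_tExp, if_pos rfl, mul_one, one_div]; rfl
  · intro l _ h; rw [wt_tExp, if_neg h]; simp
  · simp

theorem mon_uExp (hy : ∀ l, y l ≠ 0) {j k : Fin N} (h : j < k) :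
    mon y (uExp j k) = y j ^ 2 / y k ^ 2 := by
  have h1 := mon_add hy (tExp j) (uExp j k)
  rw [tExp_add_uExp h.le, mon_tExp, mon_tExp] at h1
  have h2 := hy j
  have h3 := hy k
  field_simp at h1 ⊢
  linear_combination -h1

theorem SumsTo.mul (hy : ∀ l, y l ≠ 0) {Φ Ψ : MvPowerSeries (Fin N) ℂ} {F G : ℂ}
    (h1 : SumsTo y Φ F) (h2 : SumsTo y Ψ G) : SumsTo y (Φ * Ψ) (F * G) := by
  classical
  let u : (Fin N →₀ ℕ) → ℂ := fun a => MvPowerSeries.coeff a Φ * mon y a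
  let v : (Fin N →₀ ℕ) → ℂ := fun a => MvPowerSeries.coeff a Ψ * mon y a
  have hu : HasSum u F := h1
  have hv : HasSum v G := h2
  have h3 : HasSum (fun c : (Fin N →₀ ℕ) × (Fin N →₀ ℕ) => u c.1 * v c.2) (F * G) :=
    hu.mul hv (summable_mul_of_summable_norm hu.summable.norm hv.summable.norm)
  have h4 := (Equiv.hasSum_iff Finset.HasAntidiagonal.sigmaAntidiagonalEquivProd).2 h3
  have h5 := h4.sigma fun a => hasSum_fintype _
  have h6 : (fun a => MvPowerSeries.coeff a (Φ * Ψ) * mon y a) = fun a =>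
      ∑ c : Finset.HasAntidiagonal.antidiagonal a,
        u (c : (Fin N →₀ ℕ) × (Fin N →₀ ℕ)).1 * v (c : (Fin N →₀ ℕ) × (Fin N →₀ ℕ)).2 := by
    funext a
    rw [Finset.sum_coe_sort (Finset.HasAntidiagonal.antidiagonal a) fun c => u c.1 * v c.2,
      MvPowerSeries.coeff_mul, Finset.sum_mul]
    refine Finset.sum_congr rfl fun c hc => ?_
    rw [← Finset.HasAntidiagonal.mem_antidiagonal.1 hc, mon_add hy]
    simp only [u, v]
    ring
  rw [SumsTo, h6]
  exact h5

theorem sumsTo_one : SumsTo y 1 1 := by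
  classical
  have := hasSum_single
    (f := fun a => MvPowerSeries.coeff a (1 : MvPowerSeries (Fin N) ℂ) * mon y a) 0
    (fun a ha => by simp [MvPowerSeries.coeff_one, ha])
  rw [SumsTo]
  simpa [mon_zero] using this

theorem SumsTo.prod (hy : ∀ l, y l ≠ 0) {α : Type*} (s : Finset α)
    {Φ : α → MvPowerSeries (Fin N) ℂ} {F : α → ℂ} (h : ∀ i ∈ s, SumsTo y (Φ i) (F i)) :
    SumsTo y (∏ i ∈ s, Φ i) (∏ i ∈ s, F i) := by
  classical
  induction s using Finset.induction_on with
  | empty => simpa using sumsTo_one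
  | insert a s ha ih =>
    rw [Finset.prod_insert ha, Finset.prod_insert ha]
    exact (h a (Finset.mem_insert_self _ _)).mul hy
      (ih fun i hi => h i (Finset.mem_insert_of_mem hi))

theorem sumsTo_lac (hy : ∀ l, y l ≠ 0) {δ : Fin N →₀ ℕ} (hδ : δ ≠ 0) {f : PowerSeries ℂ} {F : ℂ}
    (h : HasSum (fun n => PowerSeries.coeff n f * mon y δ ^ n) F) : SumsTo y (lac δ f) F := by
  refine ((nsmul_left_injective_of_ne_zero hδ).hasSum_iff ?_).1 ?_
  · intro a ha
    rw [coeff_lac_of_ne hδ, zero_mul]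
    exact fun n hn => ha ⟨n, hn⟩
  · convert h using 2 with n
    simp only [Function.comp_apply, coeff_lac_smul hδ, mon_nsmul hy]

theorem hasSum_binSeries (κ : ℝ) {c u : ℂ} (h : ‖c * u‖ < 1) :
    HasSum (fun n => PowerSeries.coeff n (binSeries κ c) * u ^ n) ((1 - c * u) ^ (κ : ℂ)) := by
  have h1 := (Complex.one_add_cpow_hasFPowerSeriesOnBall_zero (a := (κ : ℂ))).hasSum
    (y := -(c * u)) (by
      rw [Metric.mem_eball, edist_zero_right, ← ofReal_norm, ENNReal.ofReal_lt_one, norm_neg]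
      exact h)
  simp only [zero_add] at h1
  rw [← sub_eq_add_neg] at h1
  suffices h3 : (fun n => PowerSeries.coeff n (binSeries κ c) * u ^ n) =
      fun n => (binomialSeries ℂ (κ : ℂ) n) fun _ => -(c * u) by
    rw [h3]; exact h1
  funext n
  rw [binomialSeries_apply]
  have h2 : (Ring.choose (κ : ℂ) n) = ((Ring.choose κ n : ℝ) : ℂ) :=
    (Ring.map_choose Complex.ofRealHom κ n).symm
  rw [h2]
  simp only [binSeries, bin, PowerSeries.coeff_mk, List.ofFn_const, List.prod_replicate,
    smul_eq_mul]
  simp only [Complex.coe_algebraMap]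
  push_cast
  rw [neg_pow (c * u), mul_pow]
  ring

/-- Evaluation of the coefficients at `z_j = x_j ^ 2`, with values in `ℂ`. -/
def evalC (x : Fin N → ℝ) : Pol N →+* ℂ :=
  Complex.ofRealHom.comp (MvPolynomial.eval fun j => x j ^ 2)

theorem map_evalC_binSeries (x : Fin N → ℝ) (κ : ℝ) (q : Pol N) :
    PowerSeries.map (evalC x) (binSeries κ q) = binSeries κ (evalC x q) := by
  ext n
  simp [binSeries, evalC, MvPolynomial.algebraMap_eq]

/-- On nested circles of radius greater than all `|x j|`, the generating function converges to the
product of principal powers. -/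
theorem sumsTo_genSer (lam : ℝ) (x : Fin N → ℝ) (hmono : ∀ j k, j < k → ‖y j‖ < ‖y k‖)
    (hx : ∀ j k, |x j| < ‖y k‖) :
    SumsTo y (MvPowerSeries.map (evalC x) (genSer lam))
      ((∏ j, ∏ k ∈ Finset.Ioi j, (1 - y j ^ 2 / y k ^ 2) ^ (lam : ℂ)) /
          ∏ j, ∏ k, (1 - (x j : ℂ) ^ 2 / y k ^ 2) ^ (lam : ℂ)) := by
  have hy : ∀ l, y l ≠ 0 := fun l => norm_pos_iff.1 ((abs_nonneg _).trans_lt (hx l l))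
  rw [genSer, map_mul, deltaSer, kernelSer, div_eq_mul_inv, map_prod, map_prod]
  refine SumsTo.mul hy (SumsTo.prod hy _ fun j _ => ?_) ?_
  · rw [map_prod]
    refine SumsTo.prod hy _ fun k hk => ?_
    have hk := Finset.mem_Ioi.1 hk
    rw [map_lac (uExp_ne_zero hk), map_evalC_binSeries, map_one]
    refine sumsTo_lac hy (uExp_ne_zero hk) ?_
    rw [mon_uExp hy hk]
    have := hasSum_binSeries lam (c := 1) (u := y j ^ 2 / y k ^ 2) ?_
    · simpa using this
    · rw [one_mul, norm_div, norm_pow, norm_pow, ← div_pow]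
      refine pow_lt_one₀ (by positivity) ?_ two_ne_zero
      rw [div_lt_one (norm_pos_iff.2 (hy k))]
      exact hmono j k hk
  · rw [← Finset.prod_inv_distrib]
    refine SumsTo.prod hy _ fun j _ => ?_
    rw [map_prod, ← Finset.prod_inv_distrib]
    refine SumsTo.prod hy _ fun k _ => ?_
    rw [map_lac (tExp_ne_zero k), map_evalC_binSeries]
    refine sumsTo_lac hy (tExp_ne_zero k) ?_
    rw [mon_tExp]
    have := hasSum_binSeries (-lam) (c := evalC x (MvPolynomial.X j)) (u := 1 / y k ^ 2) ?_
    · rw [Complex.ofReal_neg, Complex.cpow_neg] at this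
      simpa [evalC, div_eq_mul_inv] using this
    · rw [norm_mul, norm_div, norm_pow, norm_one, mul_one_div]
      have : ‖evalC x (MvPolynomial.X j)‖ = |x j| ^ 2 := by simp [evalC]
      rw [this, ← div_pow]
      refine pow_lt_one₀ (by positivity) ?_ two_ne_zero
      rw [div_lt_one (norm_pos_iff.2 (hy k))]
      exact hx j k

theorem integral_exp_int (k : ℤ) :
    ∫ θ in Set.Icc 0 (2 * Real.pi), (1 / (2 * (Real.pi : ℂ))) * Complex.exp (k * (θ * Complex.I)) =
      if k = 0 then 1 else 0 := by
  rw [MeasureTheory.integral_const_mul, MeasureTheory.integral_Icc_eq_integral_Ioc,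
    ← intervalIntegral.integral_of_le (by positivity)]
  have hpi : (Real.pi : ℂ) ≠ 0 := by exact_mod_cast Real.pi_ne_zero
  split_ifs with h
  · subst h
    simp
    field_simp
  · have hc : (k : ℂ) * Complex.I ≠ 0 := mul_ne_zero (by exact_mod_cast h) Complex.I_ne_zero
    have h1 : ∀ θ : ℝ, Complex.exp (k * (θ * Complex.I)) = Complex.exp ((k * Complex.I) * θ) :=
      fun θ => by congr 1; ring
    simp only [h1]
    rw [integral_exp_mul_complex hc]
    have h2 : Complex.exp (k * Complex.I * ((2 * Real.pi : ℝ) : ℂ)) = 1 := by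
      rw [Complex.exp_eq_one_iff]
      exact ⟨k, by push_cast; ring⟩
    rw [h2]; simp

/-- The contour integral is evaluated termwise: on the torus the integrand is an absolutely
convergent series, and only the term with exponent `∏ y_l ^ (-2 n_l)` has a non-zero integral. -/
theorem f_eq_eval_fPol (lam : ℝ) {ε : ℝ} (hε : 0 < ε) (n : Fin N → ℤ) (x : Fin N → ℝ) :
    f lam ε n x = ((MvPolynomial.eval (fun j => x j ^ 2) (fPol lam n) : ℝ) : ℂ) := by
  classical
  set Φ : MvPowerSeries (Fin N) ℂ := MvPowerSeries.map (evalC x) (genSer lam) with hΦ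
  have hR : ∀ j, ‖x‖ < radius ε x j := fun j => by
    have : 0 < ε * ((j : ℕ) + 1 : ℝ) := by positivity
    rw [radius]; linarith
  have hR0 : ∀ j, 0 < radius ε x j := fun j => (norm_nonneg x).trans_lt (hR j)
  have hRC : ∀ j, (radius ε x j : ℂ) ≠ 0 := fun j => by exact_mod_cast (hR0 j).ne'
  have hnorm : ∀ θ : Fin N → ℝ, ∀ j, ‖torusMap 0 (radius ε x) θ j‖ = radius ε x j := by
    intro θ j
    simp [torusMap, Complex.norm_exp_ofReal_mul_I, abs_of_pos (hR0 j)]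
  have hne : ∀ θ : Fin N → ℝ, ∀ j, torusMap 0 (radius ε x) θ j ≠ 0 := fun θ j =>
    norm_pos_iff.1 (by rw [hnorm]; exact hR0 j)
  have hsum : ∀ θ : Fin N → ℝ, SumsTo (torusMap 0 (radius ε x) θ) Φ _ := fun θ =>
    sumsTo_genSer lam x
      (fun j k h => by
        rw [hnorm, hnorm, radius, radius]
        have : ((j : ℕ) : ℝ) < (k : ℕ) := by exact_mod_cast h
        have := mul_lt_mul_of_pos_left this hε
        linarith)
      (fun j k => by
        rw [hnorm]
        exact (norm_le_pi_norm x j).trans_lt (hR k))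
  -- The terms of the expansion of the integrand.
  let T : (Fin N →₀ ℕ) → (Fin N → ℝ) → ℂ := fun a θ =>
    (MvPowerSeries.coeff a Φ * ∏ j, (radius ε x j : ℂ) ^ (2 * (n j - wt j a))) *
      ∏ j, (1 / (2 * (Real.pi : ℂ)) *
        Complex.exp (((2 * (n j - wt j a) : ℤ) : ℂ) * (θ j * Complex.I)))
  have hT : ∀ a θ, T a θ = (∏ j, (radius ε x j : ℂ) * Complex.exp (θ j * Complex.I) * Complex.I) *
      ((∏ j, torusMap 0 (radius ε x) θ j ^ (2 * n j) /
        (2 * (Real.pi : ℂ) * Complex.I * torusMap 0 (radius ε x) θ j)) *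
        (MvPowerSeries.coeff a Φ * mon (torusMap 0 (radius ε x) θ) a)) := by
    intro a θ
    simp only [T, mon]
    rw [mul_assoc, ← Finset.prod_mul_distrib, mul_left_comm _ (MvPowerSeries.coeff a Φ),
      mul_left_comm _ (MvPowerSeries.coeff a Φ), ← Finset.prod_mul_distrib,
      ← Finset.prod_mul_distrib]
    congr 1
    refine Finset.prod_congr rfl fun j _ => ?_
    have h1 := hne θ j
    have h2 : torusMap 0 (radius ε x) θ j = radius ε x j * Complex.exp (θ j * Complex.I) := by
      simp [torusMap]
    have hpi : (Real.pi : ℂ) ≠ 0 := by exact_mod_cast Real.pi_ne_zero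
    rw [Complex.exp_int_mul, ← h2, mul_left_comm, ← mul_zpow, ← h2,
      show 2 * (n j - wt j a) = 2 * n j + -2 * wt j a by ring, zpow_add₀ h1]
    field_simp [Complex.I_ne_zero]
  have hsumT : ∀ θ : Fin N → ℝ, HasSum (fun a => T a θ)
      ((∏ i, (radius ε x i : ℂ) * Complex.exp (θ i * Complex.I) * Complex.I) •
        ((∏ j, torusMap 0 (radius ε x) θ j ^ (2 * n j) /
          (2 * (Real.pi : ℂ) * Complex.I * torusMap 0 (radius ε x) θ j)) *
        ((∏ j, ∏ k ∈ Finset.Ioi j, (1 - torusMap 0 (radius ε x) θ j ^ 2 /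
          torusMap 0 (radius ε x) θ k ^ 2) ^ (lam : ℂ)) /
          ∏ j, ∏ k, (1 - (x j : ℂ) ^ 2 / torusMap 0 (radius ε x) θ k ^ 2) ^ (lam : ℂ)))) := by
    intro θ
    simp only [hT, smul_eq_mul]
    exact ((hsum θ).mul_left _).mul_left _
  -- On the torus `‖T a θ‖` is constant, so summability at `θ = 0` gives dominated convergence.
  have hnormT : ∀ a θ, ‖T a θ‖ = ‖T a 0‖ := by
    intro a θ
    simp only [T, norm_mul, norm_prod]
    congr 1
    refine Finset.prod_congr rfl fun j _ => ?_
    congr 1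
    have : ∀ s : ℝ, ‖Complex.exp (((2 * (n j - wt j a) : ℤ) : ℂ) * (s * Complex.I))‖ = 1 := by
      intro s
      have := Complex.norm_exp_ofReal_mul_I ((2 * (n j - wt j a) : ℤ) * s)
      rw [← this]; congr 2; push_cast; ring
    rw [this, this]
  have hcont : ∀ a, Continuous (T a) := by
    intro a
    simp only [T]
    fun_prop
  have hint : ∀ a, ∫ θ in Set.Icc (0 : Fin N → ℝ) fun _ => 2 * Real.pi, T a θ =
      if a = natExp (suf n) ∧ 0 ≤ suf n then MvPowerSeries.coeff a Φ else 0 := by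
    intro a
    simp only [T]
    rw [MeasureTheory.integral_const_mul, ← Set.pi_univ_Icc, MeasureTheory.volume_pi,
      MeasureTheory.Measure.restrict_pi_pi]
    rw [MeasureTheory.integral_fintype_prod_eq_prod (fun (j : Fin N) (θ : ℝ) =>
      (1 / (2 * (Real.pi : ℂ)) *
        Complex.exp (((2 * (n j - wt j a) : ℤ) : ℂ) * (θ * Complex.I))))]
    simp only [Pi.zero_apply, integral_exp_int]
    split_ifs with h
    · have h' := (wt_eq_iff a n).2 ⟨h.2, h.1⟩
      simp [h']
    · have h' : ¬ ∀ l, wt l a = n l := fun h'' =>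
        h ⟨((wt_eq_iff a n).1 h'').2, ((wt_eq_iff a n).1 h'').1⟩
      push Not at h'
      obtain ⟨l, hl⟩ := h'
      have h0 : ∏ j, (if 2 * (n j - wt j a) = 0 then (1 : ℂ) else 0) = 0 :=
        Finset.prod_eq_zero (Finset.mem_univ l) (if_neg (by omega))
      rw [h0, mul_zero]
  have h1 := MeasureTheory.hasSum_integral_of_summable_integral_norm
    (μ := MeasureTheory.volume.restrict (Set.Icc (0 : Fin N → ℝ) fun _ => 2 * Real.pi)) (F := T)
    (fun a => (hcont a).continuousOn.integrableOn_compact isCompact_Icc) (by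
      simp only [hnormT]
      simp only [MeasureTheory.integral_const]
      exact (hsumT 0).summable.norm.const_smul _)
  have h2 : f lam ε n x = ∫ θ in Set.Icc (0 : Fin N → ℝ) fun _ => 2 * Real.pi, ∑' a, T a θ := by
    rw [f, torusIntegral]
    congr 1
    funext θ
    exact (hsumT θ).tsum_eq.symm
  rw [h2, ← h1.tsum_eq]
  simp only [hint]
  rw [fPol]
  by_cases h : 0 ≤ suf n
  · rw [ecoeff_of_nonneg h, tsum_eq_single (natExp (suf n))]
    · simp only [h, and_self, if_true, hΦ, MvPowerSeries.coeff_map]; rfl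
    · intro a ha; simp [ha]
  · rw [ecoeff_of_not_nonneg h]; simp [h]

end Contour

/-! ### Non-vanishing of `f_n` for a partition `n` -/

section Nonvanishing

open MvPolynomial in
/-- By Newton's identities, as `ℝ` has characteristic zero. -/
theorem esymm_mem_adjoin_psum (σ : Type*) [Fintype σ] (k : ℕ) :
    esymm σ ℝ k ∈ Algebra.adjoin ℝ {q | ∃ r : ℕ, 1 ≤ r ∧ q = psum σ ℝ r} := by
  induction k using Nat.strong_induction_on with
  | _ k ih =>
    rcases Nat.eq_zero_or_pos k with rfl | hk
    · rw [esymm_zero]; exact one_mem _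
    · have h := mul_esymm_eq_sum σ ℝ k
      have h1 : esymm σ ℝ k = (1 / (k : ℝ)) • ((k : MvPolynomial σ ℝ) * esymm σ ℝ k) := by
        rw [← nsmul_eq_mul, ← Nat.cast_smul_eq_nsmul ℝ, smul_smul,
          one_div_mul_cancel (by exact_mod_cast hk.ne'), one_smul]
      rw [h1, h]
      have hneg : ∀ i : ℕ, ((-1 : MvPolynomial σ ℝ) ^ i) ∈
          Algebra.adjoin ℝ {q | ∃ r : ℕ, 1 ≤ r ∧ q = psum σ ℝ r} := fun i =>
        pow_mem (neg_mem (one_mem _)) i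
      refine Subalgebra.smul_mem _ (mul_mem (hneg _) (sum_mem fun a ha => ?_)) _
      rw [Finset.mem_filter, Finset.HasAntidiagonal.mem_antidiagonal] at ha
      exact mul_mem (mul_mem (hneg _) (ih _ ha.2)) (Algebra.subset_adjoin ⟨a.2, by omega, rfl⟩)

open MvPolynomial in
/-- Over `ℝ`, the power sums generate the symmetric polynomials. -/
theorem mem_adjoin_psum_of_isSymmetric {N : ℕ} {p : MvPolynomial (Fin N) ℝ} (hp : p.IsSymmetric) :
    p ∈ Algebra.adjoin ℝ {q | ∃ r : ℕ, 1 ≤ r ∧ q = psum (Fin N) ℝ r} := by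
  have key : ∀ q : MvPolynomial (Fin N) ℝ,
      aeval (fun i : Fin N => esymm (Fin N) ℝ (i + 1)) q ∈
        Algebra.adjoin ℝ {q | ∃ r : ℕ, 1 ≤ r ∧ q = psum (Fin N) ℝ r} := by
    intro q
    induction q using MvPolynomial.induction_on with
    | C a => rw [aeval_C]; exact Subalgebra.algebraMap_mem _ _
    | add p q hp hq => rw [map_add]; exact add_mem hp hq
    | mul_X p i hp =>
      rw [map_mul, aeval_X]
      exact mul_mem hp (esymm_mem_adjoin_psum _ _)
  obtain ⟨q, hq⟩ := esymmAlgHom_fin_surjective ℝ (le_refl N)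
    (⟨p, hp⟩ : symmetricSubalgebra (Fin N) ℝ)
  have h1 : (esymmAlgHom (Fin N) ℝ N q : MvPolynomial (Fin N) ℝ) = p := congrArg Subtype.val hq
  rw [esymmAlgHom_apply] at h1
  rw [← h1]
  exact key q

/-- The product of the power sums `p_r`, where `r` runs through a list. -/
def psumProd (N : ℕ) (L : List ℕ) : Pol N := (L.map (MvPolynomial.psum (Fin N) ℝ)).prod

variable {N : ℕ}

theorem psumProd_cons (r : ℕ) (L : List ℕ) :
    psumProd N (r :: L) = MvPolynomial.psum (Fin N) ℝ r * psumProd N L := by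
  simp [psumProd]

theorem psumProd_append (L L' : List ℕ) :
    psumProd N (L ++ L') = psumProd N L * psumProd N L' := by
  simp [psumProd]

theorem mem_span_psumProd {p : Pol N} (hp : p.IsSymmetric) :
    p ∈ Submodule.span ℝ {q | ∃ L : List ℕ, (∀ r ∈ L, 1 ≤ r) ∧ q = psumProd N L} := by
  have h := mem_adjoin_psum_of_isSymmetric hp
  rw [← Subalgebra.mem_toSubmodule, Algebra.adjoin_eq_span] at h
  refine Submodule.span_mono (fun q hq => ?_) h
  induction hq using Submonoid.closure_induction with
  | mem x hx =>
    obtain ⟨r, hr, rfl⟩ := hx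
    exact ⟨[r], by simpa using hr, by simp [psumProd]⟩
  | one => exact ⟨[], by simp, by simp [psumProd]⟩
  | mul x y _ _ hx hy =>
    obtain ⟨L, hL, rfl⟩ := hx
    obtain ⟨L', hL', rfl⟩ := hy
    refine ⟨L ++ L', fun r hr => ?_, (psumProd_append L L').symm⟩
    rcases List.mem_append.1 hr with h | h
    · exact hL r h
    · exact hL' r h

/-- Substitution of the variables `t_l` into a polynomial. -/
def subsT : Pol N →ₐ[ℝ] MvPowerSeries (Fin N) ℝ := MvPolynomial.aeval (tVar ℝ)

/-- The linear functional that sends a polynomial `q` to the coefficient of `∏ t_l ^ n_l` in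
`∏_{j < k} (1 - t_k / t_j) ^ lam · q(t)`. -/
def pairing (lam : ℝ) (n : Fin N → ℤ) : Pol N →ₗ[ℝ] ℝ :=
  (ecoeff (suf n)).comp ((LinearMap.mulLeft ℝ (deltaSer ℝ lam)).comp subsT.toLinearMap)

theorem pairing_apply (lam : ℝ) (n : Fin N → ℤ) (q : Pol N) :
    pairing lam n q = ecoeff (suf n) (deltaSer ℝ lam * subsT q) := rfl

/-- The coefficientwise application of a linear functional. -/
def applyCoeff (c : Pol N →ₗ[ℝ] ℝ) (Φ : Ser N) : MvPowerSeries (Fin N) ℝ :=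
  fun a => c (MvPowerSeries.coeff a Φ)

theorem coeff_applyCoeff (c : Pol N →ₗ[ℝ] ℝ) (Φ : Ser N) (a : Fin N →₀ ℕ) :
    MvPowerSeries.coeff a (applyCoeff c Φ) = c (MvPowerSeries.coeff a Φ) := rfl

theorem applyCoeff_add (c : Pol N →ₗ[ℝ] ℝ) (Φ Ψ : Ser N) :
    applyCoeff c (Φ + Ψ) = applyCoeff c Φ + applyCoeff c Ψ := by
  ext a; simp [coeff_applyCoeff]

theorem applyCoeff_sum {α : Type*} (c : Pol N →ₗ[ℝ] ℝ) (s : Finset α) (Φ : α → Ser N) :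
    applyCoeff c (∑ i ∈ s, Φ i) = ∑ i ∈ s, applyCoeff c (Φ i) := by
  ext a; simp [coeff_applyCoeff]

theorem applyCoeff_map_mul (c : Pol N →ₗ[ℝ] ℝ) (Ψ : MvPowerSeries (Fin N) ℝ) (Φ : Ser N) :
    applyCoeff c (MvPowerSeries.map (algebraMap ℝ (Pol N)) Ψ * Φ) = Ψ * applyCoeff c Φ := by
  classical
  ext a
  rw [coeff_applyCoeff, MvPowerSeries.coeff_mul, MvPowerSeries.coeff_mul, map_sum]
  refine Finset.sum_congr rfl fun x _ => ?_
  rw [MvPowerSeries.coeff_map, ← Algebra.smul_def, map_smul, coeff_applyCoeff, smul_eq_mul]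

theorem applyCoeff_thetaT (c : Pol N →ₗ[ℝ] ℝ) (l : Fin N) (Φ : Ser N) :
    applyCoeff c (thetaT l Φ) = thetaT l (applyCoeff c Φ) := by
  ext a
  rw [coeff_applyCoeff, coeff_weightDer, coeff_weightDer, coeff_applyCoeff, ← zsmul_eq_mul,
    map_zsmul, zsmul_eq_mul]

theorem map_deltaSer (lam : ℝ) :
    MvPowerSeries.map (algebraMap ℝ (Pol N)) (deltaSer (N := N) ℝ lam) = deltaSer (Pol N) lam := by
  rw [deltaSer, deltaSer, map_prod]
  refine Finset.prod_congr rfl fun j _ => ?_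
  rw [map_prod]
  refine Finset.prod_congr rfl fun k hk => ?_
  rw [map_lac (uExp_ne_zero (Finset.mem_Ioi.1 hk))]
  congr 1
  ext n : 1
  simp [binSeries]

theorem map_tVar (l : Fin N) :
    MvPowerSeries.map (algebraMap ℝ (Pol N)) (tVar ℝ l) = tVar (Pol N) l := by
  rw [tVar, tVar, MvPowerSeries.map_monomial, map_one]

/-- Write the kernel `∏ (1 - z_j t_k) ^ (-lam)` as `∑ a_i(t) b_i(z)`. Then `quad lam n M` is
`∑ c(M a_i) c(M b_i)` with `c = pairing lam n`. -/
def quad (lam : ℝ) (n : Fin N → ℤ) (M : Pol N) : ℝ :=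
  ecoeff (suf n) (deltaSer ℝ lam * subsT M *
    applyCoeff (pairing lam n) (MvPowerSeries.C M * kernelSer lam))

/-- The Euler operator `∑ t_l ∂/∂t_l`. -/
def euler : Derivation ℝ (MvPowerSeries (Fin N) ℝ) (MvPowerSeries (Fin N) ℝ) :=
  weightDer (∑ l, wt l)

theorem euler_apply (Φ : MvPowerSeries (Fin N) ℝ) : euler Φ = ∑ l, thetaT l Φ := by
  ext a
  rw [euler, coeff_weightDer, map_sum, AddMonoidHom.finsetSum_apply, Int.cast_sum, Finset.sum_mul]
  rfl

theorem ecoeff_euler (n : Fin N → ℤ) (Φ : MvPowerSeries (Fin N) ℝ) :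
    ecoeff (suf n) (euler Φ) = ((∑ j, n j : ℤ) : ℝ) * ecoeff (suf n) Φ := by
  rw [euler_apply, map_sum]
  simp only [ecoeff_suf_thetaT, smul_eq_mul]
  rw [Int.cast_sum, Finset.sum_mul]

/-- The factors `(1 - t_k / t_j) ^ lam` are homogeneous of degree zero. -/
theorem euler_deltaSer (lam : ℝ) : euler (deltaSer (N := N) ℝ lam) = 0 := by
  rw [euler_apply]
  simp only [thetaT_deltaSer]
  rw [← Finset.sum_mul, ← Finset.mul_sum, sum_add_sum_rSer]
  simp

theorem euler_tVar (l : Fin N) : euler (tVar ℝ l) = tVar ℝ l := by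
  rw [euler_apply]; simp [thetaT_tVar]

theorem subsT_psum (r : ℕ) : subsT (MvPolynomial.psum (Fin N) ℝ r) = ∑ l, tVar ℝ l ^ r := by
  simp [subsT, MvPolynomial.psum]

theorem euler_subsT_psumProd (L : List ℕ) :
    euler (subsT (psumProd N L)) = (L.sum : ℝ) • subsT (psumProd N L) := by
  induction L with
  | nil => simp [psumProd]
  | cons r L ih =>
    have h1 : euler (subsT (MvPolynomial.psum (Fin N) ℝ r)) =
        (r : ℝ) • subsT (MvPolynomial.psum (Fin N) ℝ r) := by
      rw [subsT_psum, map_sum, Finset.smul_sum]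
      refine Finset.sum_congr rfl fun l _ => ?_
      rw [Derivation.leibniz_pow, euler_tVar]
      rcases r with _ | r
      · simp
      · rw [Nat.add_sub_cancel, smul_eq_mul, ← pow_succ, Nat.cast_smul_eq_nsmul]
    rw [psumProd_cons, map_mul, Derivation.leibniz, ih, h1]
    simp only [smul_eq_mul, List.sum_cons]
    push_cast
    rw [add_smul, mul_smul_comm, mul_smul_comm, mul_comm (subsT (psumProd N L))]
    abel

/-- All `t_l = v_0 ⋯ v_l` are multiples of `v_0`, so the order in `v_0` bounds the degree in the
`t_l` from below. -/
theorem X_pow_dvd_tVar_pow {R : Type*} [CommRing R] (i l : Fin N) (hi : (i : ℕ) = 0) (r : ℕ) :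
    (MvPowerSeries.X i : MvPowerSeries (Fin N) R) ^ r ∣ tVar R l ^ r := by
  refine pow_dvd_pow_of_dvd ?_ r
  rw [MvPowerSeries.X_dvd_iff]
  intro m hm
  rw [tVar, MvPowerSeries.coeff_monomial_ne]
  rintro rfl
  rw [tExp_apply, if_pos] at hm
  · exact one_ne_zero hm
  · rw [Fin.le_def, hi]; exact Nat.zero_le _

theorem X_pow_dvd_subsT (i : Fin N) (hi : (i : ℕ) = 0) (L : List ℕ) :
    (MvPowerSeries.X i : MvPowerSeries (Fin N) ℝ) ^ L.sum ∣ subsT (psumProd N L) := by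
  induction L with
  | nil => simp
  | cons r L ih =>
    rw [psumProd_cons, map_mul, List.sum_cons, pow_add]
    refine mul_dvd_mul ?_ ih
    rw [subsT_psum]
    exact Finset.dvd_sum fun l _ => X_pow_dvd_tVar_pow i l hi r

/-- The exponent of `v_0` in `∏ t_l ^ n_l` is the degree. -/
theorem suf_zero (i : Fin N) (hi : (i : ℕ) = 0) (n : Fin N → ℤ) : suf n i = ∑ j, n j := by
  rw [suf_apply]
  congr 1
  ext j; simp [Fin.le_def, hi]

/-- The coefficient vanishes on multiples of `v_0 ^ r` if `r` exceeds the degree. -/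
theorem ecoeff_eq_zero_of_dvd {i : Fin N} (hi : (i : ℕ) = 0) {n : Fin N → ℤ} {r : ℕ}
    {Φ : MvPowerSeries (Fin N) ℝ} (h : (MvPowerSeries.X i) ^ r ∣ Φ) (hr : ∑ j, n j < r) :
    ecoeff (suf n) Φ = 0 := by
  by_cases h0 : 0 ≤ suf n
  · rw [ecoeff_of_nonneg h0]
    refine MvPowerSeries.X_pow_dvd_iff.1 h _ ?_
    rw [natExp_apply, suf_zero i hi]
    have := h0 i
    rw [suf_zero i hi] at this
    simp only [Pi.zero_apply] at this
    omega
  · exact ecoeff_of_not_nonneg h0 _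

/-- The first terms of the geometric series `1 / (1 - z_j t_k)`. -/
theorem pSer_eq_sum (j k : Fin N) (D : ℕ) :
    pSer j k - 1 = ∑ r ∈ Finset.Icc 1 D,
      MvPowerSeries.C (MvPolynomial.X j ^ r) * tVar (Pol N) k ^ r +
        tVar (Pol N) k ^ (D + 1) * (MvPowerSeries.C (MvPolynomial.X j ^ (D + 1)) * pSer j k) := by
  induction D with
  | zero =>
    have := pSer_eq j k
    simp only [zero_add, pow_one]
    rw [Finset.Icc_eq_empty (by norm_num), Finset.sum_empty]
    linear_combination this
  | succ D ih =>
    rw [ih, Finset.sum_Icc_succ_top (by omega)]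
    have := pSer_eq j k
    simp only [map_pow]
    simp only [map_pow] at ih
    linear_combination
      tVar (Pol N) k ^ (D + 1) * MvPowerSeries.C (MvPolynomial.X j) ^ (D + 1) * this

/-- The first terms of the expansion of `∑ z_j t_l / (1 - z_j t_l)` in power sums of `z`. -/
theorem sum_pSer_sub_one (l : Fin N) (k : ℕ) :
    ∑ j, (pSer j l - 1) = ∑ r ∈ Finset.Icc 1 k,
      tVar (Pol N) l ^ r * MvPowerSeries.C (MvPolynomial.psum (Fin N) ℝ r) +
      tVar (Pol N) l ^ (k + 1) *
        ∑ j, MvPowerSeries.C (MvPolynomial.X j ^ (k + 1)) * pSer j l := by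
  rw [Finset.sum_congr rfl fun j _ => pSer_eq_sum j l k, Finset.sum_add_distrib,
    Finset.sum_comm, ← Finset.mul_sum]
  congr 1
  refine Finset.sum_congr rfl fun r _ => ?_
  rw [← Finset.sum_mul, ← map_sum, mul_comm]; rfl

theorem map_smul_tVar_pow (lam : ℝ) (l : Fin N) (r : ℕ) :
    MvPowerSeries.map (algebraMap ℝ (Pol N)) (lam • tVar ℝ l ^ r) =
      MvPowerSeries.C (algebraMap ℝ (Pol N) lam) * tVar (Pol N) l ^ r := by
  rw [MvPowerSeries.smul_eq_C_mul, map_mul, MvPowerSeries.map_C, map_pow, map_tVar]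

theorem thetaT_C_mul_kernelSer (lam : ℝ) (k : ℕ) (l : Fin N) (M : Pol N) :
    thetaT l (MvPowerSeries.C M * kernelSer lam) =
      ∑ r ∈ Finset.Icc 1 k, MvPowerSeries.map (algebraMap ℝ (Pol N)) (lam • tVar ℝ l ^ r) *
        (MvPowerSeries.C (MvPolynomial.psum (Fin N) ℝ r * M) * kernelSer lam) +
      MvPowerSeries.map (algebraMap ℝ (Pol N)) (lam • tVar ℝ l ^ (k + 1)) * ∑ j,
        MvPowerSeries.C (MvPolynomial.X j ^ (k + 1)) * pSer j l *
          (MvPowerSeries.C M * kernelSer lam) := by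
  have h1 : ∑ r ∈ Finset.Icc 1 k, MvPowerSeries.map (algebraMap ℝ (Pol N)) (lam • tVar ℝ l ^ r) *
        (MvPowerSeries.C (MvPolynomial.psum (Fin N) ℝ r * M) * kernelSer lam) =
      MvPowerSeries.C (algebraMap ℝ (Pol N) lam) * (∑ r ∈ Finset.Icc 1 k,
        tVar (Pol N) l ^ r * MvPowerSeries.C (MvPolynomial.psum (Fin N) ℝ r)) *
          (MvPowerSeries.C M * kernelSer lam) := by
    rw [Finset.mul_sum, Finset.sum_mul]
    refine Finset.sum_congr rfl fun r _ => ?_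
    rw [map_smul_tVar_pow, map_mul MvPowerSeries.C]
    generalize MvPowerSeries.C (algebraMap ℝ (Pol N) lam) = a
    generalize MvPowerSeries.C (MvPolynomial.psum (Fin N) ℝ r) = b
    generalize (MvPowerSeries.C M : Ser N) = c
    generalize (kernelSer lam : Ser N) = d
    ring
  rw [Derivation.leibniz, thetaT_C, thetaT_kernelSer, sum_pSer_sub_one l k, h1,
    map_smul_tVar_pow, ← Finset.sum_mul, smul_zero, add_zero, smul_eq_mul]
  generalize MvPowerSeries.C (algebraMap ℝ (Pol N) lam) = a
  generalize (∑ j, MvPowerSeries.C (MvPolynomial.X j ^ (k + 1)) * pSer j l : Ser N) = b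
  generalize (∑ r ∈ Finset.Icc 1 k,
        tVar (Pol N) l ^ r * MvPowerSeries.C (MvPolynomial.psum (Fin N) ℝ r) : Ser N) = e
  generalize (MvPowerSeries.C M : Ser N) = c
  generalize (kernelSer lam : Ser N) = d
  ring

/-- The recursion for `quad` that comes from Euler's identity for the kernel: the Euler operator
`∑ t_l ∂/∂t_l` multiplies the extracted coefficient by `|n|`, and it multiplies the kernel by
`lam ∑_r p_r(z) p_r(t)`. The terms with `r > k` exceed the degree. -/
theorem quad_recursion (lam : ℝ) (n : Fin N → ℤ) (i : Fin N) (hi : (i : ℕ) = 0) (L : List ℕ) (k : ℕ)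
    (hk : ((L.sum + k : ℕ) : ℤ) = ∑ j, n j) :
    (k : ℝ) * quad lam n (psumProd N L) =
      lam * ∑ r ∈ Finset.Icc 1 k, quad lam n (psumProd N (r :: L)) := by
  set M := psumProd N L
  set c := pairing lam n
  have hK : euler (applyCoeff c (MvPowerSeries.C M * kernelSer lam)) =
      lam • ∑ r ∈ Finset.Icc 1 k, subsT (MvPolynomial.psum (Fin N) ℝ r) *
        applyCoeff c (MvPowerSeries.C (MvPolynomial.psum (Fin N) ℝ r * M) * kernelSer lam) +
      lam • ∑ l, tVar ℝ l ^ (k + 1) * applyCoeff c (∑ j,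
        MvPowerSeries.C (MvPolynomial.X j ^ (k + 1)) * pSer j l *
          (MvPowerSeries.C M * kernelSer lam)) := by
    rw [euler_apply]
    have h1 : ∀ l : Fin N, thetaT l (applyCoeff c (MvPowerSeries.C M * kernelSer lam)) =
        lam • (∑ r ∈ Finset.Icc 1 k, tVar ℝ l ^ r *
          applyCoeff c (MvPowerSeries.C (MvPolynomial.psum (Fin N) ℝ r * M) * kernelSer lam)) +
        lam • (tVar ℝ l ^ (k + 1) * applyCoeff c (∑ j,
          MvPowerSeries.C (MvPolynomial.X j ^ (k + 1)) * pSer j l *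
            (MvPowerSeries.C M * kernelSer lam))) := by
      intro l
      rw [← applyCoeff_thetaT, thetaT_C_mul_kernelSer lam k l M, applyCoeff_add, applyCoeff_sum]
      simp only [applyCoeff_map_mul, smul_mul_assoc, ← Finset.smul_sum]
    simp only [h1, Finset.sum_add_distrib, ← Finset.smul_sum]
    congr 2
    rw [Finset.sum_comm]
    refine Finset.sum_congr rfl fun r _ => ?_
    rw [subsT_psum, Finset.sum_mul]
  have h := ecoeff_euler n (deltaSer ℝ lam * subsT M *
    applyCoeff c (MvPowerSeries.C M * kernelSer lam))
  rw [Derivation.leibniz, Derivation.leibniz, euler_deltaSer, euler_subsT_psumProd, hK] at h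
  have h5 : ecoeff (suf n) (deltaSer ℝ lam * subsT M * ∑ l, tVar ℝ l ^ (k + 1) * applyCoeff c (∑ j,
        MvPowerSeries.C (MvPolynomial.X j ^ (k + 1)) * pSer j l *
          (MvPowerSeries.C M * kernelSer lam))) = 0 := by
    refine ecoeff_eq_zero_of_dvd hi (r := L.sum + (k + 1)) ?_ (by omega)
    rw [pow_add]
    exact mul_dvd_mul (Dvd.dvd.mul_left (X_pow_dvd_subsT i hi L) _)
      (Finset.dvd_sum fun l _ => Dvd.dvd.mul_right (X_pow_dvd_tVar_pow i l hi _) _)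
  have h6 : ecoeff (suf n) (deltaSer ℝ lam * subsT M * ∑ r ∈ Finset.Icc 1 k,
      subsT (MvPolynomial.psum (Fin N) ℝ r) *
        applyCoeff c (MvPowerSeries.C (MvPolynomial.psum (Fin N) ℝ r * M) * kernelSer lam)) =
      ∑ r ∈ Finset.Icc 1 k, quad lam n (psumProd N (r :: L)) := by
    rw [Finset.mul_sum, map_sum]
    refine Finset.sum_congr rfl fun r _ => ?_
    rw [quad, psumProd_cons, map_mul subsT]
    congr 1; ring
  simp only [smul_eq_mul, mul_add, map_add, mul_smul_comm, ecoeff_smul, h5, h6]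
    at h
  have h7 : ecoeff (suf n) (applyCoeff c (MvPowerSeries.C M * kernelSer lam) *
      (deltaSer ℝ lam * subsT M)) = quad lam n M := by
    rw [quad]; congr 1; ring
  change _ = _ * quad lam n M at h
  rw [h7] at h
  have hk' : ((∑ j, n j : ℤ) : ℝ) = (L.sum : ℝ) + k := by
    rw [← hk, Int.cast_natCast, Nat.cast_add]
  rw [hk', mul_zero, mul_zero, mul_zero, map_zero] at h
  linear_combination -h

theorem X_dvd_kernelSer_sub_one (lam : ℝ) (i : Fin N) (hi : (i : ℕ) = 0) :
    (MvPowerSeries.X i : Ser N) ∣ kernelSer lam - 1 := by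
  have hmul : ∀ a b : Ser N, MvPowerSeries.X i ∣ a - 1 → MvPowerSeries.X i ∣ b - 1 →
      MvPowerSeries.X i ∣ a * b - 1 := by
    intro a b ha hb
    have : a * b - 1 = a * (b - 1) + (a - 1) := by ring
    rw [this]; exact dvd_add (Dvd.dvd.mul_left hb _) ha
  unfold kernelSer
  refine Finset.prod_induction _ (fun a => MvPowerSeries.X i ∣ a - 1) hmul (by simp) fun j _ => ?_
  refine Finset.prod_induction _ (fun a => MvPowerSeries.X i ∣ a - 1) hmul (by simp) fun k _ => ?_
  have h1 := lac_eq_sum_add (tExp_ne_zero k) (binSeries (-lam) (MvPolynomial.X j : Pol N)) 1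
  have h2 : MvPowerSeries.monomial (0 : Fin N →₀ ℕ) (PowerSeries.coeff 0
      (binSeries (-lam) (MvPolynomial.X j : Pol N))) = 1 := by
    simp [binSeries, bin_zero, MvPowerSeries.monomial_zero_one]
  rw [Finset.sum_range_one, zero_smul, h2, one_smul] at h1
  rw [h1, add_sub_cancel_left]
  have := X_pow_dvd_tVar_pow (R := Pol N) i k hi 1
  rw [pow_one, pow_one] at this
  exact Dvd.dvd.mul_right this _

/-- If `M` has the full degree `|n|`, only the constant term of the kernel contributes. -/
theorem quad_of_degree_eq (lam : ℝ) (n : Fin N → ℤ) (i : Fin N) (hi : (i : ℕ) = 0) (L : List ℕ)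
    (hL : (L.sum : ℤ) = ∑ j, n j) :
    quad lam n (psumProd N L) = pairing lam n (psumProd N L) ^ 2 := by
  set M := psumProd N L
  obtain ⟨Ψ, hΨ⟩ := X_dvd_kernelSer_sub_one lam i hi
  have h1 : MvPowerSeries.C M * kernelSer lam = MvPowerSeries.C M +
      MvPowerSeries.map (algebraMap ℝ (Pol N)) (MvPowerSeries.X i) * (MvPowerSeries.C M * Ψ) := by
    rw [MvPowerSeries.map_X]
    linear_combination MvPowerSeries.C M * hΨ
  have h2 : applyCoeff (pairing lam n) (MvPowerSeries.C M) =
      MvPowerSeries.C (pairing lam n M) := by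
    classical
    ext a
    rw [coeff_applyCoeff, MvPowerSeries.coeff_C, MvPowerSeries.coeff_C]
    split_ifs <;> simp
  have h3 : ecoeff (suf n) (deltaSer ℝ lam * subsT M * (MvPowerSeries.X i *
      applyCoeff (pairing lam n) (MvPowerSeries.C M * Ψ))) = 0 := by
    refine ecoeff_eq_zero_of_dvd hi (r := L.sum + 1) ?_ (by omega)
    rw [pow_succ]
    exact mul_dvd_mul (Dvd.dvd.mul_left (X_pow_dvd_subsT i hi L) _) (dvd_mul_right _ _)
  rw [quad, h1, applyCoeff_add, applyCoeff_map_mul, h2, mul_add, map_add, h3, add_zero, mul_comm,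
    ecoeff_C_mul, ← pairing_apply, sq]

/-- Positivity: `quad` is a positive combination of squares of values of `pairing` on products of
power sums. -/
theorem quad_nonneg_and {lam : ℝ} (hlam : 0 < lam) (n : Fin N → ℤ) (i : Fin N) (hi : (i : ℕ) = 0)
    (k : ℕ) : ∀ L : List ℕ, ((L.sum + k : ℕ) : ℤ) = ∑ j, n j →
      0 ≤ quad lam n (psumProd N L) ∧ (quad lam n (psumProd N L) = 0 →
        ∀ L' : List ℕ, (∀ r ∈ L', 1 ≤ r) → L'.sum = k →
          pairing lam n (psumProd N L * psumProd N L') = 0) := by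
  induction k using Nat.strong_induction_on with
  | _ k ih =>
    intro L hL
    rcases Nat.eq_zero_or_pos k with rfl | hk
    · rw [quad_of_degree_eq lam n i hi L (by simpa using hL)]
      refine ⟨sq_nonneg _, fun h L' hL' hs => ?_⟩
      have : L' = [] := by
        rcases L' with _ | ⟨r, L'⟩
        · rfl
        · have := hL' r (by simp)
          simp at hs; omega
      subst this
      have h' := pow_eq_zero_iff (two_ne_zero) |>.1 h
      simpa [psumProd] using h'
    · have hrec := quad_recursion lam n i hi L k hL
      have hstep : ∀ r ∈ Finset.Icc 1 k, (((r :: L).sum + (k - r) : ℕ) : ℤ) = ∑ j, n j := by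
        intro r hr
        rw [Finset.mem_Icc] at hr
        rw [← hL, List.sum_cons]
        congr 1; omega
      have hnn : ∀ r ∈ Finset.Icc 1 k, 0 ≤ quad lam n (psumProd N (r :: L)) := fun r hr =>
        (ih (k - r) (by rw [Finset.mem_Icc] at hr; omega) (r :: L) (hstep r hr)).1
      have hk' : (0 : ℝ) < k := by exact_mod_cast hk
      refine ⟨?_, fun h L' hL' hs => ?_⟩
      · have h1 : 0 ≤ (k : ℝ) * quad lam n (psumProd N L) := by
          rw [hrec]; exact mul_nonneg hlam.le (Finset.sum_nonneg hnn)
        exact nonneg_of_mul_nonneg_right h1 hk'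
      · rw [h, mul_zero] at hrec
        have h2 := (mul_eq_zero.1 hrec.symm).resolve_left hlam.ne'
        rw [Finset.sum_eq_zero_iff_of_nonneg hnn] at h2
        rcases L' with _ | ⟨r, L'⟩
        · simp at hs; omega
        have hr1 := hL' r (by simp)
        rw [List.sum_cons] at hs
        have hr : r ∈ Finset.Icc 1 k := Finset.mem_Icc.2 ⟨hr1, by omega⟩
        have h3 := (ih (k - r) (by omega) (r :: L) (hstep r hr)).2 (h2 r hr) L'
          (fun s hs => hL' s (by simp [hs])) (by omega)
        rw [← h3, psumProd_cons, psumProd_cons]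
        congr 1; ring

/-- The value of the functional at `f_n` is the coefficient, in `z` and `t`, of the kernel. -/
theorem pairing_fPol (lam : ℝ) (n : Fin N → ℤ) :
    pairing lam n (fPol lam n) = quad lam n (psumProd N []) := by
  have h1 : ∀ Φ : Ser N, pairing lam n (ecoeff (suf n) Φ) =
      ecoeff (suf n) (applyCoeff (pairing lam n) Φ) := by
    intro Φ
    by_cases h : 0 ≤ suf n
    · rw [ecoeff_of_nonneg h, ecoeff_of_nonneg h]; rfl
    · rw [ecoeff_of_not_nonneg h, ecoeff_of_not_nonneg h, map_zero]
  rw [fPol, h1, genSer, ← map_deltaSer, applyCoeff_map_mul, quad]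
  simp [psumProd]

/-- If `f_n = 0` then `pairing` kills all symmetric polynomials. -/
theorem pairing_eq_zero {lam : ℝ} (hlam : 0 < lam) (n : Fin N → ℤ) (i : Fin N)
    (hi : (i : ℕ) = 0) (hf : fPol lam n = 0) {p : Pol N} (hp : p.IsSymmetric) :
    pairing lam n p = 0 := by
  refine (Submodule.span_le (p := LinearMap.ker (pairing lam n))).2 ?_ (mem_span_psumProd hp)
  rintro x ⟨L, hL, rfl⟩
  rw [SetLike.mem_coe, LinearMap.mem_ker]
  by_cases hd : (L.sum : ℤ) = ∑ j, n j
  · have h1 := (quad_nonneg_and hlam n i hi L.sum [] (by simpa using hd)).2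
      (by rw [← pairing_fPol, hf, map_zero]) L hL rfl
    simpa [psumProd] using h1
  · have h1 := ecoeff_euler n (deltaSer ℝ lam * subsT (psumProd N L))
    rw [Derivation.leibniz, euler_deltaSer, euler_subsT_psumProd, smul_zero, add_zero, smul_eq_mul,
      mul_smul_comm, ecoeff_smul, ← pairing_apply, smul_eq_mul] at h1
    by_contra hne
    have h2 := mul_right_cancel₀ hne h1
    exact hd (Int.cast_injective (α := ℝ) (by rw [Int.cast_natCast, h2]))

theorem pairing_monomial (lam : ℝ) (n : Fin N → ℤ) (b : Fin N → ℕ) :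
    pairing lam n (∏ j, MvPolynomial.X j ^ b j) =
      ecoeff (suf n - suf fun j => (b j : ℤ)) (deltaSer ℝ lam) := by
  rw [pairing_apply, map_prod]
  have h1 : ∀ (s : Finset (Fin N)) (m : Fin N → ℤ) (Φ : MvPowerSeries (Fin N) ℝ),
      ecoeff (suf m) ((∏ j ∈ s, subsT (MvPolynomial.X j ^ b j)) * Φ) =
      ecoeff (suf (m - ∑ j ∈ s, Pi.single j (b j : ℤ))) Φ := by
    intro s
    induction s using Finset.induction_on with
    | empty => intro m Φ; simp
    | insert a s ha ih =>
      intro m Φ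
      have h2 : ∀ (r : ℕ) (m : Fin N → ℤ) (Φ : MvPowerSeries (Fin N) ℝ),
          ecoeff (suf m) (tVar ℝ a ^ r * Φ) = ecoeff (suf (m - Pi.single a (r : ℤ))) Φ := by
        intro r
        induction r with
        | zero => intro m Φ; simp
        | succ r ihr =>
          intro m Φ
          rw [pow_succ, mul_assoc, ihr, ecoeff_suf_tVar_mul, sub_sub, ← Pi.single_add]
          push_cast; rfl
      rw [Finset.prod_insert ha, Finset.sum_insert ha, mul_assoc, map_pow, subsT,
        MvPolynomial.aeval_X, h2]
      rw [← sub_sub]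
      exact ih _ _
  rw [mul_comm, h1, Finset.univ_sum_single (fun j => (b j : ℤ)), map_sub]

theorem coeff_zero_deltaSer (lam : ℝ) :
    MvPowerSeries.coeff 0 (deltaSer (N := N) ℝ lam) = 1 := by
  rw [MvPowerSeries.coeff_zero_eq_constantCoeff_apply, deltaSer, map_prod]
  refine Finset.prod_eq_one fun j _ => ?_
  rw [map_prod]
  refine Finset.prod_eq_one fun k hk => ?_
  rw [← MvPowerSeries.coeff_zero_eq_constantCoeff_apply]
  have := coeff_lac_smul (uExp_ne_zero (Finset.mem_Ioi.1 hk)) (binSeries lam (1 : ℝ)) 0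
  rw [zero_smul] at this
  rw [this]; simp [binSeries, bin_zero]

/-- Rearranging a decreasing sequence increases the sums over final segments. -/
theorem suf_le_suf_comp_perm {n : Fin N → ℤ} (hn : Antitone n) (e : Equiv.Perm (Fin N)) :
    suf n ≤ suf (fun j => n (e j)) := by
  intro i
  have hanti : Antivary (fun k : Fin N => if i ≤ k then (1 : ℤ) else 0) n := by
    refine Monotone.antivary ?_ hn
    intro a b hab
    simp only
    split_ifs with h1 h2
    · exact le_rfl
    · exact absurd (h1.trans hab) h2
    · exact zero_le_one
    · exact le_rfl
  have := hanti.sum_mul_le_sum_mul_comp_perm (σ := e)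
  simp only [ite_mul, one_mul, zero_mul, ← Finset.sum_filter] at this
  rw [suf_apply, suf_apply]
  have h2 : Finset.univ.filter (fun k => i ≤ k) = Finset.Ici i := by ext; simp
  rw [h2] at this
  exact this

/-- For a partition `n` the polynomial `f_n` is non-zero: otherwise `pairing` would kill the
symmetrization of `∏ z_j ^ n_j`, on which it is positive. -/
theorem fPol_ne_zero {lam : ℝ} (hlam : 0 < lam) (hN : 1 ≤ N) {n : Fin N → ℤ} (hn : Antitone n)
    (hn0 : ∀ j, 0 ≤ n j) : fPol lam n ≠ 0 := by
  intro hf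
  let b : Fin N → ℕ := fun j => (n j).toNat
  have hb : ∀ j, (b j : ℤ) = n j := fun j => Int.toNat_of_nonneg (hn0 j)
  let p : Pol N := ∑ e : Equiv.Perm (Fin N), ∏ j, MvPolynomial.X j ^ b (e j)
  have hp : p.IsSymmetric := by
    intro s
    simp only [p, map_sum, map_prod, map_pow, MvPolynomial.rename_X]
    rw [← Equiv.sum_comp (Equiv.mulRight s)]
    refine Finset.sum_congr rfl fun e _ => ?_
    rw [← Equiv.prod_comp s fun j => (MvPolynomial.X j : Pol N) ^ b (e j)]
    rfl
  have h0 := pairing_eq_zero hlam n ⟨0, hN⟩ rfl hf hp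
  simp only [p, map_sum, pairing_monomial] at h0
  have hval : ∀ e : Equiv.Perm (Fin N),
      ecoeff (suf n - suf fun j => (b (e j) : ℤ)) (deltaSer ℝ lam) =
        if suf n = suf (fun j => n (e j)) then 1 else 0 := by
    intro e
    simp only [hb]
    have hle := suf_le_suf_comp_perm hn e
    split_ifs with h
    · rw [← h, sub_self, ecoeff_of_nonneg le_rfl]
      have : natExp (0 : Fin N → ℤ) = 0 := by ext; simp [natExp_apply]
      rw [this, coeff_zero_deltaSer]
    · rw [ecoeff_of_not_nonneg]
      intro h'
      exact h (le_antisymm hle (sub_nonneg.1 h'))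
  -- A sum of zeros and ones vanishes only if the term of the identity permutation does.
  simp only [hval] at h0
  rw [Finset.sum_eq_zero_iff_of_nonneg (fun e _ => by split_ifs <;> norm_num)] at h0
  have := h0 1 (Finset.mem_univ _)
  simp at this

end Nonvanishing

/-! ### The coefficients `α_n(m)` -/

section Alpha

variable {N : ℕ}

theorem suf_injective : Function.Injective (suf : (Fin N → ℤ) →+ (Fin N → ℤ)) := by
  intro m m' h
  ext l
  have h1 := suf_eq m l
  have h2 := suf_eq m' l
  rw [h] at h1
  rw [h1] at h2
  exact add_right_cancel h2

theorem sum_shift (j k : Fin N) (ν : ℕ) : ∑ i, shift j k ν i = 1 := by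
  simp [shift, Finset.sum_add_distrib, ← Finset.mul_sum]

/-- For `j ≤ k` the shift `E_{jk}^ν` is `e_j` plus `ν` moves of a unit from position `j` to the
later position `k`. -/
theorem suf_shift_nonneg {j k : Fin N} (h : j ≤ k) (ν : ℕ) : 0 ≤ suf (shift j k ν) := by
  intro i
  rw [suf_shift h]
  exact add_nonneg (Nat.cast_nonneg _) (by positivity)

theorem eq_zero_or_lt_of_g_ne_zero {lam mu : ℝ} {j k : Fin N} {ν : ℕ} {m : Fin N → ℤ}
    (h : g lam mu j k ν m ≠ 0) (hjk : j ≤ k) : ν = 0 ∨ j < k := by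
  by_contra hc
  push Not at hc
  have : j = k := le_antisymm hjk hc.2
  simp [g, this, hc.1] at h

/-- Where `g` does not vanish, `ν` is bounded by the increase of the final sums. -/
theorem le_of_g_ne_zero {lam mu : ℝ} {j k : Fin N} {ν : ℕ} {m b : Fin N → ℤ}
    (h : g lam mu j k ν m ≠ 0) (hjk : j ≤ k) {M : ℕ} (hb : suf (shift j k ν) ≤ suf b)
    (hM : ∀ i, suf b i ≤ M) : ν ≤ M := by
  rcases eq_zero_or_lt_of_g_ne_zero h hjk with rfl | hlt
  · exact Nat.zero_le _
  · obtain ⟨i, hi⟩ := Finsupp.ne_iff.1 (uExp_ne_zero hlt)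
    have h1 : suf (shift j k ν) i ≤ suf b i := hb i
    have h2 := hM i
    rw [suf_shift hjk] at h1
    have h3 : ν * 1 ≤ ν * uExp j k i := Nat.mul_le_mul_left _ (Nat.one_le_iff_ne_zero.2 hi)
    have h4 : (ν : ℤ) ≤ ν * uExp j k i := by exact_mod_cast (mul_one ν ▸ h3)
    have h5 : (0 : ℤ) ≤ tExp j i := Nat.cast_nonneg _
    omega

section Term

variable {lam mu : ℝ} {n m : Fin N → ℤ} {s : ℕ} {p : Fin s → IdxPair N} {ν : Fin s → ℕ}

theorem add_sum_shift_of_alphaTerm_ne_zero (h : alphaTerm lam mu n m s p ν ≠ 0) :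
    m + ∑ r, shift (p r).1.1 (p r).1.2 (ν r) = n := by
  by_contra hc
  simp [alphaTerm, hc] at h

theorem sum_eq_of_alphaTerm_ne_zero (h : alphaTerm lam mu n m s p ν ≠ 0) :
    ∑ j, m j + s = ∑ j, n j := by
  rw [← add_sum_shift_of_alphaTerm_ne_zero h]
  simp only [Pi.add_apply, Finset.sum_apply, Finset.sum_add_distrib]
  rw [Finset.sum_comm]
  simp [sum_shift]

theorem suf_shift_le_of_alphaTerm_ne_zero (h : alphaTerm lam mu n m s p ν ≠ 0) (r : Fin s) :
    suf (shift (p r).1.1 (p r).1.2 (ν r)) ≤ suf (n - m) := by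
  rw [← add_sum_shift_of_alphaTerm_ne_zero h, add_sub_cancel_left, map_sum]
  exact Finset.single_le_sum (f := fun r => suf (shift (p r).1.1 (p r).1.2 (ν r)))
    (fun r _ => suf_shift_nonneg (p r).2 _) (Finset.mem_univ r)

theorem suf_le_of_alphaTerm_ne_zero (h : alphaTerm lam mu n m s p ν ≠ 0) : suf m ≤ suf n := by
  rw [← add_sum_shift_of_alphaTerm_ne_zero h, map_add, map_sum]
  exact le_add_of_nonneg_right (Finset.sum_nonneg fun r _ => suf_shift_nonneg (p r).2 _)

theorem le_of_alphaTerm_ne_zero (h : alphaTerm lam mu n m s p ν ≠ 0) {M : ℕ}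
    (hM : ∀ i, suf (n - m) i ≤ M) (r : Fin s) : ν r ≤ M := by
  refine le_of_g_ne_zero (lam := lam) (mu := mu)
    (m := n - ∑ l ∈ Finset.Iic r, shift (p l).1.1 (p l).1.2 (ν l)) ?_ (p r).2
    (suf_shift_le_of_alphaTerm_ne_zero h r) hM
  intro h0
  refine h ?_
  rw [alphaTerm, Finset.prod_eq_zero (Finset.mem_univ r) h0, mul_zero]

end Term

theorem exists_forall_le_natCast (a : Fin N → ℤ) : ∃ M : ℕ, ∀ i, a i ≤ M := by
  refine ⟨∑ i, (a i).toNat, fun i => (Int.self_le_toNat _).trans ?_⟩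
  exact_mod_cast Finset.single_le_sum (f := fun i => (a i).toNat) (fun _ _ => Nat.zero_le _)
    (Finset.mem_univ i)

/-- For given `n` and `m` there are only finitely many non-zero terms, as `s = |n| - |m|` and the
`ν_r` are bounded. -/
theorem finite_alphaTerm_ne_zero (lam mu : ℝ) (n m : Fin N → ℤ) :
    {t : Σ s : ℕ, (Fin s → IdxPair N) × (Fin s → ℕ) |
      alphaTerm lam mu n m t.1 t.2.1 t.2.2 ≠ 0}.Finite := by
  obtain ⟨M, hM⟩ := exists_forall_le_natCast (suf (n - m))
  let s₀ := (∑ j, n j - ∑ j, m j).toNat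
  have hfin : (Set.univ ×ˢ Set.pi Set.univ fun _ => Set.Iic M :
      Set ((Fin s₀ → IdxPair N) × (Fin s₀ → ℕ))).Finite :=
    Set.finite_univ.prod (Set.Finite.pi fun _ => Set.finite_Iic M)
  refine (hfin.image fun q => (⟨s₀, q⟩ : Σ s : ℕ, (Fin s → IdxPair N) × (Fin s → ℕ))).subset ?_
  rintro ⟨s, p, ν⟩ h
  have h : alphaTerm lam mu n m s p ν ≠ 0 := h
  have hs : s = s₀ := by
    have := sum_eq_of_alphaTerm_ne_zero h
    simp only [s₀]; omega
  subst hs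
  exact ⟨(p, ν), ⟨Set.mem_univ _, fun r _ => le_of_alphaTerm_ne_zero h hM r⟩, rfl⟩

theorem finite_support_alphaTerm (lam mu : ℝ) (n m : Fin N → ℤ) (s : ℕ) (p : Fin s → IdxPair N) :
    (Function.support fun ν => alphaTerm lam mu n m s p ν).Finite := by
  refine ((finite_alphaTerm_ne_zero lam mu n m).preimage
    (f := fun ν : Fin s → ℕ => (⟨s, p, ν⟩ : Σ s : ℕ, (Fin s → IdxPair N) × (Fin s → ℕ)))
    ?_).subset fun ν h => h
  intro a _ b _ h
  simpa using h

theorem summable_alphaTerm (lam mu : ℝ) (n m : Fin N → ℤ) (s : ℕ) (p : Fin s → IdxPair N) :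
    Summable fun ν => alphaTerm lam mu n m s p ν :=
  summable_of_hasFiniteSupport (finite_support_alphaTerm lam mu n m s p)

/-- The sum of the terms with `s` factors. -/
def alphaSum (lam mu : ℝ) (n m : Fin N → ℤ) (s : ℕ) : ℝ :=
  ∑ p : Fin s → IdxPair N, ∑' ν : Fin s → ℕ, alphaTerm lam mu n m s p ν

theorem exists_of_alphaSum_ne_zero {lam mu : ℝ} {n m : Fin N → ℤ} {s : ℕ}
    (h : alphaSum lam mu n m s ≠ 0) :
    ∃ (p : Fin s → IdxPair N) (ν : Fin s → ℕ), alphaTerm lam mu n m s p ν ≠ 0 := by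
  by_contra hc
  push Not at hc
  simp [alphaSum, hc] at h

theorem alphaSum_zero (lam mu : ℝ) (n m : Fin N → ℤ) :
    alphaSum lam mu n m 0 = if m = n then 1 else 0 := by
  simp [alphaSum, alphaTerm]

/-- Since every shift raises `|m|` by one, only `s = |n| - |m|` contributes. -/
theorem alpha_of_eq {lam mu : ℝ} {n m : Fin N → ℤ} {s : ℕ} (h : ∑ j, m j + s = ∑ j, n j) :
    alpha lam mu n m = 1 / (4 ^ s * (s.factorial : ℝ)) * alphaSum lam mu n m s := by
  have h0 : ∀ s', s' ≠ s → alphaSum lam mu n m s' = 0 := by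
    intro s' hs
    by_contra hc
    obtain ⟨p, ν, hp⟩ := exists_of_alphaSum_ne_zero hc
    have := sum_eq_of_alphaTerm_ne_zero hp
    omega
  have h1 : alpha lam mu n m = alphaSum lam mu n m 0 +
      ∑' s : ℕ, 1 / (4 ^ (s + 1) * (Nat.factorial (s + 1) : ℝ)) * alphaSum lam mu n m (s + 1) := by
    rw [alphaSum_zero]; rfl
  rw [h1]
  rcases s with _ | s
  · simp [h0]
  · rw [h0 0 (by omega), zero_add, tsum_eq_single s]
    intro s' hs
    rw [h0 (s' + 1) (by omega), mul_zero]

theorem alpha_of_lt {lam mu : ℝ} {n m : Fin N → ℤ} (h : ∑ j, n j < ∑ j, m j) :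
    alpha lam mu n m = 0 := by
  have h0 : ∀ s', alphaSum lam mu n m s' = 0 := by
    intro s'
    by_contra hc
    obtain ⟨p, ν, hp⟩ := exists_of_alphaSum_ne_zero hc
    have := sum_eq_of_alphaTerm_ne_zero hp
    omega
  have h1 : alpha lam mu n m = alphaSum lam mu n m 0 +
      ∑' s : ℕ, 1 / (4 ^ (s + 1) * (Nat.factorial (s + 1) : ℝ)) * alphaSum lam mu n m (s + 1) := by
    rw [alphaSum_zero]; rfl
  rw [h1]; simp [h0]

theorem exists_alphaTerm_of_alpha_ne_zero {lam mu : ℝ} {n m : Fin N → ℤ}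
    (h : alpha lam mu n m ≠ 0) :
    ∃ (s : ℕ) (p : Fin s → IdxPair N) (ν : Fin s → ℕ), alphaTerm lam mu n m s p ν ≠ 0 := by
  have hle : ∑ j, m j ≤ ∑ j, n j := by
    by_contra hc
    exact h (alpha_of_lt (not_le.1 hc))
  rw [alpha_of_eq (s := (∑ j, n j - ∑ j, m j).toNat) (by omega)] at h
  exact ⟨_, exists_of_alphaSum_ne_zero (right_ne_zero_of_mul h)⟩

theorem suf_le_of_alpha_ne_zero {lam mu : ℝ} {n m : Fin N → ℤ} (h : alpha lam mu n m ≠ 0) :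
    suf m ≤ suf n := by
  obtain ⟨s, p, ν, h⟩ := exists_alphaTerm_of_alpha_ne_zero h
  exact suf_le_of_alphaTerm_ne_zero h

theorem alpha_of_sum_eq {lam mu : ℝ} {n m : Fin N → ℤ} (h : ∑ j, m j = ∑ j, n j) :
    alpha lam mu n m = if m = n then 1 else 0 := by
  rw [alpha_of_eq (s := 0) (by simpa using h), alphaSum_zero]
  simp

theorem sum_Iic_castSucc {M : Type*} [AddCommMonoid M] {s : ℕ} (f : Fin (s + 1) → M) (r : Fin s) :
    ∑ l ∈ Finset.Iic r.castSucc, f l = ∑ l ∈ Finset.Iic r, f l.castSucc := by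
  rw [← Fin.map_castSuccEmb_Iic, Finset.sum_map]; rfl

/-- Splitting off the last factor: where the Kronecker delta does not vanish, the argument of this
factor is `n - ∑ E = m`. -/
theorem alphaTerm_snoc (lam mu : ℝ) (n m : Fin N → ℤ) (s : ℕ) (p : Fin s → IdxPair N)
    (ν : Fin s → ℕ) (q : IdxPair N) (c : ℕ) :
    alphaTerm lam mu n m (s + 1) (Fin.snoc p q : Fin (s + 1) → IdxPair N)
        (Fin.snoc ν c : Fin (s + 1) → ℕ) =
      g lam mu q.1.1 q.1.2 c m * alphaTerm lam mu n (m + shift q.1.1 q.1.2 c) s p ν := by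
  have hlast : Finset.Iic (Fin.last s) = Finset.univ := by
    ext l; simp [Fin.le_last]
  unfold alphaTerm
  rw [Fin.prod_univ_castSucc, Fin.sum_univ_castSucc, hlast]
  simp only [sum_Iic_castSucc, Fin.snoc_castSucc, Fin.snoc_last, Fin.sum_univ_castSucc]
  set S := ∑ r, shift (p r).1.1 (p r).1.2 (ν r)
  by_cases h : m + shift q.1.1 q.1.2 c + S = n
  · have h' : m + (S + shift q.1.1 q.1.2 c) = n := by rw [← h]; abel
    have h2 : n - (S + shift q.1.1 q.1.2 c) = m := by rw [← h']; abel
    rw [if_pos h, if_pos h', h2]; ring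
  · have h' : ¬ m + (S + shift q.1.1 q.1.2 c) = n := by
      rwa [add_comm S, ← add_assoc]
    rw [if_neg h, if_neg h']; simp

theorem alphaSum_succ (lam mu : ℝ) (n m : Fin N → ℤ) (s : ℕ) :
    alphaSum lam mu n m (s + 1) = ∑ q : IdxPair N, ∑' c : ℕ,
      g lam mu q.1.1 q.1.2 c m * alphaSum lam mu n (m + shift q.1.1 q.1.2 c) s := by
  have h1 : ∀ (p : Fin s → IdxPair N) (q : IdxPair N),
      ∑' ν : Fin (s + 1) → ℕ,
        alphaTerm lam mu n m (s + 1) (Fin.snoc p q : Fin (s + 1) → IdxPair N) ν =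
      ∑' c : ℕ, ∑' ν : Fin s → ℕ, g lam mu q.1.1 q.1.2 c m *
        alphaTerm lam mu n (m + shift q.1.1 q.1.2 c) s p ν := by
    intro p q
    have hs := summable_alphaTerm lam mu n m (s + 1) (Fin.snoc p q : Fin (s + 1) → IdxPair N)
    rw [← (Fin.snocEquiv fun _ : Fin (s + 1) => ℕ).tsum_eq]
    rw [← (Fin.snocEquiv fun _ : Fin (s + 1) => ℕ).summable_iff] at hs
    refine hs.tsum_prod.trans ?_
    refine tsum_congr fun c => tsum_congr fun ν => ?_
    exact alphaTerm_snoc lam mu n m s p ν q c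
  have h2 : ∀ (p : Fin s → IdxPair N) (q : IdxPair N), Summable fun c : ℕ =>
      ∑' ν : Fin s → ℕ, g lam mu q.1.1 q.1.2 c m *
        alphaTerm lam mu n (m + shift q.1.1 q.1.2 c) s p ν := by
    intro p q
    have hs := summable_alphaTerm lam mu n m (s + 1) (Fin.snoc p q : Fin (s + 1) → IdxPair N)
    rw [← (Fin.snocEquiv fun _ : Fin (s + 1) => ℕ).summable_iff] at hs
    refine hs.prod.congr fun c => tsum_congr fun ν => ?_
    exact alphaTerm_snoc lam mu n m s p ν q c
  rw [alphaSum, ← (Fin.snocEquiv fun _ : Fin (s + 1) => IdxPair N).sum_comp, Fintype.sum_prod_type]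
  refine Finset.sum_congr rfl fun q _ => ?_
  refine (Finset.sum_congr rfl fun p _ => h1 p q).trans ?_
  rw [← Summable.tsum_finsetSum fun p _ => h2 p q]
  refine tsum_congr fun c => ?_
  rw [alphaSum, Finset.mul_sum]
  exact Finset.sum_congr rfl fun p _ => tsum_mul_left

/-- The recursion that makes `∑ α_n(m) f_m` an eigenfunction. -/
theorem alpha_recursion (lam mu : ℝ) (n m : Fin N → ℤ) :
    4 * ((∑ j, n j : ℤ) - (∑ j, m j : ℤ) : ℝ) * alpha lam mu n m =
      ∑ q : IdxPair N, ∑' c : ℕ,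
        g lam mu q.1.1 q.1.2 c m * alpha lam mu n (m + shift q.1.1 q.1.2 c) := by
  have hsum : ∀ (q : IdxPair N) (c : ℕ), ∑ j, (m + shift q.1.1 q.1.2 c) j = ∑ j, m j + 1 := by
    intro q c
    simp only [Pi.add_apply, Finset.sum_add_distrib, sum_shift]
  rcases lt_or_ge (∑ j, m j) (∑ j, n j) with h | h
  · obtain ⟨s, hs⟩ : ∃ s : ℕ, ∑ j, m j + ((s + 1 : ℕ) : ℤ) = ∑ j, n j :=
      ⟨(∑ j, n j - ∑ j, m j - 1).toNat, by omega⟩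
    have h1 : ∀ (q : IdxPair N) (c : ℕ), alpha lam mu n (m + shift q.1.1 q.1.2 c) =
        1 / (4 ^ s * (s.factorial : ℝ)) * alphaSum lam mu n (m + shift q.1.1 q.1.2 c) s :=
      fun q c => alpha_of_eq (by rw [hsum]; push_cast at hs; omega)
    simp only [h1, mul_left_comm (g _ _ _ _ _ _), tsum_mul_left, ← Finset.mul_sum]
    rw [← alphaSum_succ, alpha_of_eq hs, ← hs]
    have h3 : (s.factorial : ℝ) ≠ 0 := by positivity
    rw [Nat.factorial_succ]
    push_cast
    field_simp
    ring
  · have h1 : ∀ (q : IdxPair N) (c : ℕ), alpha lam mu n (m + shift q.1.1 q.1.2 c) = 0 :=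
      fun q c => alpha_of_lt (by rw [hsum]; omega)
    simp only [h1, mul_zero, tsum_zero, Finset.sum_const_zero]
    rcases h.lt_or_eq with h | h
    · rw [alpha_of_lt h, mul_zero]
    · rw [h, sub_self]; simp

end Alpha

/-! ### The polynomials `P_n` and their differential equation in the squared variables -/

section EigenPol

variable {N : ℕ}

theorem finite_suf_mem_Icc (n : Fin N → ℤ) : {m : Fin N → ℤ | 0 ≤ suf m ∧ suf m ≤ suf n}.Finite :=
  (Set.finite_Icc (0 : Fin N → ℤ) (suf n)).preimage suf_injective.injOn

/-- The finite set outside which `α_n(m) f_m` vanishes. -/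
def idxSet (n : Fin N → ℤ) : Finset (Fin N → ℤ) := (finite_suf_mem_Icc n).toFinset

theorem mem_idxSet {n m : Fin N → ℤ} : m ∈ idxSet n ↔ 0 ≤ suf m ∧ suf m ≤ suf n := by
  simp [idxSet]

/-- The polynomial in `z_j = x_j ^ 2` that represents `P_n`. -/
def eigenPol (lam mu : ℝ) (n : Fin N → ℤ) : Pol N :=
  ∑ m ∈ idxSet n, alpha lam mu n m • fPol lam m

theorem zOp_add (lam c : ℝ) (z : Fin N → ℝ) (p q : Pol N) :
    zOp lam c z (p + q) = zOp lam c z p + zOp lam c z q := by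
  simp only [zOp, map_add, mul_add, Finset.sum_add_distrib]
  ring

theorem zOp_smul (lam c a : ℝ) (z : Fin N → ℝ) (p : Pol N) :
    zOp lam c z (a • p) = a * zOp lam c z p := by
  simp only [zOp, Derivation.map_smul, MvPolynomial.smul_eval, mul_left_comm _ a, ← Finset.mul_sum]
  ring

theorem zOp_sum_smul (lam c : ℝ) (z : Fin N → ℝ) {ι : Type*} (s : Finset ι) (a : ι → ℝ)
    (p : ι → Pol N) :
    zOp lam c z (∑ i ∈ s, a i • p i) = ∑ i ∈ s, a i * zOp lam c z (p i) := by
  let φ : Pol N →ₗ[ℝ] ℝ :=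
    { toFun := zOp lam c z, map_add' := zOp_add lam c z,
      map_smul' := fun a p => zOp_smul lam c a z p }
  change φ _ = ∑ i ∈ s, a i * φ (p i)
  simp

theorem sum_idxPair {M : Type*} [AddCommMonoid M] (F : Fin N → Fin N → M) :
    ∑ q : IdxPair N, F q.1.1 q.1.2 = ∑ j, (F j j + ∑ k ∈ Finset.Ioi j, F j k) := by
  rw [← Finset.sum_subtype (Finset.univ.filter fun p : Fin N × Fin N => p.1 ≤ p.2) (by simp)
    (fun p => F p.1 p.2), Finset.sum_filter, Fintype.sum_prod_type]
  refine Finset.sum_congr rfl fun j _ => ?_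
  rw [← Finset.sum_filter, ← Finset.sum_insert (f := fun k => F j k) (by simp), Finset.Ioi_insert]
  congr 1
  ext k; simp

theorem shift_self_zero (j : Fin N) : shift j j 0 = Pi.single j (1 : ℤ) := by
  simp [shift]

/-- The recurrence for the `f_m` in terms of the coefficients `g`. -/
theorem zOp_fPol_eq_sum_g (lam mu : ℝ) (z : Fin N → ℝ) (hz : Function.Injective z)
    (m : Fin N → ℤ) {M : ℕ} (hM : ∀ i, suf m i < M) (hM0 : 0 < M) :
    -4 * zOp lam (mu + 1 / 2) z (fPol lam m) =
      ∑ q : IdxPair N, ∑ c ∈ Finset.range M,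
        g lam mu q.1.1 q.1.2 c (m - shift q.1.1 q.1.2 c) *
          MvPolynomial.eval z (fPol lam (m - shift q.1.1 q.1.2 c)) := by
  rw [zOp_fPol lam _ z hz m M hM, sum_idxPair fun j k => ∑ c ∈ Finset.range M,
    g lam mu j k c (m - shift j k c) * MvPolynomial.eval z (fPol lam (m - shift j k c)),
    Finset.sum_add_distrib]
  have h1 : ∀ j : Fin N, ∑ c ∈ Finset.range M,
      g lam mu j j c (m - shift j j c) * MvPolynomial.eval z (fPol lam (m - shift j j c)) =
      -4 * (((m j : ℝ) - 1 + lam * ((N : ℝ) - (j : ℕ))) *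
        ((m j : ℝ) - 1 + lam * ((N : ℝ) - (j : ℕ)) + (mu + 1 / 2) - lam) *
          MvPolynomial.eval z (fPol lam (m - Pi.single j 1))) := by
    intro j
    rw [Finset.sum_eq_single 0]
    · rw [shift_self_zero]
      simp only [g, tilde, if_true, Pi.sub_apply, Pi.single_eq_same]
      push_cast
      ring
    · intro c _ hc
      simp [g, hc]
    · intro h
      exact absurd (Finset.mem_range.2 hM0) h
  have h2 : ∀ j, ∀ k ∈ Finset.Ioi j, ∑ c ∈ Finset.range M,
      g lam mu j k c (m - shift j k c) * MvPolynomial.eval z (fPol lam (m - shift j k c)) =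
      4 * lam * (lam - 1) * ∑ ν ∈ Finset.range M, (if ν = 0 then 0 else 2 * (ν : ℝ) - 1) *
            MvPolynomial.eval z (fPol lam (m - shift j k ν)) := by
    intro j k hk
    have hk : j ≠ k := (Finset.mem_Ioi.1 hk).ne
    rw [Finset.mul_sum]
    refine Finset.sum_congr rfl fun ν _ => ?_
    simp only [g, if_neg hk]
    split_ifs <;> ring
  rw [Finset.sum_congr rfl fun j _ => h1 j,
    Finset.sum_congr rfl fun j _ => Finset.sum_congr rfl fun k hk => h2 j k hk]
  simp only [← Finset.mul_sum]
  ring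

/-- The substitution `m ↦ m + E` in the sum over `m`; both summands vanish outside `idxSet n`. -/
theorem sum_alpha_mul_shift (lam mu : ℝ) (n : Fin N → ℤ) (z : Fin N → ℝ) (q : IdxPair N) (c : ℕ) :
    ∑ m ∈ idxSet n, alpha lam mu n m * (g lam mu q.1.1 q.1.2 c (m - shift q.1.1 q.1.2 c) *
      MvPolynomial.eval z (fPol lam (m - shift q.1.1 q.1.2 c))) =
    ∑ m ∈ idxSet n, g lam mu q.1.1 q.1.2 c m * alpha lam mu n (m + shift q.1.1 q.1.2 c) *
      MvPolynomial.eval z (fPol lam m) := by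
  set E := shift q.1.1 q.1.2 c
  have hE : 0 ≤ suf E := suf_shift_nonneg q.2 c
  have hf : ∀ m, MvPolynomial.eval z (fPol lam m) ≠ 0 → 0 ≤ suf m := by
    intro m hm
    by_contra hc
    rw [fPol_eq_zero hc, map_zero] at hm
    exact hm rfl
  rw [← finsum_eq_sum_of_support_subset (fun m => alpha lam mu n m *
      (g lam mu q.1.1 q.1.2 c (m - E) * MvPolynomial.eval z (fPol lam (m - E)))),
    ← finsum_eq_sum_of_support_subset (fun m => g lam mu q.1.1 q.1.2 c m *
      alpha lam mu n (m + E) * MvPolynomial.eval z (fPol lam m)),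
    ← finsum_comp_equiv (Equiv.addRight E)]
  · refine finsum_congr fun m => ?_
    simp only [Equiv.coe_addRight, add_sub_cancel_right]
    ring
  · intro m hm
    rw [Function.mem_support] at hm
    rw [Finset.mem_coe, mem_idxSet]
    refine ⟨hf m (right_ne_zero_of_mul hm), ?_⟩
    have h1 := suf_le_of_alpha_ne_zero (right_ne_zero_of_mul (left_ne_zero_of_mul hm))
    rw [map_add] at h1
    exact (le_add_of_nonneg_right hE).trans h1
  · intro m hm
    rw [Function.mem_support] at hm
    rw [Finset.mem_coe, mem_idxSet]
    refine ⟨?_, suf_le_of_alpha_ne_zero (left_ne_zero_of_mul hm)⟩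
    have h1 := hf _ (right_ne_zero_of_mul (right_ne_zero_of_mul hm))
    rw [map_sub] at h1
    exact hE.trans (sub_nonneg.1 h1)

/-- The differential equation for `P_n` in the variables `z_j = x_j ^ 2`. -/
theorem eigenPol_equation (lam mu : ℝ) (n : Fin N → ℤ) (z : Fin N → ℝ)
    (hz : Function.Injective z) :
    4 * ∑ j, z j * MvPolynomial.eval z (MvPolynomial.pderiv j (eigenPol lam mu n)) -
        4 * zOp lam (mu + 1 / 2) z (eigenPol lam mu n) =
      4 * ((∑ j, n j : ℤ) : ℝ) * MvPolynomial.eval z (eigenPol lam mu n) := by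
  obtain ⟨M', hM'⟩ := exists_forall_le_natCast (suf n)
  set M := M' + 1
  have h1 : ∑ j, z j * MvPolynomial.eval z (MvPolynomial.pderiv j (eigenPol lam mu n)) =
      ∑ m ∈ idxSet n, alpha lam mu n m * (((∑ j, m j : ℤ) : ℝ) *
        MvPolynomial.eval z (fPol lam m)) := by
    have h2 : ∀ p : Pol N, ∑ j, z j * MvPolynomial.eval z (MvPolynomial.pderiv j p) =
        MvPolynomial.eval z (∑ j, MvPolynomial.X j * MvPolynomial.pderiv j p) := by
      intro p; simp
    have h3 : ∑ j, MvPolynomial.X j * MvPolynomial.pderiv j (eigenPol lam mu n) =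
        ∑ m ∈ idxSet n, alpha lam mu n m • (((∑ j, m j : ℤ) : ℝ) • fPol lam m) := by
      simp only [eigenPol, map_sum, Derivation.map_smul, Finset.mul_sum, mul_smul_comm]
      rw [Finset.sum_comm]
      refine Finset.sum_congr rfl fun m _ => ?_
      rw [← Finset.smul_sum, sum_mul_pderiv_fPol]
    rw [h2, h3, map_sum]
    simp only [MvPolynomial.smul_eval]
  have h2 : -4 * zOp lam (mu + 1 / 2) z (eigenPol lam mu n) =
      ∑ m ∈ idxSet n, (∑ q : IdxPair N, ∑' c : ℕ, g lam mu q.1.1 q.1.2 c m *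
        alpha lam mu n (m + shift q.1.1 q.1.2 c)) * MvPolynomial.eval z (fPol lam m) := by
    rw [eigenPol, zOp_sum_smul, Finset.mul_sum]
    have h3 : ∀ m ∈ idxSet n, -4 * (alpha lam mu n m * zOp lam (mu + 1 / 2) z (fPol lam m)) =
        ∑ q : IdxPair N, ∑ c ∈ Finset.range M, alpha lam mu n m *
          (g lam mu q.1.1 q.1.2 c (m - shift q.1.1 q.1.2 c) *
          MvPolynomial.eval z (fPol lam (m - shift q.1.1 q.1.2 c))) := by
      intro m hm
      rw [mul_left_comm, zOp_fPol_eq_sum_g lam mu z hz m (M := M) ?_ (Nat.succ_pos _)]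
      · simp only [Finset.mul_sum]
      · intro i
        have h4 : suf m i ≤ suf n i := (mem_idxSet.1 hm).2 i
        have := hM' i
        push_cast [M]; omega
    rw [Finset.sum_congr rfl h3, Finset.sum_comm]
    simp only [Finset.sum_mul]
    rw [Finset.sum_comm (s := idxSet n)]
    refine Finset.sum_congr rfl fun q _ => ?_
    rw [Finset.sum_comm, Finset.sum_congr rfl fun c _ => sum_alpha_mul_shift lam mu n z q c,
      Finset.sum_comm]
    refine Finset.sum_congr rfl fun m hm => ?_
    rw [← Finset.sum_mul, tsum_eq_sum]
    intro c hc
    by_contra hne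
    refine hc (Finset.mem_range.2 (Nat.lt_succ_of_le ?_))
    refine le_of_g_ne_zero (left_ne_zero_of_mul hne) q.2 ?_ hM'
    have h5 := suf_le_of_alpha_ne_zero (right_ne_zero_of_mul hne)
    rw [map_add] at h5
    exact (le_add_of_nonneg_left (mem_idxSet.1 hm).1).trans h5
  have h3 : MvPolynomial.eval z (eigenPol lam mu n) =
      ∑ m ∈ idxSet n, alpha lam mu n m * MvPolynomial.eval z (fPol lam m) := by
    simp [eigenPol, MvPolynomial.smul_eval]
  rw [sub_eq_add_neg, ← neg_mul, h2, h1, h3, Finset.mul_sum, Finset.mul_sum,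
    ← Finset.sum_add_distrib]
  refine Finset.sum_congr rfl fun m _ => ?_
  rw [← alpha_recursion]
  ring

theorem isSymmetric_eigenPol (lam mu : ℝ) (n : Fin N → ℤ) : (eigenPol lam mu n).IsSymmetric := by
  intro e
  rw [eigenPol, map_sum]
  refine Finset.sum_congr rfl fun m _ => ?_
  rw [map_smul, isSymmetric_fPol lam m e]

/-- The terms with `m ≠ n` have lower degree than `f_n`, so they cannot cancel it. -/
theorem eigenPol_ne_zero {lam : ℝ} (hlam : 0 < lam) (mu : ℝ) (hN : 1 ≤ N) {n : Fin N → ℤ}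
    (hn : Antitone n) (hn0 : ∀ j, 0 ≤ n j) : eigenPol lam mu n ≠ 0 := by
  obtain ⟨b, hb⟩ := MvPolynomial.ne_zero_iff.1 (fPol_ne_zero hlam hN hn hn0)
  refine MvPolynomial.ne_zero_iff.2 ⟨b, ?_⟩
  have hmem : n ∈ idxSet n :=
    mem_idxSet.2 ⟨fun i => Finset.sum_nonneg fun j _ => hn0 j, le_rfl⟩
  rw [eigenPol, MvPolynomial.coeff_sum, Finset.sum_eq_single_of_mem n hmem]
  · rwa [MvPolynomial.coeff_smul, alpha_of_sum_eq rfl, if_pos rfl, one_smul]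
  · intro m _ hmn
    rw [MvPolynomial.coeff_smul, smul_eq_mul, mul_eq_zero]
    by_contra! hc
    have h1 := (coeff_fPol hc.2).symm.trans (coeff_fPol hb)
    rw [alpha_of_sum_eq h1, if_neg hmn] at hc
    exact hc.1 rfl

theorem alpha_eq_zero_or_fPol_eq_zero {lam mu : ℝ} {n m : Fin N → ℤ} (hm : m ∉ idxSet n) :
    alpha lam mu n m = 0 ∨ fPol lam m = 0 := by
  by_contra! hc
  refine hm (mem_idxSet.2 ⟨?_, suf_le_of_alpha_ne_zero hc.1⟩)
  by_contra h
  exact hc.2 (fPol_eq_zero h)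

theorem P_eq_eval_eigenPol (lam mu : ℝ) {ε : ℝ} (hε : 0 < ε) (n : Fin N → ℤ) (x : Fin N → ℝ) :
    P lam mu ε n x =
      ((MvPolynomial.eval (fun j => x j ^ 2) (eigenPol lam mu n) : ℝ) : ℂ) := by
  rw [P, tsum_eq_sum (s := idxSet n)]
  · simp only [f_eq_eval_fPol lam hε, eigenPol, map_sum, MvPolynomial.smul_eval]
    push_cast
    rfl
  · intro m hm
    rw [f_eq_eval_fPol lam hε]
    rcases alpha_eq_zero_or_fPol_eq_zero (lam := lam) (mu := mu) hm with h | h <;> simp [h]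

theorem finite_alpha_ne_zero (lam mu : ℝ) (n : Fin N → ℤ) :
    {m : Fin N → ℤ | alpha lam mu n m ≠ 0 ∧
      ∃ ε : ℝ, 0 < ε ∧ ∃ x : Fin N → ℝ, f lam ε m x ≠ 0}.Finite := by
  refine (idxSet n).finite_toSet.subset ?_
  rintro m ⟨ha, ε, hε, x, hx⟩
  by_contra hm
  rcases alpha_eq_zero_or_fPol_eq_zero (lam := lam) (mu := mu) hm with h | h
  · exact ha h
  · rw [f_eq_eval_fPol lam hε, h] at hx
    simp at hx

end EigenPol

/-! ### Derivatives of the groundstate -/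

section GroundState

variable {N : ℕ}

theorem hasDerivAt_prod_of_log {ι : Type*} (s : Finset ι) {F : ι → ℝ → ℂ} {a : ι → ℝ} {t : ℝ}
    (h : ∀ i ∈ s, HasDerivAt (F i) ((a i : ℂ) * F i t) t) :
    HasDerivAt (fun τ => ∏ i ∈ s, F i τ) (((∑ i ∈ s, a i : ℝ) : ℂ) * ∏ i ∈ s, F i t) t := by
  classical
  induction s using Finset.induction_on with
  | empty => simpa using hasDerivAt_const t (1 : ℂ)
  | insert i s hi ih =>
    have h1 := (h i (Finset.mem_insert_self i s)).mul
      (ih fun j hj => h j (Finset.mem_insert_of_mem hj))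
    simp only [Finset.prod_insert hi, Finset.sum_insert hi]
    refine h1.congr_deriv ?_
    push_cast
    ring

theorem hasDerivAt_ofReal_cpow_log {c : ℝ} (hc : c ≠ 0) {u : ℝ → ℝ} {u' t : ℝ}
    (hu : HasDerivAt u u' t) (h0 : u t ≠ 0) :
    HasDerivAt (fun τ => (u τ : ℂ) ^ (c : ℂ))
      (((c * (u' / u t) : ℝ) : ℂ) * (u t : ℂ) ^ (c : ℂ)) t := by
  have h1 := HasDerivAt.scomp t (hasDerivAt_ofReal_cpow_const h0 (r := (c : ℂ))
    (by exact_mod_cast hc)) hu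
  refine h1.congr_deriv ?_
  have h2 : (u t : ℂ) ≠ 0 := by exact_mod_cast h0
  rw [Complex.cpow_sub _ _ h2, Complex.cpow_one, Complex.real_smul]
  push_cast
  field_simp

/-- The derivative of the groundstate along a curve. -/
theorem hasDerivAt_groundState_comp {lam mu : ℝ} (hlam : lam ≠ 0) (hmu : mu ≠ 0)
    {u : ℝ → Fin N → ℝ} {u' : Fin N → ℝ} {t : ℝ} (hu : ∀ i, HasDerivAt (fun τ => u τ i) (u' i) t)
    (ht : u t ∈ regularSet N) :
    HasDerivAt (fun τ => groundState lam mu (u τ))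
      (((∑ i, (-(u t i * u' i) + mu * (u' i / u t i)) + ∑ i, ∑ k ∈ Finset.Ioi i,
        lam * ((2 * u t k * u' k - 2 * u t i * u' i) / (u t k ^ 2 - u t i ^ 2)) : ℝ) : ℂ) *
          groundState lam mu (u t)) t := by
  have hsq : ∀ i, HasDerivAt (fun τ => u τ i ^ 2) (2 * u t i * u' i) t := by
    intro i
    simpa using (hu i).fun_pow 2
  have h1 := hasDerivAt_prod_of_log (Finset.univ : Finset (Fin N))
    (F := fun i τ => ((Real.exp (-(u τ i ^ 2) / 2) : ℝ) : ℂ) * ((u τ i : ℝ) : ℂ) ^ (mu : ℂ))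
    (a := fun i => -(u t i * u' i) + mu * (u' i / u t i)) (t := t) (by
      intro i _
      have h2 := ((((hsq i).fun_neg).div_const 2).exp).ofReal_comp
      have h3 := hasDerivAt_ofReal_cpow_log hmu (hu i) (ht.1 i)
      refine (h2.mul h3).congr_deriv ?_
      push_cast
      ring)
  have h2 := hasDerivAt_prod_of_log (Finset.univ : Finset (Fin N))
    (F := fun i τ => ∏ k ∈ Finset.Ioi i, ((u τ k ^ 2 - u τ i ^ 2 : ℝ) : ℂ) ^ (lam : ℂ))
    (a := fun i => ∑ k ∈ Finset.Ioi i,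
      lam * ((2 * u t k * u' k - 2 * u t i * u' i) / (u t k ^ 2 - u t i ^ 2))) (t := t) (by
      intro i _
      refine hasDerivAt_prod_of_log _ fun k hk => ?_
      exact hasDerivAt_ofReal_cpow_log hlam ((hsq k).sub (hsq i))
        (sub_ne_zero.2 (ht.2 k i (Finset.mem_Ioi.1 hk).ne')))
  refine (h1.mul h2).congr_deriv ?_
  simp only [groundState]
  rw [Complex.ofReal_add]
  ring

/-- The logarithmic derivative of the groundstate in the `j`-th coordinate. The term `k = j` is
`0 / 0 = 0`. -/
def logDer (lam mu : ℝ) (j : Fin N) (x : Fin N → ℝ) : ℝ :=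
  -x j + mu / x j + lam * ∑ k, 2 * x j / (x j ^ 2 - x k ^ 2)

theorem hasDerivAt_update_apply (x : Fin N → ℝ) (j i : Fin N) (t : ℝ) :
    HasDerivAt (fun τ => Function.update x j τ i) (if i = j then 1 else 0) t := by
  by_cases h : i = j
  · subst h; simpa using hasDerivAt_id' t
  · simpa [h] using hasDerivAt_const t (x i)

theorem hasDerivAt_groundState {lam mu : ℝ} (hlam : lam ≠ 0) (hmu : mu ≠ 0) (x : Fin N → ℝ)
    (j : Fin N) {t : ℝ} (ht : Function.update x j t ∈ regularSet N) :
    HasDerivAt (fun τ => groundState lam mu (Function.update x j τ))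
      ((logDer lam mu j (Function.update x j t) : ℂ) *
        groundState lam mu (Function.update x j t)) t := by
  refine (hasDerivAt_groundState_comp hlam hmu
    (fun i => hasDerivAt_update_apply x j i t) ht).congr_deriv ?_
  congr 2
  set y := Function.update x j t
  have h1 := sum_sum_eq_sum_Ioi
    (fun i k : Fin N => 2 * y i * (if i = j then 1 else 0) / (y i ^ 2 - y k ^ 2)) (by simp)
  have h2 : ∑ i, ∑ k, 2 * y i * (if i = j then 1 else 0) / (y i ^ 2 - y k ^ 2) =
      ∑ k, 2 * y j / (y j ^ 2 - y k ^ 2) := by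
    rw [Finset.sum_eq_single j]
    · simp
    · intro i _ hi; simp [hi]
    · simp
  simp only [← Finset.mul_sum]
  rw [logDer, ← h2, h1]
  congr 1
  · simp [Finset.sum_add_distrib, div_eq_mul_inv]
  · congr 1
    refine Finset.sum_congr rfl fun i _ => Finset.sum_congr rfl fun k _ => ?_
    rw [show y k ^ 2 - y i ^ 2 = -(y i ^ 2 - y k ^ 2) by ring, div_neg, div_neg, sub_div]
    ring

theorem hasDerivAt_logDer (lam mu : ℝ) {x : Fin N → ℝ} (hx : x ∈ regularSet N) (j : Fin N) :
    HasDerivAt (fun τ => logDer lam mu j (Function.update x j τ))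
      (-1 - mu / x j ^ 2 - lam * ∑ k, 2 * (x j ^ 2 + x k ^ 2) / (x j ^ 2 - x k ^ 2) ^ 2) (x j) := by
  have hj := hasDerivAt_id (x j)
  have h1 : ∀ k, HasDerivAt (fun τ => 2 * Function.update x j τ j /
      (Function.update x j τ j ^ 2 - Function.update x j τ k ^ 2))
      (-(2 * (x j ^ 2 + x k ^ 2) / (x j ^ 2 - x k ^ 2) ^ 2)) (x j) := by
    intro k
    by_cases h : k = j
    · subst h; simpa using hasDerivAt_const (x k) (0 : ℝ)
    · have hne : x j ^ 2 - x k ^ 2 ≠ 0 := sub_ne_zero.2 (hx.2 j k (Ne.symm h))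
      simp only [Function.update_self, Function.update_of_ne h]
      refine ((hj.const_mul 2).fun_div ((hj.fun_pow 2).sub_const (x k ^ 2)) hne).congr_deriv ?_
      simp only [id]
      field_simp
      ring
  have h2 : HasDerivAt (fun τ => ∑ k, 2 * Function.update x j τ j /
      (Function.update x j τ j ^ 2 - Function.update x j τ k ^ 2))
      (∑ k, -(2 * (x j ^ 2 + x k ^ 2) / (x j ^ 2 - x k ^ 2) ^ 2)) (x j) :=
    HasDerivAt.fun_sum fun k _ => h1 k
  have h3 : HasDerivAt (fun τ => -Function.update x j τ j + mu / Function.update x j τ j)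
      (-1 - mu / x j ^ 2) (x j) := by
    simp only [Function.update_self]
    refine (hj.fun_neg.fun_add ((hasDerivAt_const (x j) mu).fun_div hj (hx.1 j))).congr_deriv ?_
    simp only [id]
    ring
  refine (h3.fun_add (h2.const_mul lam)).congr_deriv ?_
  rw [Finset.sum_neg_distrib]
  ring

theorem isOpen_regularSet (N : ℕ) : IsOpen (regularSet N) := by
  have h : regularSet N = (⋂ j, {x | x j ≠ 0}) ∩
      ⋂ j, ⋂ k, ⋂ _ : j ≠ k, {x | x j ^ 2 ≠ x k ^ 2} := by
    ext x; simp [regularSet]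
  rw [h]
  refine (isOpen_iInter_of_finite fun j => ?_).inter (isOpen_iInter_of_finite fun j =>
    isOpen_iInter_of_finite fun k => isOpen_iInter_of_finite fun _ => ?_)
  · exact isOpen_ne_fun (continuous_apply j) continuous_const
  · exact isOpen_ne_fun ((continuous_apply j).pow 2) ((continuous_apply k).pow 2)

/-- For a negative base the principal power is a constant phase times the power of `-t`. -/
theorem contDiffAt_ofReal_cpow (c : ℝ) {t : ℝ} (ht : t ≠ 0) :
    ContDiffAt ℝ 2 (fun τ : ℝ => (τ : ℂ) ^ (c : ℂ)) t := by
  have hpos : ∀ {t : ℝ}, 0 < t → ContDiffAt ℝ 2 (fun τ : ℝ => (τ : ℂ) ^ (c : ℂ)) t := by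
    intro t ht
    have h1 : ContDiffAt ℝ 2 (fun τ : ℝ => ((τ ^ c : ℝ) : ℂ)) t :=
      Complex.ofRealCLM.contDiff.contDiffAt.comp t (Real.contDiffAt_rpow_const_of_ne ht.ne')
    refine h1.congr_of_eventuallyEq ?_
    filter_upwards [lt_mem_nhds ht] with τ hτ
    rw [Complex.ofReal_cpow hτ.le]
  rcases lt_or_gt_of_ne ht with h | h
  · have h1 : ContDiffAt ℝ 2 (fun τ : ℝ => ((-τ : ℝ) : ℂ) ^ (c : ℂ) *
        Complex.exp (Real.pi * Complex.I * c)) t :=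
      ((hpos (neg_pos.2 h)).comp t contDiffAt_id.neg).mul contDiffAt_const
    refine h1.congr_of_eventuallyEq ?_
    filter_upwards [gt_mem_nhds h] with τ hτ
    rw [Complex.ofReal_cpow_of_nonpos hτ.le, Complex.ofReal_neg]
  · exact hpos h

theorem contDiffOn_groundState (lam mu : ℝ) :
    ContDiffOn ℝ 2 (groundState lam mu) (regularSet N) := by
  intro x hx
  refine ContDiffAt.contDiffWithinAt ?_
  unfold groundState
  have hc : ∀ i, ContDiffAt ℝ 2 (fun y : Fin N → ℝ => y i) x := fun i =>
    contDiffAt_apply ..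
  refine ContDiffAt.mul (contDiffAt_prod fun i _ => ContDiffAt.mul ?_ ?_)
    (contDiffAt_prod fun i _ => contDiffAt_prod fun k hk => ?_)
  · exact Complex.ofRealCLM.contDiff.contDiffAt.comp x ((((hc i).pow 2).neg).div_const 2).exp
  · exact (contDiffAt_ofReal_cpow mu (hx.1 i)).comp x (hc i)
  · exact (contDiffAt_ofReal_cpow lam
      (sub_ne_zero.2 (hx.2 k i (Finset.mem_Ioi.1 hk).ne'))).comp x
        (((hc k).pow 2).sub ((hc i).pow 2))

end GroundState

/-! ### Conjugation of the Hamiltonian with the groundstate -/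

section Conjugation

variable {N : ℕ}

theorem hasDerivAt_eval {σ : Type*} [Fintype σ] {v : ℝ → σ → ℝ} {v' : σ → ℝ} {t : ℝ}
    (hv : ∀ i, HasDerivAt (fun τ => v τ i) (v' i) t) (p : MvPolynomial σ ℝ) :
    HasDerivAt (fun τ => MvPolynomial.eval (v τ) p)
      (∑ i, v' i * MvPolynomial.eval (v t) (MvPolynomial.pderiv i p)) t := by
  classical
  induction p using MvPolynomial.induction_on with
  | C a => simpa using hasDerivAt_const t a
  | add p q hp hq =>
    simp only [map_add, mul_add, Finset.sum_add_distrib]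
    exact hp.fun_add hq
  | mul_X p k hp =>
    simp only [map_mul, MvPolynomial.eval_X]
    refine (hp.fun_mul (hv k)).congr_deriv ?_
    simp only [Derivation.leibniz, MvPolynomial.pderiv_X, smul_eq_mul, map_add, map_mul,
      MvPolynomial.eval_X, mul_add, Finset.sum_add_distrib]
    rw [add_comm]
    congr 1
    · rw [Finset.sum_eq_single k]
      · simp [mul_comm]
      · intro i _ hi; simp [hi.symm]
      · simp
    · rw [Finset.sum_mul]
      exact Finset.sum_congr rfl fun i _ => by ring

theorem hasDerivAt_eval_sq (x : Fin N → ℝ) (j : Fin N) (p : Pol N) (t : ℝ) :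
    HasDerivAt (fun τ => MvPolynomial.eval (fun i => Function.update x j τ i ^ 2) p)
      (2 * t * MvPolynomial.eval (fun i => Function.update x j t i ^ 2)
        (MvPolynomial.pderiv j p)) t := by
  refine (hasDerivAt_eval (v := fun τ i => Function.update x j τ i ^ 2)
    (v' := fun i => if i = j then 2 * t else 0) (fun i => ?_) p).congr_deriv ?_
  · by_cases h : i = j
    · subst h; simpa using (hasDerivAt_id' t).fun_pow 2
    · simpa [h] using hasDerivAt_const t (x i ^ 2)
  · rw [Finset.sum_eq_single j]
    · simp
    · intro i _ hi; simp [hi]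
    · simp

/-- The second derivatives of the groundstate times a polynomial in the squared variables. -/
theorem partialSq_groundState_mul {lam mu : ℝ} (hlam : lam ≠ 0) (hmu : mu ≠ 0) {x : Fin N → ℝ}
    (hx : x ∈ regularSet N) (p : Pol N) (j : Fin N) :
    partialSq j (fun y => groundState lam mu y *
        ((MvPolynomial.eval (fun i => y i ^ 2) p : ℝ) : ℂ)) x =
      groundState lam mu x *
        (((logDer lam mu j x ^ 2 + (-1 - mu / x j ^ 2 -
            lam * ∑ k, 2 * (x j ^ 2 + x k ^ 2) / (x j ^ 2 - x k ^ 2) ^ 2)) *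
              MvPolynomial.eval (fun i => x i ^ 2) p +
          2 * logDer lam mu j x * (2 * x j *
            MvPolynomial.eval (fun i => x i ^ 2) (MvPolynomial.pderiv j p)) +
          (2 * MvPolynomial.eval (fun i => x i ^ 2) (MvPolynomial.pderiv j p) +
            4 * x j ^ 2 * MvPolynomial.eval (fun i => x i ^ 2)
              (MvPolynomial.pderiv j (MvPolynomial.pderiv j p))) : ℝ) : ℂ) := by
  let u : ℝ → Fin N → ℝ := fun τ => Function.update x j τ
  let F : ℝ → ℝ := fun τ => logDer lam mu j (u τ) * MvPolynomial.eval (fun i => u τ i ^ 2) p +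
    2 * τ * MvPolynomial.eval (fun i => u τ i ^ 2) (MvPolynomial.pderiv j p)
  have h0 : u (x j) = x := Function.update_eq_self j x
  have h1 : ∀ τ, u τ ∈ regularSet N → HasDerivAt (fun τ => groundState lam mu (u τ) *
      ((MvPolynomial.eval (fun i => u τ i ^ 2) p : ℝ) : ℂ))
      (groundState lam mu (u τ) * (F τ : ℂ)) τ := by
    intro τ hτ
    refine ((hasDerivAt_groundState hlam hmu x j hτ).fun_mul
      (hasDerivAt_eval_sq x j p τ).ofReal_comp).congr_deriv ?_
    simp only [F, u]
    push_cast
    ring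
  have hev : deriv (fun τ => groundState lam mu (u τ) *
      ((MvPolynomial.eval (fun i => u τ i ^ 2) p : ℝ) : ℂ)) =ᶠ[nhds (x j)]
      fun τ => groundState lam mu (u τ) * (F τ : ℂ) := by
    have hcont : Continuous u := continuous_const.update j continuous_id
    have hmem : u ⁻¹' regularSet N ∈ nhds (x j) :=
      hcont.continuousAt.preimage_mem_nhds ((isOpen_regularSet N).mem_nhds (by rwa [h0]))
    filter_upwards [hmem] with τ hτ
    exact (h1 τ hτ).deriv
  have hF := (((hasDerivAt_logDer lam mu hx j).fun_mul (hasDerivAt_eval_sq x j p (x j))).fun_add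
    (((hasDerivAt_id' (x j)).const_mul 2).fun_mul
      (hasDerivAt_eval_sq x j (MvPolynomial.pderiv j p) (x j)))).ofReal_comp
  have hgs := hasDerivAt_groundState hlam hmu x j (t := x j) (by rwa [Function.update_eq_self])
  have h2 := hgs.fun_mul hF
  rw [partialSq, iteratedDeriv_succ, iteratedDeriv_one, hev.deriv_eq]
  refine h2.deriv.trans ?_
  simp only [Function.update_eq_self]
  push_cast
  ring

theorem sum_sum_div_sub (z : Fin N → ℝ) (hz : Function.Injective z) :
    ∑ j, ∑ k, z j / (z j - z k) = (N : ℝ) * ((N : ℝ) - 1) / 2 := by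
  have h1 : ∑ j, ∑ k, (z j + z k) / (z j - z k) = 0 :=
    sum_sum_eq_zero_of_antisymm _ fun j k => by
      rw [← neg_sub (z j) (z k), div_neg, add_comm (z k)]; ring
  have h2 : ∀ j k, (z j + z k) / (z j - z k) = 2 * (z j / (z j - z k)) - 1 +
      if j = k then 1 else 0 := by
    intro j k
    by_cases h : j = k
    · subst h; simp
    · have : z j - z k ≠ 0 := sub_ne_zero.2 (hz.ne h)
      rw [if_neg h]
      field_simp
      ring
  simp only [h2, Finset.sum_add_distrib, Finset.sum_sub_distrib, ← Finset.mul_sum,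
    Finset.sum_ite_eq, Finset.mem_univ, if_true, Finset.sum_const, Finset.card_univ,
    Fintype.card_fin, nsmul_eq_mul, mul_one] at h1
  linarith

/-- The three-body cancellation for `1 / (z_j - z_k)`, which is `sum_mul_sum_sq` for `t = 1 / z`. -/
theorem sum_mul_sum_inv_sub_sq (z : Fin N → ℝ) (hz : Function.Injective z) (h0 : ∀ j, z j ≠ 0) :
    ∑ j, z j * (∑ k, 1 / (z j - z k)) ^ 2 = ∑ j, ∑ k, z j / (z j - z k) ^ 2 := by
  have h := sum_mul_sum_sq (S := ℝ) (fun j => (z j)⁻¹) (fun l k => z l / (z k - z l))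
    (inv_injective.comp hz) (by simp) (by
      intro l k hlk
      have h1 : z k - z l ≠ 0 := sub_ne_zero.2 (hz.ne (Ne.symm hlk))
      have h2 := h0 l
      have h3 := h0 k
      field_simp)
  have h1 : ∀ l, (z l)⁻¹ * (∑ k, z l / (z k - z l)) ^ 2 = z l * (∑ k, 1 / (z l - z k)) ^ 2 := by
    intro l
    have h2 : ∑ k, z l / (z k - z l) = -(z l * ∑ k, 1 / (z l - z k)) := by
      rw [Finset.mul_sum, ← Finset.sum_neg_distrib]
      refine Finset.sum_congr rfl fun k _ => ?_
      rw [← neg_sub (z l) (z k), div_neg, mul_one_div]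
    have h3 := h0 l
    rw [h2]
    field_simp
  have h2 : ∀ l k, (z l)⁻¹ * (z l / (z k - z l)) ^ 2 = z l / (z l - z k) ^ 2 := by
    intro l k
    have h3 := h0 l
    rw [← neg_sub (z l) (z k), div_neg, neg_sq, div_pow]
    field_simp
  simpa only [h1, h2] using h

/-- The potential minus the sum of the `∂_j² ψ_0 / ψ_0` is constant, namely the energy of the
groundstate. -/
theorem sum_logDer_sq (lam mu : ℝ) {x : Fin N → ℝ} (hx : x ∈ regularSet N) :
    ∑ j, (-(logDer lam mu j x ^ 2 + (-1 - mu / x j ^ 2 -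
            lam * ∑ k, 2 * (x j ^ 2 + x k ^ 2) / (x j ^ 2 - x k ^ 2) ^ 2)) +
        (x j ^ 2 + mu * (mu - 1) / x j ^ 2)) +
      4 * lam * (lam - 1) *
        ∑ j, ∑ k ∈ Finset.Ioi j, (x j ^ 2 + x k ^ 2) / (x j ^ 2 - x k ^ 2) ^ 2 =
      (N : ℝ) * (1 + 2 * mu + 2 * lam * ((N : ℝ) - 1)) := by
  set z : Fin N → ℝ := fun j => x j ^ 2 with hzdef
  have hz : Function.Injective z := fun j k h => by
    by_contra hne
    exact hx.2 j k hne h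
  have hz0 : ∀ j, z j ≠ 0 := fun j => pow_ne_zero 2 (hx.1 j)
  have h1 : ∑ j, ∑ k, 1 / (z j - z k) = 0 :=
    sum_sum_eq_zero_of_antisymm _ fun j k => by rw [← neg_sub (z j) (z k), div_neg]; ring
  have h2 : ∑ j, z j * ∑ k, 1 / (z j - z k) = (N : ℝ) * ((N : ℝ) - 1) / 2 := by
    rw [← sum_sum_div_sub z hz]
    simp only [Finset.mul_sum, mul_one_div]
  have h3 := sum_mul_sum_inv_sub_sq z hz hz0
  have h4 := sum_sum_eq_sum_Ioi (fun j k => z j / (z j - z k) ^ 2) (by simp)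
  have h5 : ∑ j, ∑ k ∈ Finset.Ioi j, (z j + z k) / (z j - z k) ^ 2 =
      ∑ j, ∑ k, z j / (z j - z k) ^ 2 := by
    rw [h4]
    refine Finset.sum_congr rfl fun j _ => Finset.sum_congr rfl fun k _ => ?_
    rw [← neg_sub (z j) (z k), neg_sq, add_div]
  have h6 : ∑ j, ∑ k, 2 * (z j + z k) / (z j - z k) ^ 2 =
      4 * ∑ j, ∑ k, z j / (z j - z k) ^ 2 := by
    have h7 : ∑ j, ∑ k, z k / (z j - z k) ^ 2 = ∑ j, ∑ k, z j / (z j - z k) ^ 2 := by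
      rw [Finset.sum_comm]
      refine Finset.sum_congr rfl fun j _ => Finset.sum_congr rfl fun k _ => ?_
      rw [← neg_sub (z j) (z k), neg_sq]
    have h8 : ∀ j k, 2 * (z j + z k) / (z j - z k) ^ 2 =
        2 * (z j / (z j - z k) ^ 2) + 2 * (z k / (z j - z k) ^ 2) := fun j k => by ring
    simp only [h8, Finset.sum_add_distrib, ← Finset.mul_sum]
    rw [h7]; ring
  have h9 : ∀ j, -(logDer lam mu j x ^ 2 + (-1 - mu / z j -
        lam * ∑ k, 2 * (z j + z k) / (z j - z k) ^ 2)) + (z j + mu * (mu - 1) / z j) =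
      (1 + 2 * mu) + 4 * lam * (z j * ∑ k, 1 / (z j - z k)) -
        4 * lam * mu * ∑ k, 1 / (z j - z k) - 4 * lam ^ 2 * (z j * (∑ k, 1 / (z j - z k)) ^ 2) +
        lam * ∑ k, 2 * (z j + z k) / (z j - z k) ^ 2 := by
    intro j
    have h10 : ∑ k, 2 * x j / (x j ^ 2 - x k ^ 2) = 2 * x j * ∑ k, 1 / (z j - z k) := by
      simp only [Finset.mul_sum, mul_one_div, hzdef]
    rw [logDer, h10]
    generalize ∑ k, 1 / (z j - z k) = S
    generalize ∑ k, 2 * (z j + z k) / (z j - z k) ^ 2 = T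
    have := hx.1 j
    simp only [hzdef]
    field_simp
    ring
  change ∑ j, (-(logDer lam mu j x ^ 2 + (-1 - mu / z j -
        lam * ∑ k, 2 * (z j + z k) / (z j - z k) ^ 2)) + (z j + mu * (mu - 1) / z j)) +
      4 * lam * (lam - 1) * ∑ j, ∑ k ∈ Finset.Ioi j, (z j + z k) / (z j - z k) ^ 2 = _
  simp only [h9, Finset.sum_add_distrib, Finset.sum_sub_distrib, ← Finset.mul_sum]
  rw [h1, h2, h3, h5, h6]
  simp only [Finset.sum_const, Finset.card_univ, Fintype.card_fin, nsmul_eq_mul]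
  ring

/-- On polynomials in `z_j = x_j ^ 2`, the Hamiltonian conjugated with the groundstate acts as
`4 ∑ z_j ∂_j - 4 zOp` plus the energy of the groundstate. -/
theorem hamiltonian_groundState_mul {lam mu : ℝ} (hlam : lam ≠ 0) (hmu : mu ≠ 0)
    {x : Fin N → ℝ} (hx : x ∈ regularSet N) (p : Pol N) :
    hamiltonian lam mu (fun y => groundState lam mu y *
        ((MvPolynomial.eval (fun i => y i ^ 2) p : ℝ) : ℂ)) x =
      groundState lam mu x *
        (((4 * ∑ j, x j ^ 2 * MvPolynomial.eval (fun i => x i ^ 2) (MvPolynomial.pderiv j p) -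
          4 * zOp lam (mu + 1 / 2) (fun i => x i ^ 2) p) +
          (N : ℝ) * (1 + 2 * mu + 2 * lam * ((N : ℝ) - 1)) *
            MvPolynomial.eval (fun i => x i ^ 2) p : ℝ) : ℂ) := by
  rw [← sum_logDer_sq lam mu hx, zOp]
  set q := MvPolynomial.eval (fun i => x i ^ 2) p
  set q₁ := fun j => MvPolynomial.eval (fun i => x i ^ 2) (MvPolynomial.pderiv j p)
  set q₂ := fun j => MvPolynomial.eval (fun i => x i ^ 2)
    (MvPolynomial.pderiv j (MvPolynomial.pderiv j p))
  set V := 4 * lam * (lam - 1) *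
        ∑ j, ∑ k ∈ Finset.Ioi j, (x j ^ 2 + x k ^ 2) / (x j ^ 2 - x k ^ 2) ^ 2
  set A : Fin N → ℝ := fun j => logDer lam mu j x ^ 2 + (-1 - mu / x j ^ 2 -
            lam * ∑ k, 2 * (x j ^ 2 + x k ^ 2) / (x j ^ 2 - x k ^ 2) ^ 2)
  set B : Fin N → ℝ := fun j => x j ^ 2 + mu * (mu - 1) / x j ^ 2
  have h1 : ∀ j, logDer lam mu j x * x j = -x j ^ 2 + mu +
      2 * lam * ∑ k, x j ^ 2 / (x j ^ 2 - x k ^ 2) := by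
    intro j
    have h2 : ∑ k, 2 * x j / (x j ^ 2 - x k ^ 2) = 2 * x j * ∑ k, 1 / (x j ^ 2 - x k ^ 2) := by
      simp only [Finset.mul_sum, mul_one_div]
    have h3 : ∑ k, x j ^ 2 / (x j ^ 2 - x k ^ 2) = x j ^ 2 * ∑ k, 1 / (x j ^ 2 - x k ^ 2) := by
      simp only [Finset.mul_sum, mul_one_div]
    rw [logDer, h2, h3]
    have := hx.1 j
    field_simp
  have key : (∑ j, (-(A j * q + 2 * logDer lam mu j x * (2 * x j * q₁ j) +
      (2 * q₁ j + 4 * x j ^ 2 * q₂ j)) + B j * q)) + V * q =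
      4 * ∑ j, x j ^ 2 * q₁ j - 4 * (∑ j, x j ^ 2 * q₂ j + (mu + 1 / 2) * ∑ j, q₁ j +
        2 * lam * ∑ i, ∑ j, x i ^ 2 / (x i ^ 2 - x j ^ 2) * q₁ i) +
      (∑ j, (-A j + B j) + V) * q := by
    have h4 : ∀ j, -(A j * q + 2 * logDer lam mu j x * (2 * x j * q₁ j) +
        (2 * q₁ j + 4 * x j ^ 2 * q₂ j)) + B j * q =
        4 * (x j ^ 2 * q₁ j) - 4 * (x j ^ 2 * q₂ j + (mu + 1 / 2) * q₁ j +
          2 * lam * ∑ k, x j ^ 2 / (x j ^ 2 - x k ^ 2) * q₁ j) + (-A j + B j) * q := by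
      intro j
      rw [← Finset.sum_mul]
      linear_combination (-4 * q₁ j) * h1 j
    rw [Finset.sum_congr rfl fun j _ => h4 j]
    simp only [Finset.sum_add_distrib, Finset.sum_sub_distrib, ← Finset.mul_sum, ← Finset.sum_mul]
    ring
  have hP : ∀ j, partialSq j (fun y => groundState lam mu y *
      ((MvPolynomial.eval (fun i => y i ^ 2) p : ℝ) : ℂ)) x = groundState lam mu x *
        ((A j * q + 2 * logDer lam mu j x * (2 * x j * q₁ j) +
          (2 * q₁ j + 4 * x j ^ 2 * q₂ j) : ℝ) : ℂ) :=
    fun j => partialSq_groundState_mul hlam hmu hx p j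
  refine Eq.trans ?_ (congrArg (fun r : ℝ => groundState lam mu x * (r : ℂ)) key)
  rw [hamiltonian]
  simp only [hP]
  change ∑ j, (-(groundState lam mu x * ((A j * q + 2 * logDer lam mu j x * (2 * x j * q₁ j) +
    (2 * q₁ j + 4 * x j ^ 2 * q₂ j) : ℝ) : ℂ)) + (B j : ℂ) * (groundState lam mu x * (q : ℂ))) +
      (V : ℂ) * (groundState lam mu x * (q : ℂ)) = _
  clear_value q q₁ q₂ V A B
  push_cast
  rw [mul_add, Finset.mul_sum]
  congr 1
  · refine Finset.sum_congr rfl fun j _ => ?_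
    ring
  · ring

theorem solvesSchroedinger_eigenPol {lam mu : ℝ} (hlam : lam ≠ 0) (hmu : mu ≠ 0)
    (n : Fin N → ℤ) :
    SolvesSchroedinger lam mu (energy lam mu n) (fun x => groundState lam mu x *
      ((MvPolynomial.eval (fun j => x j ^ 2) (eigenPol lam mu n) : ℝ) : ℂ)) := by
  refine ⟨(contDiffOn_groundState lam mu).mul ?_, fun x hx => ?_⟩
  · have h1 : ContDiff ℝ 2 fun y : Fin N → ℝ => MvPolynomial.eval y (eigenPol lam mu n) :=
      (AnalyticOnNhd.eval_mvPolynomial (𝕜 := ℝ) (eigenPol lam mu n)).contDiff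
    have h2 : ContDiff ℝ 2 fun x : Fin N → ℝ => fun j => x j ^ 2 :=
      contDiff_pi.2 fun j => (contDiff_apply ℝ ℝ j).pow 2
    exact (Complex.ofRealCLM.contDiff.comp (h1.comp h2)).contDiffOn
  · have hz : Function.Injective fun j => x j ^ 2 := fun j k h => by
      by_contra hne
      exact hx.2 j k hne h
    rw [hamiltonian_groundState_mul hlam hmu hx, eigenPol_equation lam mu n _ hz, energy]
    push_cast
    ring

end Conjugation

end CalogeroBN

end

theorem mainTheorem5 (N : ℕ) (hN : 1 ≤ N) (lam mu : ℝ) (hlam : 0 < lam) (hmu : 0 < mu)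
    (n : Fin N → ℤ) :
    -- all sums are finite
    (∀ m : Fin N → ℤ,
      {t : Σ s : ℕ, (Fin s → CalogeroBN.IdxPair N) × (Fin s → ℕ) |
        CalogeroBN.alphaTerm lam mu n m t.1 t.2.1 t.2.2 ≠ 0}.Finite) ∧
    {m : Fin N → ℤ | CalogeroBN.alpha lam mu n m ≠ 0 ∧
      ∃ ε : ℝ, 0 < ε ∧ ∃ x : Fin N → ℝ, CalogeroBN.f lam ε m x ≠ 0}.Finite ∧
    -- `P_n` is a symmetric polynomial in the squares, independent of `ε`,
    -- and non-zero if `n` is a partition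
    (∃ p : MvPolynomial (Fin N) ℝ, p.IsSymmetric ∧
      (∀ ε : ℝ, 0 < ε → ∀ x : Fin N → ℝ,
        CalogeroBN.P lam mu ε n x = ((MvPolynomial.eval (fun j => x j ^ 2) p : ℝ) : ℂ)) ∧
      (Antitone n → (∀ j, 0 ≤ n j) → p ≠ 0)) ∧
    -- `ψ_0 P_n` satisfies the eigenvalue equation with eigenvalue `E_n`
    (∀ ε : ℝ, 0 < ε →
      CalogeroBN.SolvesSchroedinger lam mu (CalogeroBN.energy lam mu n)
        (fun x => CalogeroBN.groundState lam mu x * CalogeroBN.P lam mu ε n x)) := by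
  refine ⟨CalogeroBN.finite_alphaTerm_ne_zero lam mu n, CalogeroBN.finite_alpha_ne_zero lam mu n,
    ⟨CalogeroBN.eigenPol lam mu n, CalogeroBN.isSymmetric_eigenPol lam mu n,
      fun ε hε x => CalogeroBN.P_eq_eval_eigenPol lam mu hε n x,
      CalogeroBN.eigenPol_ne_zero hlam mu hN⟩, fun ε hε => ?_⟩
  simp only [CalogeroBN.P_eq_eval_eigenPol lam mu hε]
  exact CalogeroBN.solvesSchroedinger_eigenPol hlam.ne' hmu.ne' n
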